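/- **Notation.** Let $\tilde{\mathcal A}=\{\sum_{\nu\ge 0}P_\nu(a)\,b^\nu : P_\nu\in\mathbb C[z]\}$ be the $\mathbb C$-algebra with $ab-ba=b^2$ in which left and right multiplication by $a$ are continuous for the $b$-adic topology. An *(a,b)-module* is a left $\tilde{\mathcal A}$-module $E$ that is free of finite type over $\mathbb C[[b]]\subset\tilde{\mathcal A}$. It is *monogenic* if $E\simeq\tilde{\mathcal A}/I$ for a left ideal $I$. Let $E^\sharp\subset E[b^{-1}]$ be the saturation of $E$ under $b^{-1}a$, i.e. the smallest $\mathbb C[[b]]$-submodule containing $E$ and stable under $b^{-1}a$. The (a,b)-module $E$ is *regular* if $E^\sharp$ is of finite type over $\mathbb C[[b]]$, and a regular $E$ is *geometric* if all eigenvalues of $b^{-1}a$ on $E^\sharp/bE^\sharp$ are positive rational numbers. For $n\in\mathbb N$ let $\Xi_n$ be the set of formal series $$\varphi=\sum_{j=0}^{n}\sum_{\alpha\in A}T_{\alpha,j}(s)\,s^\alpha\frac{(\log s)^j}{j!},\qquad A\subset\mathbb Q\cap\,]-1,+\infty[\ \text{ finite},\quad T_{\alpha,j}\in\mathbb C[[s]],$$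 a left $\tilde{\mathcal A}$-module in which $a$ is multiplication by $s$ and $b$ is the primitive without constant term. For a complex vector space $V$, $\tilde{\mathcal A}$ acts on $\Xi_n\otimes_{\mathbb C}V$ through the first factor. A *canonical writing* of $\varphi\in\Xi_n$ is an expression $\varphi=\sum_{(\alpha,j)\in A}S_{\alpha,j}(b)\,s^\alpha\frac{(\log s)^j}{j!}$ with $A\subset(\mathbb Q\cap\,]-1,+\infty[)\times\{0,\dots,n\}$ finite and $S_{\alpha,j}\in\mathbb C[[b]]$ such that 1. if $(\alpha,j)\in A$ and $0\le i\le j$ then $(\alpha,i)\in A$; 2. for $(\alpha,j)\in A$, either $S_{\alpha,j}=0$ or $S_{\alpha,j}(0)\ne0$; 3. for $(\alpha,j)\in A$ there is $k\ge j$ with $(\alpha,k)\in A$ and $S_{\alpha,k}(0)\neq0$; 4. if $(\alpha,j)\in A$, $S_{\alpha,j}\ne0$, $p\ge1$ is an integer and $(\alpha+p,j)\in A$, then $S_{\alpha+p,j}=0$. **Theorem.** 1. For every $n$ and every $\varphi\in\Xi_n$, the submodule $\tilde{\mathcal A}\varphi\subset\Xi_n$ is a monogenic geometric regular (a,b)-module.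 2. Every $\varphi\in\Xi_n$ has a canonical writing for which, $A$ denoting its index set, there are polynomials $T_{\alpha,j}\in\mathbb C[b]$, $(\alpha,j)\in A$, with $T_{\alpha,j}(0)\neq 0$, such that for $\psi=\sum_{(\alpha,j)\in A}T_{\alpha,j}(b)\,s^\alpha(\log s)^j\in\Xi_n$ the $\tilde{\mathcal A}$-modules $\tilde{\mathcal A}\psi$ and $\tilde{\mathcal A}\varphi$ are isomorphic. 3. For every geometric regular (a,b)-module $E$ there are $n\in\mathbb N$, a finite-dimensional complex vector space $V$ and an injective $\tilde{\mathcal A}$-linear map $E\to\Xi_n\otimes_{\mathbb C}V$. -/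

import Mathlib

namespace AB

open Polynomial

noncomputable section

/-! ### The algebra `Ã`

An element `∑_ν P_ν(a) b^ν` of `Ã`, with `P_ν ∈ ℂ[z]`, is the sequence `ν ↦ P_ν`. -/

/-- The algebra `Ã = { ∑_ν P_ν(a) b^ν }`, with `a b - b a = b²`. -/
def ATilde : Type := ℕ → ℂ[X]

namespace ATilde

instance : AddCommGroup ATilde := inferInstanceAs (AddCommGroup (ℕ → ℂ[X]))
instance : Module ℂ ATilde := inferInstanceAs (Module ℂ (ℕ → ℂ[X]))

/-- The polynomial `P_ν` of the element `∑_ν P_ν(a) b^ν`. -/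
def coeff (x : ATilde) (ν : ℕ) : ℂ[X] := x ν

@[ext] theorem ext {x y : ATilde} (h : ∀ m, x.coeff m = y.coeff m) : x = y := funext h

/-- The element `∑_ν P_ν(a) b^ν`. -/
def mk (P : ℕ → ℂ[X]) : ATilde := P

@[simp] theorem coeff_mk (P : ℕ → ℂ[X]) (m : ℕ) : (mk P).coeff m = P m := rfl
@[simp] theorem coeff_add (x y : ATilde) (m : ℕ) : (x + y).coeff m = x.coeff m + y.coeff m := rfl
@[simp] theorem coeff_sub (x y : ATilde) (m : ℕ) : (x - y).coeff m = x.coeff m - y.coeff m := rfl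
@[simp] theorem coeff_zero (m : ℕ) : (0 : ATilde).coeff m = 0 := rfl
@[simp] theorem coeff_smul (c : ℂ) (x : ATilde) (m : ℕ) : (c • x).coeff m = c • x.coeff m := rfl

/-- The coefficients of `b y`.  In `Ã` one has `b P(a) = P(a) b - b P'(a) b`, that is
`b P(a) = ∑_k (-1)^k P^{(k)}(a) b^{k+1}`; so `u = b y` is given by
`u_0 = 0`, `u_{m+1} = y_m - (u_m)'`. -/
def bMulCoeff (y : ATilde) : ℕ → ℂ[X]
  | 0 => 0
  | m + 1 => y.coeff m - derivative (bMulCoeff y m)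

/-- Left multiplication by `b`. -/
def bMul : Module.End ℂ ATilde where
  toFun y := mk (bMulCoeff y)
  map_add' x y := by
    ext1 m
    induction m with
    | zero => simp [bMulCoeff]
    | succ m ih =>
      simp only [coeff_mk, coeff_add] at ih
      simp [bMulCoeff, ih]
      ring
  map_smul' c x := by
    ext1 m
    induction m with
    | zero => simp [bMulCoeff]
    | succ m ih =>
      simp only [coeff_mk, coeff_smul, RingHom.id_apply] at ih
      simp [bMulCoeff, ih, smul_sub]

@[simp] theorem coeff_bMul_zero (y : ATilde) : (bMul y).coeff 0 = 0 := rfl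
@[simp] theorem coeff_bMul_succ (y : ATilde) (m : ℕ) :
    (bMul y).coeff (m + 1) = y.coeff m - derivative ((bMul y).coeff m) := rfl

/-- Left multiplication by `a`. -/
def aMul : Module.End ℂ ATilde where
  toFun y := mk fun m => X * y.coeff m
  map_add' x y := by ext1 m; simp [mul_add]
  map_smul' c x := by ext1 m; simp

@[simp] theorem coeff_aMul (y : ATilde) (m : ℕ) : (aMul y).coeff m = X * y.coeff m := rfl

theorem coeff_aeval_aMul (P : ℂ[X]) (y : ATilde) (m : ℕ) :
    (aeval aMul P y).coeff m = P * y.coeff m := by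
  induction P using Polynomial.induction_on' generalizing y with
  | add p q hp hq => simp [hp, hq, add_mul]
  | monomial k c =>
    rw [aeval_monomial]
    have : ∀ y : ATilde, ((aMul ^ k) y).coeff m = X ^ k * y.coeff m := by
      induction k with
      | zero => intro y; simp
      | succ k ih => intro y; rw [pow_succ, Module.End.mul_apply, ih]; simp; ring
    simp [this, Module.algebraMap_end_apply, ← C_mul_X_pow_eq_monomial, smul_eq_C_mul, mul_assoc]

theorem aMul_bMul : aMul * bMul - bMul * aMul = bMul * bMul := by
  refine LinearMap.ext fun y => ?_
  ext1 m
  induction m with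
  | zero => simp
  | succ m ih =>
    simp only [LinearMap.sub_apply, Module.End.mul_apply, coeff_sub, coeff_aMul] at ih
    have h : (bMul (aMul y)).coeff m = X * (bMul y).coeff m - (bMul (bMul y)).coeff m := by
      rw [← ih]; ring
    simp [h, derivative_mul]
    ring

/-- The product of `Ã`: `(∑_ν P_ν(a) b^ν) y = ∑_ν P_ν(a) (b^ν y)`. -/
instance : Mul ATilde :=
  ⟨fun x y => mk fun m => ∑ ν ∈ Finset.range (m + 1), x.coeff ν * ((bMul ^ ν) y).coeff m⟩

instance : One ATilde := ⟨mk fun m => if m = 0 then 1 else 0⟩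

/-- The element `a` of `Ã`. -/
def a : ATilde := mk fun m => if m = 0 then X else 0

/-- The element `b` of `Ã`. -/
def b : ATilde := mk fun m => if m = 1 then 1 else 0

theorem coeff_mul (x y : ATilde) (m : ℕ) :
    (x * y).coeff m = ∑ ν ∈ Finset.range (m + 1), x.coeff ν * ((bMul ^ ν) y).coeff m := rfl

theorem coeff_one (m : ℕ) : (1 : ATilde).coeff m = if m = 0 then 1 else 0 := rfl

theorem coeff_bMul_pow_of_lt (y : ATilde) {ν m : ℕ} (h : m < ν) : ((bMul ^ ν) y).coeff m = 0 := by
  induction ν generalizing m with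
  | zero => omega
  | succ ν ih =>
    rw [pow_succ', Module.End.mul_apply]
    induction m with
    | zero => simp
    | succ m ihm => rw [coeff_bMul_succ, ihm (by omega), ih (by omega)]; simp

/-! ### Modules from a pair of operators

The facts below are used to check the ring axioms of `Ã` and the module axioms of the
space of formal series in `s` and `log s`. -/

section act

variable {M : Type*} [AddCommGroup M] [Module ℂ M] (A B : Module.End ℂ M)

/-- The operator `∑_{ν < N} P_ν(A) B^ν`. -/
def partialAct (N : ℕ) (x : ATilde) : Module.End ℂ M :=
  ∑ ν ∈ Finset.range N, aeval A (x.coeff ν) * B ^ ν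

theorem partialAct_add (N : ℕ) (x y : ATilde) :
    partialAct A B N (x + y) = partialAct A B N x + partialAct A B N y := by
  simp [partialAct, add_mul, Finset.sum_add_distrib]

theorem partialAct_smul (N : ℕ) (c : ℂ) (x : ATilde) :
    partialAct A B N (c • x) = c • partialAct A B N x := by
  simp [partialAct, Finset.smul_sum]

theorem partialAct_congr {N : ℕ} {x y : ATilde} (h : ∀ m < N, x.coeff m = y.coeff m) :
    partialAct A B N x = partialAct A B N y :=
  Finset.sum_congr rfl fun m hm => by rw [h m (Finset.mem_range.1 hm)]

theorem partialAct_sum {ι : Type*} (N : ℕ) (s : Finset ι) (x : ι → ATilde) :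
    partialAct A B N (∑ i ∈ s, x i) = ∑ i ∈ s, partialAct A B N (x i) := by
  classical
  induction s using Finset.induction_on with
  | empty => simp [partialAct]
  | insert i s hi ih => simp [Finset.sum_insert hi, partialAct_add, ih]

theorem partialAct_aeval (N : ℕ) (P : ℂ[X]) (x : ATilde) :
    partialAct A B N (aeval aMul P x) = aeval A P * partialAct A B N x := by
  simp [partialAct, coeff_aeval_aMul, Finset.mul_sum, mul_assoc]

variable {A B}

theorem comm_aeval (h : A * B - B * A = B * B) (P : ℂ[X]) :
    B * aeval A P = aeval A P * B - B * aeval A (derivative P) * B := by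
  have hBA : B * A = A * B - B * B := by rw [← h]; abel
  induction P using Polynomial.induction_on with
  | C c =>
    simp [Algebra.commutes]
  | add p q hp hq => simp only [map_add, mul_add, add_mul, hp, hq]; abel
  | monomial k c ih =>
    rw [pow_succ, ← mul_assoc]
    generalize C c * X ^ k = P at ih
    have e1 : B * (aeval A (derivative P) * A) * B
        = B * aeval A (derivative P) * (B * A) + B * aeval A (derivative P) * (B * B) := by
      rw [hBA]; noncomm_ring
    calc B * aeval A (P * X) = (B * aeval A P) * A := by simp [mul_assoc]
      _ = aeval A P * (B * A) - B * aeval A (derivative P) * (B * A) := by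
          rw [ih]; noncomm_ring
      _ = aeval A P * A * B - (aeval A P * B - B * aeval A (derivative P) * B) * B
            - B * (aeval A (derivative P) * A) * B := by
          rw [e1, hBA]; noncomm_ring
      _ = aeval A P * A * B - B * aeval A P * B
            - B * (aeval A (derivative P) * A) * B := by rw [← ih]
      _ = _ := by
          simp only [derivative_mul, derivative_X, map_add, map_mul, aeval_X, mul_one]
          noncomm_ring

theorem partialAct_bMul (h : A * B - B * A = B * B) (N : ℕ) (x : ATilde) :
    partialAct A B (N + 1) (bMul x) + B * aeval A ((bMul x).coeff (N + 1)) * B ^ N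
      = B * partialAct A B (N + 1) x := by
  induction N with
  | zero => simp [partialAct]
  | succ N ih =>
    have e1 := comm_aeval h ((bMul x).coeff (N + 1))
    have e2 : partialAct A B (N + 1 + 1) (bMul x) = partialAct A B (N + 1) (bMul x) +
        aeval A ((bMul x).coeff (N + 1)) * B ^ (N + 1) := Finset.sum_range_succ _ _
    have e3 : partialAct A B (N + 1 + 1) x = partialAct A B (N + 1) x +
        aeval A (x.coeff (N + 1)) * B ^ (N + 1) := Finset.sum_range_succ _ _
    have e4 : aeval A ((bMul x).coeff (N + 1)) * B =
        B * aeval A ((bMul x).coeff (N + 1)) +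
          B * aeval A (derivative ((bMul x).coeff (N + 1))) * B := by rw [e1]; abel
    rw [e2, e3, mul_add, ← ih, coeff_bMul_succ x (N + 1), pow_succ' B N, ← mul_assoc, e4]
    simp only [map_sub]
    noncomm_ring

variable {F : ℕ → Submodule ℂ M}

theorem aeval_mem (hA : ∀ N, ∀ c ∈ F N, A c ∈ F N) (P : ℂ[X]) (N : ℕ) (c : M) (hc : c ∈ F N) :
    aeval A P c ∈ F N := by
  induction P using Polynomial.induction_on generalizing c with
  | C r => simpa [Module.algebraMap_end_apply] using (F N).smul_mem r hc
  | add p q hp hq => simpa using (F N).add_mem (hp c hc) (hq c hc)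
  | monomial k r ih =>
    rw [pow_succ, ← mul_assoc, map_mul, Module.End.mul_apply, aeval_X]
    exact ih _ (hA N c hc)

theorem bpow_mem (hB : ∀ N, ∀ c ∈ F N, B c ∈ F (N + 1)) (ν N : ℕ) (c : M) (hc : c ∈ F N) :
    (B ^ ν) c ∈ F (N + ν) := by
  induction ν with
  | zero => simpa using hc
  | succ ν ih => rw [pow_succ', Module.End.mul_apply]; exact hB _ _ ih

theorem act_mul (h : A * B - B * A = B * B) (hA : ∀ N, ∀ c ∈ F N, A c ∈ F N)
    (hB : ∀ N, ∀ c ∈ F N, B c ∈ F (N + 1)) (h0 : F 0 = ⊤)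
    (hF : ∀ N, F (N + 1) ≤ F N)
    (hsep : ∀ c, (∀ N, c ∈ F (N + 1)) → c = 0) (act : ATilde → M → M)
    (hact : ∀ x c N, act x c - partialAct A B N x c ∈ F N) (x y : ATilde) (c : M) :
    act (x * y) c = act x (act y c) := by
  rw [← sub_eq_zero]
  refine hsep _ fun N => ?_
  have hle : ∀ N k, F (N + k) ≤ F N := by
    intro N k
    induction k with
    | zero => exact le_rfl
    | succ k ih => exact (hF _).trans ih
  have hpow : ∀ ν (c : M), (B ^ ν) c ∈ F ν := by
    intro ν c
    simpa using bpow_mem hB ν 0 c (by rw [h0]; trivial)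
  have hb1 : ∀ (z : ATilde), partialAct A B (N + 1) (bMul z) c
      - B (partialAct A B (N + 1) z c) ∈ F (N + 1) := by
    intro z
    have := LinearMap.congr_fun (partialAct_bMul h N z) c
    simp only [LinearMap.add_apply, Module.End.mul_apply] at this
    rw [← this, sub_add_cancel_left]
    exact (F (N + 1)).neg_mem (hB _ _ (aeval_mem hA _ _ _ (hpow N c)))
  have hb2 : ∀ ν (z : ATilde), partialAct A B (N + 1) ((bMul ^ ν) z) c
      - (B ^ ν) (partialAct A B (N + 1) z c) ∈ F (N + 1) := by
    intro ν
    induction ν with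
    | zero => intro z; simp
    | succ ν ih =>
      intro z
      rw [pow_succ', pow_succ', Module.End.mul_apply, Module.End.mul_apply]
      have := (F (N + 1)).add_mem (hb1 ((bMul ^ ν) z)) (hF _ (hB _ _ (ih z)))
      simpa using this
  have e1 : partialAct A B (N + 1) (x * y) =
      ∑ ν ∈ Finset.range (N + 1),
        aeval A (x.coeff ν) * partialAct A B (N + 1) ((bMul ^ ν) y) := by
    simp_rw [← partialAct_aeval]
    rw [← partialAct_sum]
    refine partialAct_congr _ _ fun m hm => ?_
    have hs : ∀ (s : Finset ℕ) (z : ℕ → ATilde), (∑ i ∈ s, z i).coeff m = ∑ i ∈ s, (z i).coeff m :=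
      fun s z => Finset.sum_apply m s z
    rw [hs, coeff_mul]
    simp_rw [coeff_aeval_aMul]
    refine Finset.sum_subset (by intro i; simp; omega) fun ν _ hν => ?_
    rw [coeff_bMul_pow_of_lt y (by simpa using hν), mul_zero]
  have e2 : partialAct A B (N + 1) (x * y) c -
      partialAct A B (N + 1) x (partialAct A B (N + 1) y c) ∈ F (N + 1) := by
    rw [e1, partialAct, LinearMap.sum_apply, LinearMap.sum_apply, ← Finset.sum_sub_distrib]
    refine Submodule.sum_mem _ fun ν _ => ?_
    rw [Module.End.mul_apply, Module.End.mul_apply, ← map_sub]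
    exact aeval_mem hA _ _ _ (hb2 ν y)
  have e3 : partialAct A B (N + 1) x (act y c) -
      partialAct A B (N + 1) x (partialAct A B (N + 1) y c) ∈ F (N + 1) := by
    rw [← map_sub, partialAct, LinearMap.sum_apply]
    refine Submodule.sum_mem _ fun ν _ => ?_
    rw [Module.End.mul_apply]
    exact aeval_mem hA _ _ _ (hle _ ν (bpow_mem hB ν _ _ (hact y c (N + 1))))
  have := (F (N + 1)).sub_mem ((F (N + 1)).add_mem (hact (x * y) c (N + 1)) e2)
    ((F (N + 1)).add_mem (hact x (act y c) (N + 1)) e3)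
  convert this using 1
  abel

end act

/-! ### Ring structure of `Ã` -/

theorem mul_eq_partialAct (x y : ATilde) (N : ℕ) :
    ∀ m < N, (x * y - partialAct aMul bMul N x y).coeff m = 0 := by
  intro m hm
  have hs : ∀ (s : Finset ℕ) (z : ℕ → ATilde), (∑ i ∈ s, z i).coeff m = ∑ i ∈ s, (z i).coeff m :=
    fun s z => Finset.sum_apply m s z
  rw [coeff_sub, sub_eq_zero, coeff_mul, partialAct, LinearMap.sum_apply, hs]
  simp_rw [Module.End.mul_apply, coeff_aeval_aMul]
  refine Finset.sum_subset (by intro i; simp; omega) fun ν _ hν => ?_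
  rw [coeff_bMul_pow_of_lt y (by simpa using hν), mul_zero]

/-- The elements of `Ã` divisible by `b^N`. -/
def filt (N : ℕ) : Submodule ℂ ATilde where
  carrier := {x | ∀ m < N, x.coeff m = 0}
  add_mem' hx hy m hm := by simp [hx m hm, hy m hm]
  zero_mem' m _ := rfl
  smul_mem' c x hx m hm := by simp [hx m hm]

theorem mul_assoc' (x y z : ATilde) : x * y * z = x * (y * z) := by
  refine act_mul (F := filt) (A := aMul) (B := bMul) aMul_bMul ?_ ?_ ?_ ?_ ?_
    (fun x y => x * y) ?_ x y z
  · intro N c hc m hm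
    rw [coeff_aMul, hc m hm, mul_zero]
  · intro N c hc m
    induction m with
    | zero => intro _; rfl
    | succ m ih => intro hm; rw [coeff_bMul_succ, ih (by omega), hc m (by omega)]; simp
  · refine eq_top_iff.2 fun x _ m hm => ?_
    omega
  · exact fun N c hc m hm => hc m (by omega)
  · exact fun c hc => ext fun m => hc m m (by omega)
  · exact fun x y N => mul_eq_partialAct x y N

theorem add_mul' (x y z : ATilde) : (x + y) * z = x * z + y * z := by
  ext1 m; simp [coeff_mul, add_mul, Finset.sum_add_distrib]

theorem mul_add' (x y z : ATilde) : x * (y + z) = x * y + x * z := by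
  ext1 m; simp [coeff_mul, mul_add, Finset.sum_add_distrib]

theorem one_mul' (x : ATilde) : 1 * x = x := by
  ext1 m
  simp [coeff_mul, coeff_one]

theorem coeff_bMul_pow_one (ν m : ℕ) :
    ((bMul ^ ν) 1).coeff m = if m = ν then 1 else 0 := by
  induction ν generalizing m with
  | zero => simp [coeff_one]
  | succ ν ih =>
    rw [pow_succ', Module.End.mul_apply]
    induction m with
    | zero => simp
    | succ m ihm =>
      rw [coeff_bMul_succ, ihm, ih]
      split_ifs <;> simp_all

theorem mul_one' (x : ATilde) : x * 1 = x := by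
  ext1 m
  simp [coeff_mul, coeff_bMul_pow_one]

instance : Ring ATilde :=
  { (inferInstance : AddCommGroup ATilde), (inferInstance : Mul ATilde),
    (inferInstance : One ATilde) with
    left_distrib := mul_add'
    right_distrib := add_mul'
    zero_mul := fun x => by ext1 m; simp [coeff_mul]
    mul_zero := fun x => by ext1 m; simp [coeff_mul]
    mul_assoc := mul_assoc'
    one_mul := one_mul'
    mul_one := mul_one' }

instance : Algebra ℂ ATilde :=
  Algebra.ofModule (fun c x y => by ext1 m; simp [coeff_mul, Finset.smul_sum])
    (fun c x y => by ext1 m; simp [coeff_mul, Finset.smul_sum])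

theorem a_mul (y : ATilde) : a * y = aMul y := by
  ext1 m; simp [coeff_mul, a]

theorem b_mul (y : ATilde) : b * y = bMul y := by
  ext1 m
  cases m <;> simp [coeff_mul, b]

/-- The defining relation `a b - b a = b²`. -/
theorem a_mul_b_sub : a * b - b * a = b * b := by
  rw [a_mul, b_mul, b_mul]
  have h := LinearMap.congr_fun aMul_bMul (1 : ATilde)
  have ha : aMul 1 = a := by rw [← a_mul, mul_one]
  have hb : bMul 1 = b := by rw [← b_mul, mul_one]
  simpa [ha, hb] using h

theorem coeff_bMul_pow_C (f : ℕ → ℂ) (ν m : ℕ) :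
    ((bMul ^ ν) (mk fun n => C (f n))).coeff m = if ν ≤ m then C (f (m - ν)) else 0 := by
  induction ν generalizing m with
  | zero => simp
  | succ ν ih =>
    rw [pow_succ', Module.End.mul_apply]
    induction m with
    | zero => simp
    | succ m ihm =>
      rw [coeff_bMul_succ, ihm, ih]
      split_ifs <;> simp_all <;> omega

/-- The inclusion `ℂ[[b]] → Ã`. -/
def ofB : PowerSeries ℂ →+* ATilde where
  toFun f := mk fun ν => C (PowerSeries.coeff ν f)
  map_one' := by
    ext1 m; simp only [coeff_mk, coeff_one, PowerSeries.coeff_one]; split_ifs <;> simp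
  map_zero' := by ext1 m; simp
  map_add' f g := by ext1 m; simp
  map_mul' f g := by
    ext1 m
    simp only [coeff_mul, coeff_bMul_pow_C, coeff_mk, PowerSeries.coeff_mul, map_sum, map_mul]
    rw [Finset.Nat.sum_antidiagonal_eq_sum_range_succ
      (fun i j => C (PowerSeries.coeff i f) * C (PowerSeries.coeff j g))]
    refine Finset.sum_congr rfl fun i hi => ?_
    rw [if_pos (by simpa [Nat.lt_succ_iff] using hi)]

@[simp] theorem coeff_ofB (f : PowerSeries ℂ) (m : ℕ) :
    (ofB f).coeff m = C (PowerSeries.coeff m f) := rfl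

theorem ofB_X : ofB PowerSeries.X = b := by
  ext1 m
  simp only [coeff_ofB, PowerSeries.coeff_X, b, coeff_mk]
  split_ifs <;> simp

theorem coeff_bMul_pow_a (ν m : ℕ) :
    ((bMul ^ ν) a).coeff m = if m = ν then X else if m = ν + 1 then -C (ν : ℂ) else 0 := by
  induction ν generalizing m with
  | zero => simp [a]
  | succ ν ih =>
    rw [pow_succ', Module.End.mul_apply]
    induction m with
    | zero => simp
    | succ m ihm =>
      rw [coeff_bMul_succ, ihm, ih]
      have hd : derivative (if m = ν + 1 then X else
          if m = ν + 1 + 1 then -C ((ν + 1 : ℕ) : ℂ) else 0) = if m = ν + 1 then 1 else 0 := by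
        split_ifs
        · exact derivative_X
        · rw [derivative_neg, derivative_C, neg_zero]
        · exact derivative_zero
      rw [hd]
      simp only [Nat.add_right_cancel_iff]
      by_cases h1 : m = ν
      · rw [if_pos h1, if_neg (by omega), if_pos h1, sub_zero]
      · by_cases h2 : m = ν + 1
        · rw [if_neg h1, if_pos h2, if_pos h2, if_neg h1, if_pos h2, Nat.cast_succ, C_add, C_1]
          ring
        · rw [if_neg h1, if_neg h2, if_neg h2, if_neg h1, if_neg h2, sub_zero]

/-- `a S(b) = S(b) a + b² S'(b)`. -/
theorem a_mul_ofB (f : PowerSeries ℂ) :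
    a * ofB f = ofB f * a + ofB (PowerSeries.X ^ 2 * PowerSeries.derivative ℂ f) := by
  ext1 m
  rw [a_mul, coeff_add, coeff_mul, coeff_aMul]
  simp only [coeff_bMul_pow_a, coeff_ofB]
  rcases m with _ | _ | m
  · rw [Finset.sum_range_one, pow_two, mul_assoc, PowerSeries.coeff_zero_X_mul, C_0, add_zero,
      if_pos rfl, mul_comm]
  · rw [Finset.sum_range_succ, Finset.sum_range_one, pow_two, mul_assoc,
      PowerSeries.coeff_succ_X_mul, PowerSeries.coeff_zero_X_mul, C_0, add_zero, if_pos rfl,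
      if_neg (by omega), if_pos rfl, Nat.cast_zero, C_0, neg_zero, mul_zero, zero_add,
      zero_add, mul_comm]
  · rw [Finset.sum_range_succ, Finset.sum_range_succ, Finset.sum_eq_zero]
    · have : PowerSeries.coeff (m + 1 + 1) (PowerSeries.X ^ 2 * PowerSeries.derivative ℂ f)
          = PowerSeries.coeff m (PowerSeries.derivative ℂ f) := by
        rw [pow_two, mul_assoc, PowerSeries.coeff_succ_X_mul, PowerSeries.coeff_succ_X_mul]
      rw [this, PowerSeries.coeff_derivative]
      simp
      ring
    · intro i hi
      have := Finset.mem_range.1 hi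
      rw [if_neg (by omega), if_neg (by omega), mul_zero]

end ATilde

open ATilde

/-! ### (a,b)-modules -/

section modules

/-- The `ℂ[[b]]`-module underlying a left `Ã`-module. -/
@[reducible] def bModule (E : Type*) [AddCommGroup E] [Module ATilde E] :
    Module (PowerSeries ℂ) E := Module.compHom E ofB

attribute [local instance] bModule

variable (E : Type*) [AddCommGroup E] [Module ATilde E]

/-- An (a,b)-module: a left `Ã`-module that is free of finite type over `ℂ[[b]]`. -/
def IsABModule : Prop := Module.Free (PowerSeries ℂ) E ∧ Module.Finite (PowerSeries ℂ) E

/-- A monogenic (a,b)-module: one isomorphic, as a left `Ã`-module, to a quotient `Ã / I` by a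
left ideal `I`. -/
def IsMonogenic : Prop :=
  IsABModule E ∧ ∃ I : Submodule ATilde ATilde, Nonempty (E ≃ₗ[ATilde] (ATilde ⧸ I))

/-- The localisation `E[b⁻¹]`. -/
abbrev BInv : Type _ := LocalizedModule (Submonoid.powers (PowerSeries.X : PowerSeries ℂ)) E

variable {E}

theorem smul_eq (f : PowerSeries ℂ) (x : E) : f • x = ofB f • x := rfl

theorem a_smul_smul (f : PowerSeries ℂ) (x : E) :
    a • (f • x) = f • (a • x) + (PowerSeries.X ^ 2 * PowerSeries.derivative ℂ f) • x := by
  rw [smul_eq, smul_eq, smul_eq, smul_smul, smul_smul, a_mul_ofB, add_smul]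

theorem wd_aux {R M : Type*} [CommRing R] [AddCommGroup M] [Module R M]
    (X s t u ds dt du : R) (x y x' y' : M) (h : (u * t) • x = (u * s) • y)
    (h2 : (u * t) • x' + (X ^ 2 * (u * dt + t * du)) • x =
      (u * s) • y' + (X ^ 2 * (u * ds + s * du)) • y) :
    (u ^ 2 * (X * t * t)) • (s • x' - (X ^ 2 * ds) • x) =
      (u ^ 2 * (X * s * s)) • (t • y' - (X ^ 2 * dt) • y) := by
  linear_combination (norm := module) (X * u * s * t) • h2 - (X ^ 3 * (s * t * du + u * t * ds + u * s * dt)) • h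

theorem add_aux {R M : Type*} [CommRing R] [AddCommGroup M] [Module R M]
    (X s t ds dt : R) (x y x' y' : M) :
    ((X * s * s) * (X * t * t)) • ((s * t) • (t • x' + (X ^ 2 * dt) • x + (s • y' + (X ^ 2 * ds) • y))
        - (X ^ 2 * (s * dt + t * ds)) • (t • x + s • y)) =
      (X * (s * t) * (s * t)) • ((X * t * t) • (s • x' - (X ^ 2 * ds) • x) +
        (X * s * s) • (t • y' - (X ^ 2 * dt) • y)) := by
  module

/-- The operator `b⁻¹ a` on fractions, by the quotient rule
`b⁻¹ a (x / S) = (S a x - b² S' x) / (b S²)`. -/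
def thetaFun (y : BInv E) : BInv E :=
  y.liftOn (fun p => LocalizedModule.mk
      ((p.2 : PowerSeries ℂ) • (a • p.1)
        - (PowerSeries.X ^ 2 * PowerSeries.derivative ℂ (p.2 : PowerSeries ℂ)) • p.1)
      (⟨PowerSeries.X, Submonoid.mem_powers _⟩ * p.2 * p.2)) (by
    rintro ⟨x, s, hs⟩ ⟨y, t, ht⟩ ⟨⟨u, hu⟩, h⟩
    refine LocalizedModule.mk_eq.2 ⟨⟨u, hu⟩ ^ 2, ?_⟩
    simp only [Submonoid.smul_def, Submonoid.coe_mul, SubmonoidClass.coe_pow, smul_smul] at h ⊢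
    have h2 := congrArg (fun z => a • z) h
    simp only [a_smul_smul, Derivation.leibniz, smul_eq_mul] at h2
    set ds := PowerSeries.derivative ℂ s
    set dt := PowerSeries.derivative ℂ t
    set du := PowerSeries.derivative ℂ u
    exact wd_aux _ _ _ _ _ _ _ _ _ _ _ h h2)

theorem thetaFun_mk (x : E) (s : Submonoid.powers (PowerSeries.X : PowerSeries ℂ)) :
    thetaFun (LocalizedModule.mk x s) = LocalizedModule.mk
      ((s : PowerSeries ℂ) • (a • x)
        - (PowerSeries.X ^ 2 * PowerSeries.derivative ℂ (s : PowerSeries ℂ)) • x)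
      (⟨PowerSeries.X, Submonoid.mem_powers _⟩ * s * s) := rfl

variable (E) in
/-- The operator `b⁻¹ a` on `E[b⁻¹]`. -/
def theta : BInv E →+ BInv E :=
  AddMonoidHom.mk' thetaFun (by
    intro y z
    induction y using LocalizedModule.induction_on with | _ x s
    induction z using LocalizedModule.induction_on with | _ y t
    rw [LocalizedModule.mk_add_mk, thetaFun_mk, thetaFun_mk, thetaFun_mk,
      LocalizedModule.mk_add_mk]
    refine LocalizedModule.mk_eq.2 ⟨1, ?_⟩
    simp only [Submonoid.smul_def, Submonoid.coe_mul, smul_add a, a_smul_smul,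
      Derivation.leibniz, smul_eq_mul, one_smul]
    exact add_aux _ _ _ _ _ _ _ _ _)

/-- `b⁻¹ a (x / b^k) = (a x - k b x) / b^{k+1}`. -/
theorem theta_mk_X_pow (x : E) (k : ℕ) :
    theta E (LocalizedModule.mk x ⟨PowerSeries.X ^ k, pow_mem (Submonoid.mem_powers _) k⟩) =
      LocalizedModule.mk (a • x - (k : ATilde) • b • x) ⟨PowerSeries.X ^ (k + 1), pow_mem (Submonoid.mem_powers _) (k + 1)⟩ := by
  refine (thetaFun_mk _ _).trans (LocalizedModule.mk_eq.2 ⟨1, ?_⟩)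
  have hb : (k : ATilde) • b • x = ((k : PowerSeries ℂ) * PowerSeries.X) • x := by
    rw [smul_eq, smul_smul, map_mul, map_natCast, ofB_X]
  rw [hb]
  simp only [Submonoid.smul_def, Submonoid.coe_mul, Derivation.leibniz_pow,
    PowerSeries.derivative_X, nsmul_eq_mul, smul_eq_mul, mul_one, one_smul]
  rw [smul_sub, smul_sub]
  simp only [smul_smul]
  congr 2
  · ring
  · rcases k with _ | k
    · simp
    · rw [Nat.add_sub_cancel]; ring

variable (E) in
/-- The saturation `E^♯` of `E` by `b⁻¹ a`: the smallest `ℂ[[b]]`-submodule of `E[b⁻¹]` that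
contains (the image of) `E` and is stable under `b⁻¹ a`. -/
def saturation : Submodule (PowerSeries ℂ) (BInv E) :=
  sInf {F | (∀ x : E, LocalizedModule.mk x 1 ∈ F) ∧ ∀ y ∈ F, theta E y ∈ F}

variable (E) in
/-- A regular (a,b)-module: the saturation `E^♯` is of finite type over `ℂ[[b]]`. -/
def IsRegular : Prop := IsABModule E ∧ (saturation E).FG

variable (E) in
/-- `lam` is an eigenvalue of the endomorphism induced by `b⁻¹ a` on `E^♯ / b E^♯`: there is
`x ∈ E^♯`, not in `b E^♯`, with `b⁻¹ a x - lam x ∈ b E^♯`. -/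
def IsSharpEigenvalue (lam : ℂ) : Prop :=
  ∃ x ∈ saturation E, (¬ ∃ y ∈ saturation E, x = (PowerSeries.X : PowerSeries ℂ) • y) ∧
    ∃ y ∈ saturation E, theta E x - (PowerSeries.C lam : PowerSeries ℂ) • x =
      (PowerSeries.X : PowerSeries ℂ) • y

variable (E) in
/-- A geometric regular (a,b)-module: the eigenvalues of `b⁻¹ a` on `E^♯ / b E^♯` are positive
rational numbers. -/
def IsRegularGeometric : Prop :=
  IsRegular E ∧ ∀ lam : ℂ, IsSharpEigenvalue E lam → ∃ q : ℚ, 0 < q ∧ lam = (q : ℂ)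

end modules

/-! ### Formal series in `s` and `log s` -/

/-- The exponents: rational numbers `> -1`. -/
abbrev Expo : Type := {α : ℚ // -1 < α}

/-- Formal series `∑_α s^α q_α(log s)`, over all rational `α > -1`, with `q_α ∈ ℂ[z]`; such a
series is the family `α ↦ q_α`. -/
def LogSeries : Type := Expo → ℂ[X]

namespace LogSeries

instance : AddCommGroup LogSeries := inferInstanceAs (AddCommGroup (Expo → ℂ[X]))
instance : Module ℂ LogSeries := inferInstanceAs (Module ℂ (Expo → ℂ[X]))

/-- The polynomial `q_α`. -/
def coeff (φ : LogSeries) (α : Expo) : ℂ[X] := φ α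

/-- The series `∑_α s^α q_α(log s)`. -/
def mk (q : Expo → ℂ[X]) : LogSeries := q

@[ext] theorem ext {φ ψ : LogSeries} (h : ∀ β, φ.coeff β = ψ.coeff β) : φ = ψ := funext h
@[simp] theorem coeff_mk (q : Expo → ℂ[X]) (β : Expo) : (mk q).coeff β = q β := rfl
@[simp] theorem coeff_add (x y : LogSeries) (m) : (x + y).coeff m = x.coeff m + y.coeff m := rfl
@[simp] theorem coeff_sub (x y : LogSeries) (m) : (x - y).coeff m = x.coeff m - y.coeff m := rfl
@[simp] theorem coeff_zero (m) : (0 : LogSeries).coeff m = 0 := rfl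
@[simp] theorem coeff_smul (c : ℂ) (x : LogSeries) (m) : (c • x).coeff m = c • x.coeff m := rfl
theorem coeff_sum {ι : Type*} (s : Finset ι) (z : ι → LogSeries) (m) :
    (∑ i ∈ s, z i).coeff m = ∑ i ∈ s, (z i).coeff m := Finset.sum_apply m s z

/-- For `β ≠ 0`, the polynomial `r` with `β r + r' = q`, that is with
`d/ds (s^β r(log s)) = s^{β-1} q(log s)`. -/
def primPoly (β : ℂ) (q : ℂ[X]) : ℂ[X] :=
  ∑ i ∈ Finset.range (q.natDegree + 1), ((-1) ^ i * β⁻¹ ^ (i + 1)) • (derivative^[i] q)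

theorem primPoly_eq (β : ℂ) (q : ℂ[X]) {N : ℕ} (hN : q.natDegree < N) :
    primPoly β q = ∑ i ∈ Finset.range N, ((-1) ^ i * β⁻¹ ^ (i + 1)) • (derivative^[i] q) := by
  refine Finset.sum_subset (by intro i; simp; omega) fun i _ hi => ?_
  rw [iterate_derivative_eq_zero (by simpa using hi), smul_zero]

theorem primPoly_spec {β : ℂ} (hβ : β ≠ 0) (q : ℂ[X]) :
    β • primPoly β q + derivative (primPoly β q) = q := by
  have key : ∀ N, β • (∑ i ∈ Finset.range N, ((-1) ^ i * β⁻¹ ^ (i + 1)) • (derivative^[i] q)) +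
      derivative (∑ i ∈ Finset.range N, ((-1) ^ i * β⁻¹ ^ (i + 1)) • (derivative^[i] q))
      = q - ((-1) ^ N * β⁻¹ ^ N) • (derivative^[N] q) := by
    intro N
    induction N with
    | zero => simp
    | succ N ih =>
      rw [Finset.sum_range_succ, smul_add, map_add, add_add_add_comm, ih, derivative_smul,
        ← Function.iterate_succ_apply' derivative, smul_smul]
      have : β * ((-1) ^ N * β⁻¹ ^ (N + 1)) = (-1) ^ N * β⁻¹ ^ N := by
        rw [pow_succ]; field_simp
      rw [this]
      module
  rw [primPoly, key, iterate_derivative_eq_zero (Nat.lt_succ_self _), smul_zero, sub_zero]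

theorem primPoly_add (β : ℂ) (p q : ℂ[X]) : primPoly β (p + q) = primPoly β p + primPoly β q := by
  have h := natDegree_add_le p q
  set N := max p.natDegree q.natDegree + 1
  rw [primPoly_eq β (p + q) (N := N) (by omega), primPoly_eq β p (N := N) (by omega),
    primPoly_eq β q (N := N) (by omega), ← Finset.sum_add_distrib]
  simp [iterate_map_add]

theorem primPoly_smul (β c : ℂ) (q : ℂ[X]) : primPoly β (c • q) = c • primPoly β q := by
  rw [primPoly_eq β (c • q) (N := q.natDegree + 1)
    (Nat.lt_succ_of_le (natDegree_smul_le c q)), primPoly, Finset.smul_sum]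
  refine Finset.sum_congr rfl fun i _ => ?_
  rw [iterate_derivative_smul, smul_comm]

theorem natDegree_primPoly_le (β : ℂ) (q : ℂ[X]) : (primPoly β q).natDegree ≤ q.natDegree := by
  refine natDegree_sum_le_of_forall_le _ _ fun i _ => ?_
  exact (natDegree_smul_le _ _).trans ((natDegree_iterate_derivative q i).trans (Nat.sub_le _ _))

theorem primPoly_zero (β : ℂ) : primPoly β 0 = 0 := by simp [primPoly]

theorem primPoly_unique {β : ℂ} (hβ : β ≠ 0) {r q : ℂ[X]} (h : β • r + derivative r = q) :
    r = primPoly β q := by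
  have h2 : ∀ r : ℂ[X], β • r + derivative r = 0 → r = 0 := by
    intro r hr
    by_contra hne
    have hd : (derivative r).degree < r.degree := degree_derivative_lt hne
    have : r.degree = (derivative r).degree := by
      have e : C β * r = - derivative r := by
        rw [← smul_eq_C_mul]; exact eq_neg_of_add_eq_zero_left hr
      rw [← degree_C_mul (p := r) hβ, e, degree_neg]
    exact absurd this hd.ne'
  rw [← sub_eq_zero]
  apply h2
  have := primPoly_spec hβ q
  rw [smul_sub, map_sub]
  linear_combination (exp := 1) h - this

/-- The exponent `β - 1`, when `β > 0`. -/
def pred (β : Expo) (h : 0 < β.1) : Expo := ⟨β.1 - 1, by linarith⟩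

/-- `a` is multiplication by `s`: the coefficient of `s^β` in `s φ` is that of `s^{β-1}` in `φ`. -/
def aOp : Module.End ℂ LogSeries where
  toFun φ := mk fun β => if h : 0 < β.1 then φ.coeff (pred β h) else 0
  map_add' φ ψ := by ext1 β; simp only [coeff_mk, coeff_add]; split_ifs <;> simp
  map_smul' c φ := by
    ext1 β; simp only [coeff_mk, coeff_smul, RingHom.id_apply]; split_ifs <;> simp

/-- `b` is the primitive without constant: the primitive of `s^{β-1} q(log s)` is `s^β r(log s)`
with `β r + r' = q`. -/
def bOp : Module.End ℂ LogSeries where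
  toFun φ := mk fun β => if h : 0 < β.1 then primPoly (β.1 : ℂ) (φ.coeff (pred β h)) else 0
  map_add' φ ψ := by
    ext1 β; simp only [coeff_mk, coeff_add]; split_ifs <;> simp [primPoly_add]
  map_smul' c φ := by
    ext1 β; simp only [coeff_mk, coeff_smul, RingHom.id_apply]; split_ifs <;> simp [primPoly_smul]

theorem coeff_aOp (φ : LogSeries) (β : Expo) :
    (aOp φ).coeff β = if h : 0 < β.1 then φ.coeff (pred β h) else 0 := rfl

theorem coeff_bOp (φ : LogSeries) (β : Expo) :
    (bOp φ).coeff β = if h : 0 < β.1 then primPoly (β.1 : ℂ) (φ.coeff (pred β h)) else 0 := rfl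

theorem aOp_bOp : aOp * bOp - bOp * aOp = bOp * bOp := by
  refine LinearMap.ext fun φ => ?_
  ext1 β
  simp only [LinearMap.sub_apply, Module.End.mul_apply, coeff_sub, coeff_aOp, coeff_bOp]
  by_cases h : 0 < β.1
  · by_cases h1 : 0 < (pred β h).1
    · simp only [h, h1, dif_pos]
      set q := φ.coeff (pred (pred β h) h1)
      have hβ : (β.1 : ℂ) ≠ 0 := by exact_mod_cast h.ne'
      have hγ : ((pred β h).1 : ℂ) ≠ 0 := by exact_mod_cast h1.ne'
      have hrel : ((pred β h).1 : ℂ) = (β.1 : ℂ) - 1 := by simp [pred]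
      set γ : ℂ := ((pred β h).1 : ℂ)
      refine primPoly_unique hβ ?_
      have e1 := primPoly_spec hβ q
      have e2 := primPoly_spec hγ q
      rw [map_sub, smul_sub]
      have e3 : (β.1 : ℂ) • primPoly γ q = γ • primPoly γ q + primPoly γ q := by
        rw [hrel]; module
      rw [e3]
      linear_combination (exp := 1) e2 - e1
    · simp [h, h1, primPoly_zero]
  · simp [h]

/-- The action `(∑_ν P_ν(a) b^ν) φ = ∑_ν P_ν(a) (b^ν φ)`; only the terms with `ν < β + 1` contribute
to the coefficient of `s^β`. -/
def act (x : ATilde) (φ : LogSeries) : LogSeries :=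
  mk fun β => ∑ ν ∈ Finset.range ⌈β.1 + 1⌉₊, (aeval aOp (x.coeff ν) ((bOp ^ ν) φ)).coeff β

/-- The series whose exponents are all `> N - 1`. -/
def filt (N : ℕ) : Submodule ℂ LogSeries where
  carrier := {φ | ∀ β : Expo, β.1 + 1 ≤ N → φ.coeff β = 0}
  add_mem' hx hy m hm := by simp [hx m hm, hy m hm]
  zero_mem' m _ := rfl
  smul_mem' c x hx m hm := by simp [hx m hm]

theorem aOp_filt (N : ℕ) (c) (hc : c ∈ filt N) : aOp c ∈ filt N := by
  intro β hβ
  rw [coeff_aOp]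
  split_ifs with h
  · exact hc _ (by simp only [pred]; linarith)
  · rfl

theorem bOp_filt (N : ℕ) (c) (hc : c ∈ filt N) : bOp c ∈ filt (N + 1) := by
  intro β hβ
  rw [coeff_bOp]
  push_cast at hβ
  split_ifs with h
  · rw [hc _ (by simp only [pred]; linarith), primPoly_zero]
  · rfl

theorem filt_zero : filt 0 = ⊤ := by
  refine eq_top_iff.2 fun φ _ β hβ => ?_
  have := β.2
  push_cast at hβ
  linarith

theorem filt_succ (N : ℕ) : filt (N + 1) ≤ filt N :=
  fun φ hφ β hβ => hφ β (by push_cast; linarith)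

theorem filt_anti {M N : ℕ} (h : M ≤ N) : filt N ≤ filt M :=
  fun φ hφ β hβ => hφ β (hβ.trans (by exact_mod_cast h))

theorem term_mem (P : ℂ[X]) (ν : ℕ) (φ : LogSeries) : aeval aOp P ((bOp ^ ν) φ) ∈ filt ν := by
  have := bpow_mem bOp_filt ν 0 φ (by rw [filt_zero]; trivial)
  rw [zero_add] at this
  exact aeval_mem aOp_filt P ν _ this

theorem act_sub_mem (x : ATilde) (φ : LogSeries) (N : ℕ) :
    act x φ - partialAct aOp bOp N x φ ∈ filt N := by
  intro β hβ
  rw [coeff_sub, sub_eq_zero, act, coeff_mk, partialAct, LinearMap.sum_apply, coeff_sum]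
  refine Finset.sum_subset (Finset.range_subset_range.2 (Nat.ceil_le.2 hβ)) fun ν _ hν => ?_
  exact term_mem _ ν φ β (Nat.ceil_le.1 (by simpa using hν))

instance : Module ATilde LogSeries where
  smul := act
  one_smul φ := by
    ext1 β
    change (act 1 φ).coeff β = _
    have h : 0 < ⌈β.1 + 1⌉₊ := Nat.ceil_pos.2 (by linarith [β.2])
    rw [act, coeff_mk, Finset.sum_eq_single 0]
    · simp [ATilde.coeff_one]
    · intro ν _ hν; simp [ATilde.coeff_one, hν]
    · intro h'; simp at h'; linarith [β.2]
  mul_smul x y φ := act_mul (F := filt) aOp_bOp aOp_filt bOp_filt filt_zero filt_succ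
    (fun c hc => ext fun β => hc ⌈β.1 + 1⌉₊ β
      ((Nat.le_ceil _).trans (by exact_mod_cast Nat.le_succ _))) act act_sub_mem x y φ
  smul_zero x := by ext1 β; change (act x 0).coeff β = _; simp [act]
  smul_add x φ ψ := by
    ext1 β
    change (act x (φ + ψ)).coeff β = (act x φ).coeff β + (act x ψ).coeff β
    simp [act, Finset.sum_add_distrib]
  add_smul x y φ := by
    ext1 β
    change (act (x + y) φ).coeff β = (act x φ).coeff β + (act y φ).coeff β
    simp [act, Finset.sum_add_distrib]
  zero_smul φ := by ext1 β; change (act 0 φ).coeff β = _; simp [act]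

theorem smul_def (x : ATilde) (φ : LogSeries) : x • φ = act x φ := rfl

instance : IsScalarTower ℂ ATilde LogSeries where
  smul_assoc c x φ := by
    ext1 β
    rw [smul_def, smul_def, coeff_smul]
    simp [act, Finset.smul_sum]

theorem smul_sub_mem (x : ATilde) (φ : LogSeries) (N : ℕ) :
    x • φ - partialAct aOp bOp N x φ ∈ filt N := act_sub_mem x φ N

theorem a_smul (φ : LogSeries) : a • φ = aOp φ := by
  ext1 β
  have h : 0 < ⌈β.1 + 1⌉₊ := Nat.ceil_pos.2 (by linarith [β.2])
  rw [smul_def, act, coeff_mk, Finset.sum_eq_single 0]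
  · simp [a]
  · intro ν _ hν; simp [a, hν]
  · intro h'; simp at h'; linarith [β.2]

theorem b_smul (φ : LogSeries) : b • φ = bOp φ := by
  ext1 β
  rw [smul_def, act, coeff_mk, Finset.sum_eq_single 1]
  · simp [b]
  · intro ν _ hν; simp [b, hν]
  · intro h'
    simpa using term_mem (b.coeff 1) 1 φ β (Nat.ceil_le.1 (by simpa using h'))

/-- The series `φ` has exponents in `A + ℕ` and log-degree at most `n`. -/
def SuppIn (A : Finset Expo) (n : ℕ) (φ : LogSeries) : Prop :=
  ∀ α : Expo, (φ.coeff α).natDegree ≤ n ∧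
    (φ.coeff α ≠ 0 → ∃ α₀ ∈ A, ∃ m : ℕ, α.1 = α₀.1 + m)

theorem SuppIn.mono {A A' : Finset Expo} (h : A ⊆ A') {n : ℕ} {φ : LogSeries}
    (hφ : SuppIn A n φ) : SuppIn A' n φ := fun α => ⟨(hφ α).1, fun hα =>
  let ⟨α₀, h₀, m, hm⟩ := (hφ α).2 hα; ⟨α₀, h h₀, m, hm⟩⟩

theorem SuppIn.zero (A : Finset Expo) (n : ℕ) : SuppIn A n 0 := fun α => by simp

theorem SuppIn.add {A : Finset Expo} {n : ℕ} {φ ψ : LogSeries}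
    (hφ : SuppIn A n φ) (hψ : SuppIn A n ψ) : SuppIn A n (φ + ψ) := fun α => by
  refine ⟨(natDegree_add_le _ _).trans (max_le (hφ α).1 (hψ α).1), fun h => ?_⟩
  by_cases h1 : φ.coeff α = 0
  · exact (hψ α).2 (by rintro h2; exact h (by simp [h1, h2]))
  · exact (hφ α).2 h1

theorem SuppIn.smul {A : Finset Expo} {n : ℕ} {φ : LogSeries} (c : ℂ)
    (hφ : SuppIn A n φ) : SuppIn A n (c • φ) := fun α =>
  ⟨(natDegree_smul_le _ _).trans (hφ α).1, fun h =>
    (hφ α).2 (by rintro h2; exact h (by simp [h2]))⟩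

theorem SuppIn.aOp {A : Finset Expo} {n : ℕ} {φ : LogSeries}
    (hφ : SuppIn A n φ) : SuppIn A n (aOp φ) := fun β => by
  rw [coeff_aOp]
  split_ifs with h
  · refine ⟨(hφ _).1, fun h0 => ?_⟩
    obtain ⟨α₀, h₀, m, hm⟩ := (hφ _).2 h0
    exact ⟨α₀, h₀, m + 1, by simp only [pred] at hm; push_cast; linarith⟩
  · simp

theorem SuppIn.bOp {A : Finset Expo} {n : ℕ} {φ : LogSeries}
    (hφ : SuppIn A n φ) : SuppIn A n (bOp φ) := fun β => by
  rw [coeff_bOp]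
  split_ifs with h
  · refine ⟨(natDegree_primPoly_le _ _).trans (hφ _).1, fun h0 => ?_⟩
    obtain ⟨α₀, h₀, m, hm⟩ := (hφ _).2 (by
      rintro h1; rw [h1, primPoly_zero] at h0; exact h0 rfl)
    exact ⟨α₀, h₀, m + 1, by simp only [pred] at hm; push_cast; linarith⟩
  · simp

theorem SuppIn.ringSmul {A : Finset Expo} {n : ℕ} {φ : LogSeries} (x : ATilde)
    (hφ : SuppIn A n φ) : SuppIn A n (x • φ) := by
  have hb : ∀ ν, SuppIn A n ((LogSeries.bOp ^ ν) φ) := by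
    intro ν
    induction ν with
    | zero => simpa using hφ
    | succ ν ih => rw [pow_succ', Module.End.mul_apply]; exact ih.bOp
  have ha : ∀ (P : ℂ[X]) (ψ : LogSeries), SuppIn A n ψ → SuppIn A n (aeval LogSeries.aOp P ψ) := by
    intro P
    induction P using Polynomial.induction_on with
    | C r => intro ψ hψ; simpa [Module.algebraMap_end_apply] using hψ.smul r
    | add p q hp hq => intro ψ hψ; simpa using (hp ψ hψ).add (hq ψ hψ)
    | monomial k r ih =>
      intro ψ hψ
      rw [pow_succ, ← mul_assoc, map_mul, Module.End.mul_apply, aeval_X]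
      exact ih _ hψ.aOp
  have hs : ∀ (s : Finset ℕ), SuppIn A n
      (∑ ν ∈ s, aeval LogSeries.aOp (x.coeff ν) ((LogSeries.bOp ^ ν) φ)) := by
    intro s
    induction s using Finset.induction_on with
    | empty => simpa using SuppIn.zero A n
    | insert i s hi ih => rw [Finset.sum_insert hi]; exact (ha _ _ (hb i)).add ih
  intro β
  have := hs (Finset.range ⌈β.1 + 1⌉₊) β
  rwa [coeff_sum] at this

end LogSeries

open LogSeries

/-- `Ξ_n`: the standard asymptotic expansions
`∑_{j ≤ n} ∑_{α ∈ A} T_{α,j}(s) s^α (log s)^j / j!`, with `A ⊂ ℚ ∩ ]-1, ∞[` finite and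
`T_{α,j} ∈ ℂ[[s]]`, that is the series with exponents in `A + ℕ` for some finite `A` and with
degree at most `n` in `log s`, as a left `Ã`-module. -/
def Xi (n : ℕ) : Submodule ATilde LogSeries where
  carrier := {φ | ∃ A : Finset Expo, SuppIn A n φ}
  add_mem' := by
    classical
    rintro φ ψ ⟨A, hA⟩ ⟨A', hA'⟩
    exact ⟨A ∪ A', (hA.mono Finset.subset_union_left).add (hA'.mono Finset.subset_union_right)⟩
  zero_mem' := ⟨∅, SuppIn.zero _ n⟩
  smul_mem' := by
    rintro x φ ⟨A, hA⟩
    exact ⟨A, hA.ringSmul x⟩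

/-- The monomial `s^α (log s)^j`. -/
def logMono (α : Expo) (j : ℕ) : LogSeries :=
  LogSeries.mk fun β => if β = α then X ^ j else 0

/-- The monomial `e_{α,j} = s^α (log s)^j / j!`. -/
def eMono (α : Expo) (j : ℕ) : LogSeries := (j.factorial : ℂ)⁻¹ • logMono α j

/-- `φ = ∑_{(α,j) ∈ A} S_{α,j}(b) s^α (log s)^j / j!` is the canonical writing of `φ ∈ Ξ_n`. -/
structure IsCanonicalWriting (n : ℕ) (φ : LogSeries) (A : Finset (Expo × ℕ))
    (S : Expo → ℕ → PowerSeries ℂ) : Prop where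
  eq_sum : φ = ∑ p ∈ A, ofB (S p.1 p.2) • eMono p.1 p.2
  le : ∀ α j, (α, j) ∈ A → j ≤ n
  saturated : ∀ α j, (α, j) ∈ A → ∀ i ≤ j, (α, i) ∈ A
  zero_or_unit : ∀ α j, (α, j) ∈ A → S α j = 0 ∨ PowerSeries.constantCoeff (S α j) ≠ 0
  exists_unit : ∀ α j, (α, j) ∈ A →
    ∃ k ≥ j, (α, k) ∈ A ∧ PowerSeries.constantCoeff (S α k) ≠ 0
  shift : ∀ α j, (α, j) ∈ A → S α j ≠ 0 → ∀ (α' : Expo) (p : ℕ), 1 ≤ p → α'.1 = α.1 + p →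
    (α', j) ∈ A → S α' j = 0

end

end AB

open AB
open scoped TensorProduct

namespace AB

open Polynomial ATilde LogSeries

noncomputable section

attribute [local instance] bModule

/-! ### The `ℂ[[b]]`-module of formal series -/

section bModule

variable {E : Type*} [AddCommGroup E] [Module ATilde E]

/-! On formal series `b` is injective and `b⁻¹ a` is the operator `θ = d/ds ∘ s`, which sends `s^β
q(log s)` to `s^β ((β+1) q + q')(log s)`. Everything is compared with the lattices `lattice D`:
series whose log-degree is bounded in each class of exponents modulo `ℤ`, by a bound that is nonzero
for finitely many classes only. Such a lattice has finite type over `ℂ[[b]]` and is stable under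
`θ`.

Generated modules. Let `W` be the smallest lattice containing `φ` and `E = Ã φ`. Then `b^K W ⊂ E ⊂
W` for some `K` (`exists_X_pow_smul_lattice_mem`): a product of powers of `θ - (β'+1)` kills any
finite set of unwanted exponents and leaves a leading term whose polynomial in `log s` has the top
degree; `θ - (β+1)` then differentiates this polynomial, and the derivatives span all lower degrees.
So `E` is free of finite type and `E^♯ ⊂ W` up to the identification of `W` with `b^{-K} (b^K W)`.
If `θ x = λ x` modulo `b E^♯`, then `P(θ) x = P(λ) x` modulo `b E^♯`. For `P` killing all exponents
up to level `K`, `P(θ) x` lies in `b^{K+1} W ⊂ b E`, whence `P(λ) = 0` and `λ = β + 1 > 0` for an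
exponent `β` (`isRegularGeometric_of_lattice`).

Canonical writing and generator. By descending induction on the power of `log s`, the terms in `(log
s)^n` of one class come from a single `U(b) s^α (log s)^n / n!` with `U` a unit
(`exists_unit_writing`). The substitution `log s ↦ log s + t` is `Ã`-linear and injective, and for
generic `t` it makes every coefficient on the saturated index set a unit. Truncating the
coefficients at order `K + 1` changes the generator by an element of `b E`, so by Nakayama it does
not change the module (`toB_span_le_of_sub`).

Embedding. In a basis of `E^♯`, with `A(b)` the matrix of `b⁻¹ a`, a solution of `θ y = A(b) y` in
formal series defines an `Ã`-linear map on `E`. The eigenvalues of `A(0)` are positive rationals `β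
+ 1`, and each generalized eigenvector is the leading value of a solution, built level by level
(`exists_solution`). The log-degree can grow only at the finitely many levels that meet an
eigenvalue of `A(0)`. As the generalized eigenvectors span, a vector killed by all these maps has
coordinates divisible by every power of `b` (`forall_eq_zero_of_combination`). -/

theorem X_smul_eq (x : E) : (PowerSeries.X : PowerSeries ℂ) • x = b • x := by
  rw [smul_eq, ofB_X]

theorem X_pow_smul_eq (N : ℕ) (x : E) : (PowerSeries.X ^ N : PowerSeries ℂ) • x = b ^ N • x := by
  rw [smul_eq, map_pow, ofB_X]

/-- The `ℂ[[b]]`-submodule underlying an `Ã`-submodule. -/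
def toB (S : Submodule ATilde E) : Submodule (PowerSeries ℂ) E where
  carrier := S
  add_mem' := S.add_mem
  zero_mem' := S.zero_mem
  smul_mem' f _ hx := S.smul_mem (ofB f) hx

@[simp] theorem mem_toB {S : Submodule ATilde E} {x : E} : x ∈ toB S ↔ x ∈ S := Iff.rfl

end bModule

theorem ofB_C (c : ℂ) : ofB (PowerSeries.C c) = algebraMap ℂ ATilde c := by
  ext1 m
  rw [Algebra.algebraMap_eq_smul_one, ATilde.coeff_smul, coeff_ofB, PowerSeries.coeff_C, coeff_one]
  split_ifs <;> simp [smul_eq_C_mul]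

/-! ### The `b`-adic filtration and the operator `b⁻¹ a` on series -/

namespace LogSeries

theorem C_smul (c : ℂ) (φ : LogSeries) : (PowerSeries.C c : PowerSeries ℂ) • φ = c • φ := by
  rw [smul_eq, ofB_C, algebraMap_smul]

theorem X_smul (φ : LogSeries) : (PowerSeries.X : PowerSeries ℂ) • φ = bOp φ := by
  rw [X_smul_eq, b_smul]

theorem X_pow_smul (N : ℕ) (φ : LogSeries) :
    (PowerSeries.X ^ N : PowerSeries ℂ) • φ = (bOp ^ N) φ := by
  induction N with
  | zero => simp
  | succ N ih => rw [pow_succ', mul_smul, ih, X_smul, pow_succ', Module.End.mul_apply]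

theorem eq_zero_of_forall_mem_filt {φ : LogSeries} (h : ∀ N, φ ∈ filt N) : φ = 0 :=
  ext fun β => h ⌈β.1 + 1⌉₊ β (Nat.le_ceil _)

theorem smul_sub_sum_mem (f : PowerSeries ℂ) (φ : LogSeries) (N : ℕ) :
    f • φ - ∑ k ∈ Finset.range N, PowerSeries.coeff k f • (bOp ^ k) φ ∈ filt N := by
  have := smul_sub_mem (ofB f) φ N
  simpa [partialAct, LinearMap.sum_apply, Module.algebraMap_end_apply, smul_eq] using this

theorem filt_mem_of_bOp_pow (N M : ℕ) {φ : LogSeries} (h : φ ∈ filt N) :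
    (bOp ^ M) φ ∈ filt (N + M) := bpow_mem bOp_filt M N φ h

theorem ringSmul_mem_filt (x : ATilde) {N : ℕ} {φ : LogSeries} (h : φ ∈ filt N) :
    x • φ ∈ filt N := by
  have h1 := smul_sub_mem x φ N
  have h2 : partialAct aOp bOp N x φ ∈ filt N := by
    rw [partialAct, LinearMap.sum_apply]
    refine Submodule.sum_mem _ fun ν _ => ?_
    exact aeval_mem aOp_filt _ _ _ (filt_anti (Nat.le_add_right N ν) (bpow_mem bOp_filt ν N φ h))
  simpa using (filt N).add_mem h1 h2

theorem smul_mem_filt (f : PowerSeries ℂ) {N : ℕ} {φ : LogSeries} (h : φ ∈ filt N) :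
    f • φ ∈ filt N := ringSmul_mem_filt (ofB f) h

/-- Differentiation undoes the primitive: `primPoly_spec` at `β + 1` recovers the coefficient at
`β`. -/
theorem bOp_injective : Function.Injective bOp := by
  rw [injective_iff_map_eq_zero]
  intro φ h
  ext1 β
  have hβ : (0 : ℚ) < β.1 + 1 := by linarith [β.2]
  have h1 : (bOp φ).coeff ⟨β.1 + 1, by linarith⟩ = 0 := by rw [h]; rfl
  rw [coeff_bOp, dif_pos hβ] at h1
  have h2 := primPoly_spec (β := ((β.1 + 1 : ℚ) : ℂ)) (by exact_mod_cast hβ.ne')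
    (φ.coeff (pred ⟨β.1 + 1, by linarith⟩ hβ))
  rw [h1] at h2
  have h3 : pred ⟨β.1 + 1, by linarith⟩ hβ = β := Subtype.ext (by simp [pred])
  rw [h3] at h2
  simpa using h2.symm

/-- The operator `d/ds ∘ s`, that is `b⁻¹ a`. -/
def thetaOp : Module.End ℂ LogSeries where
  toFun φ := mk fun β => ((β.1 : ℂ) + 1) • φ.coeff β + derivative (φ.coeff β)
  map_add' φ ψ := by ext1 β; simp only [coeff_mk, coeff_add, smul_add, map_add]; abel
  map_smul' c φ := by
    ext1 β
    simp only [coeff_mk, coeff_smul, derivative_smul, RingHom.id_apply, smul_add, smul_comm c]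

theorem coeff_thetaOp (φ : LogSeries) (β : Expo) :
    (thetaOp φ).coeff β = ((β.1 : ℂ) + 1) • φ.coeff β + derivative (φ.coeff β) := rfl

theorem bOp_thetaOp (φ : LogSeries) : bOp (thetaOp φ) = aOp φ := by
  ext1 β
  rw [coeff_bOp, coeff_aOp]
  split_ifs with h
  · refine (primPoly_unique (by exact_mod_cast h.ne') ?_).symm
    rw [coeff_thetaOp]
    simp [pred]
  · rfl

/-- After applying the injective `b` this is the relation `a S(b) = S(b) a + b² S'(b)`; thus `θ` is
a derivation over `b d/db`. -/
theorem thetaOp_smul (f : PowerSeries ℂ) (φ : LogSeries) :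
    thetaOp (f • φ) = f • thetaOp φ + (PowerSeries.X * PowerSeries.derivative ℂ f) • φ := by
  apply bOp_injective
  rw [bOp_thetaOp, ← a_smul, a_smul_smul, map_add, a_smul, ← bOp_thetaOp, ← X_smul, ← X_smul,
    ← X_smul, smul_smul, smul_smul, smul_smul, mul_comm f, pow_two, mul_assoc]

theorem thetaOp_X_pow_smul (N : ℕ) (φ : LogSeries) :
    thetaOp ((PowerSeries.X ^ N : PowerSeries ℂ) • φ) =
      (PowerSeries.X ^ N : PowerSeries ℂ) • (thetaOp φ + (N : ℂ) • φ) := by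
  rw [thetaOp_smul, smul_add]
  congr 1
  rw [← C_smul, smul_smul]
  congr 1
  rcases N with _ | N
  · simp
  · simp only [Derivation.leibniz_pow, PowerSeries.derivative_X, nsmul_eq_mul, smul_eq_mul, mul_one,
      Nat.add_sub_cancel, map_natCast]
    ring

theorem thetaOp_mem_filt {N : ℕ} {φ : LogSeries} (h : φ ∈ filt N) : thetaOp φ ∈ filt N := by
  intro β hβ
  rw [coeff_thetaOp, h β hβ]
  simp

/-- The derivative with respect to `s`. -/
def dOp (φ : LogSeries) : LogSeries :=
  mk fun β => ((β.1 : ℂ) + 1) • φ.coeff ⟨β.1 + 1, by linarith [β.2]⟩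
    + derivative (φ.coeff ⟨β.1 + 1, by linarith [β.2]⟩)

/-- With no exponent `≤ 0`, there is no constant or polar term for the primitive to lose. -/
theorem bOp_dOp {φ : LogSeries} (h : φ ∈ filt 1) : bOp (dOp φ) = φ := by
  ext1 β
  rw [coeff_bOp]
  split_ifs with hβ
  · refine (primPoly_unique (by exact_mod_cast hβ.ne') ?_).symm
    have : (⟨(pred β hβ).1 + 1, by linarith [(pred β hβ).2]⟩ : Expo) = β :=
      Subtype.ext (by simp [pred])
    rw [dOp, coeff_mk, this]
    simp [pred]
  · exact (h β (by push_cast; linarith)).symm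

/-- If modulo `b` every element of a set of series is a linear combination of the `g i`, then
every element is a combination with coefficients in `ℂ[[b]]`. -/
theorem exists_powerSeries_of_step {ι : Type*} (s : Finset ι) (g : ι → LogSeries)
    {P : LogSeries → Prop}
    (h : ∀ w, P w → ∃ (c : ι → ℂ) (w' : LogSeries), P w' ∧ w = ∑ i ∈ s, c i • g i + bOp w')
    {w : LogSeries} (hw : P w) :
    ∃ S : ι → PowerSeries ℂ, w = ∑ i ∈ s, S i • g i := by
  choose! c r hr hrw using h
  -- The successive remainders; the scalars produced at `u k` become the coefficients of `b^k`.
  let u : ℕ → LogSeries := fun k => r^[k] w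
  have hu : ∀ k, P (u k) := by
    intro k
    induction k with
    | zero => exact hw
    | succ k ih => simp only [u, Function.iterate_succ_apply']; exact hr _ ih
  have hus : ∀ k, u k = ∑ i ∈ s, c (u k) i • g i + bOp (u (k + 1)) := by
    intro k
    have := hrw _ (hu k)
    simpa only [u, Function.iterate_succ_apply'] using this
  refine ⟨fun i => PowerSeries.mk fun k => c (u k) i, ?_⟩
  rw [← sub_eq_zero]
  refine eq_zero_of_forall_mem_filt fun N => ?_
  have key : w = ∑ i ∈ s, ∑ k ∈ Finset.range N, c (u k) i • (bOp ^ k) (g i) + (bOp ^ N) (u N) := by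
    induction N with
    | zero => simp [u]
    | succ N ih =>
      have h2 := congrArg (bOp ^ N) (hus N)
      rw [map_add, map_sum, ← Module.End.mul_apply, ← pow_succ] at h2
      simp only [Finset.sum_range_succ, Finset.sum_add_distrib]
      rw [ih, h2]
      simp only [map_smul]
      abel
  have h0 : (bOp ^ N) (u N) ∈ filt N := by
    have := filt_mem_of_bOp_pow 0 N (φ := u N) (by rw [filt_zero]; trivial)
    rwa [zero_add] at this
  have h1 : ∑ i ∈ s, ((PowerSeries.mk fun k => c (u k) i : PowerSeries ℂ) • g i -
      ∑ k ∈ Finset.range N, c (u k) i • (bOp ^ k) (g i)) ∈ filt N := by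
    refine Submodule.sum_mem _ fun i _ => ?_
    have := smul_sub_sum_mem (PowerSeries.mk fun k => c (u k) i) (g i) N
    simpa only [PowerSeries.coeff_mk] using this
  rw [Finset.sum_sub_distrib] at h1
  have h3 := (filt N).sub_mem h0 h1
  convert h3 using 1
  conv_lhs => rw [key]
  abel

/-- A map of formal series that commutes with `a` and `b` and respects the filtration is
`Ã`-linear. -/
def linearOfCommute (f : Module.End ℂ LogSeries) (hA : f * aOp = aOp * f) (hB : f * bOp = bOp * f)
    (hf : ∀ N, ∀ φ ∈ filt N, f φ ∈ filt N) : LogSeries →ₗ[ATilde] LogSeries where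
  toFun := f
  map_add' := map_add f
  map_smul' x φ := by
    rw [RingHom.id_apply, ← sub_eq_zero]
    refine eq_zero_of_forall_mem_filt fun N => ?_
    have h1 := hf N _ (smul_sub_mem x φ N)
    have h2 := smul_sub_mem x (f φ) N
    have hc : f * partialAct aOp bOp N x = partialAct aOp bOp N x * f := by
      have hAc : Commute f aOp := hA
      have hBc : Commute f bOp := hB
      have hP : ∀ P : ℂ[X], Commute f (aeval aOp P) := by
        intro P
        induction P using Polynomial.induction_on with
        | C r => rw [aeval_C]; exact (Algebra.commutes r f).symm
        | add p q hp hq => rw [map_add]; exact hp.add_right hq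
        | monomial k r ih => rw [pow_succ, ← mul_assoc, map_mul, aeval_X]; exact ih.mul_right hAc
      exact Commute.sum_right _ _ _ fun ν _ => (hP _).mul_right (hBc.pow_right ν)
    have h3 := LinearMap.congr_fun hc φ
    simp only [Module.End.mul_apply] at h3
    rw [map_sub, h3] at h1
    have h4 := (filt N).sub_mem h1 h2
    convert h4 using 1
    abel

/-! ### Classes of exponents modulo `ℤ` -/

/-- The exponent `α + m`. -/
def shift (α : Expo) (m : ℕ) : Expo := ⟨α.1 + m, by have := α.2; have : (0 : ℚ) ≤ m := m.cast_nonneg; linarith⟩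

theorem coe_shift (α : Expo) (m : ℕ) : (shift α m).1 = α.1 + m := rfl

/-- The representative in `]-1, 0]` of the class of `β` modulo `ℤ`. -/
def base (β : Expo) : Expo := ⟨β.1 - ⌈β.1⌉, by linarith [Int.ceil_lt_add_one β.1]⟩

/-- The difference between `β` and the representative of its class. -/
def level (β : Expo) : ℕ := ⌈β.1⌉.toNat

theorem coe_level (β : Expo) : (level β : ℤ) = ⌈β.1⌉ := by
  refine Int.toNat_of_nonneg ?_
  have : -1 < ⌈β.1⌉ := Int.lt_ceil.2 (by push_cast; exact β.2)
  omega

theorem coe_base (β : Expo) : (base β).1 = β.1 - level β := by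
  have : ((level β : ℤ) : ℚ) = ⌈β.1⌉ := by rw [coe_level]
  simp only [base]
  rw [← this]; simp

theorem shift_base_level (β : Expo) : shift (base β) (level β) = β :=
  Subtype.ext (by rw [coe_shift, coe_base]; ring)

theorem level_shift (β : Expo) (m : ℕ) : level (shift β m) = level β + m := by
  zify
  rw [coe_level, coe_level, coe_shift, Int.ceil_add_natCast]

theorem base_shift (β : Expo) (m : ℕ) : base (shift β m) = base β :=
  Subtype.ext (by rw [coe_base, coe_base, level_shift, coe_shift]; push_cast; ring)

theorem level_base (β : Expo) : level (base β) = 0 := by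
  have := level_shift (base β) (level β)
  rw [shift_base_level] at this
  omega

theorem base_base (β : Expo) : base (base β) = base β := by
  conv_rhs => rw [← shift_base_level β, base_shift]

theorem base_pred (β : Expo) (h : 0 < β.1) : base (pred β h) = base β := by
  have : shift (pred β h) 1 = β := Subtype.ext (by simp [coe_shift, pred])
  conv_rhs => rw [← this, base_shift]

theorem base_eq_of_eq_add {α β : Expo} {m : ℕ} (h : α.1 = β.1 + m) : base α = base β := by
  rw [← base_shift β m]
  congr 1
  exact Subtype.ext h

/-- As `N` is an integer, `β + 1 ≤ N` can be read on `⌈β⌉`, which is `level β`. -/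
theorem mem_filt_iff {N : ℕ} {φ : LogSeries} :
    φ ∈ filt N ↔ ∀ β, level β < N → φ.coeff β = 0 := by
  have : ∀ β : Expo, β.1 + 1 ≤ N ↔ level β < N := by
    intro β
    rw [← Nat.cast_lt (α := ℤ), coe_level, Int.lt_iff_add_one_le, ← le_sub_iff_add_le,
      ← le_sub_iff_add_le, Int.ceil_le]
    push_cast
    rfl
  simp only [← this]
  rfl

theorem eq_shift_of_base_eq {β ρ : Expo} (h : base β = ρ) : β = shift ρ (level β) := by
  rw [← h, shift_base_level]

/-! ### Monomials -/

/-- The series `s^β q(log s)`. -/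
def single (β : Expo) : ℂ[X] →ₗ[ℂ] LogSeries where
  toFun q := mk fun γ => if γ = β then q else 0
  map_add' p q := by ext1 γ; simp only [coeff_mk, coeff_add]; split_ifs <;> simp
  map_smul' c q := by
    ext1 γ; simp only [coeff_mk, coeff_smul, RingHom.id_apply]; split_ifs <;> simp

theorem coeff_single (β γ : Expo) (q : ℂ[X]) :
    (single β q).coeff γ = if γ = β then q else 0 := rfl

@[simp] theorem coeff_single_self (β : Expo) (q : ℂ[X]) : (single β q).coeff β = q := if_pos rfl

theorem logMono_eq (α : Expo) (j : ℕ) : logMono α j = single α (X ^ j) := rfl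

theorem single_mem_filt {β : Expo} {N : ℕ} (h : N ≤ level β) (q : ℂ[X]) : single β q ∈ filt N := by
  rw [mem_filt_iff]
  intro γ hγ
  rw [coeff_single, if_neg]
  rintro rfl
  omega

theorem thetaOp_single (β : Expo) (q : ℂ[X]) :
    thetaOp (single β q) = single β (((β.1 : ℂ) + 1) • q + derivative q) := by
  ext1 γ
  rw [coeff_thetaOp, coeff_single, coeff_single]
  split_ifs with h
  · rw [h]
  · simp

/-! ### The lattices of series with bounded log-degree in each class of exponents -/

theorem derivative_mem_degreeLT {n : ℕ} {q : ℂ[X]} (h : q ∈ degreeLT ℂ n) :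
    derivative q ∈ degreeLT ℂ n := by
  rw [mem_degreeLT] at h ⊢
  exact (degree_derivative_le).trans_lt h

theorem primPoly_mem_degreeLT {n : ℕ} (β : ℂ) {q : ℂ[X]} (h : q ∈ degreeLT ℂ n) :
    primPoly β q ∈ degreeLT ℂ n := by
  refine Submodule.sum_mem _ fun i _ => Submodule.smul_mem _ _ ?_
  clear * - h
  induction i with
  | zero => exact h
  | succ i ih => rw [Function.iterate_succ_apply']; exact derivative_mem_degreeLT ih

theorem aOp_coeff_mem {D : Expo → ℕ} {φ : LogSeries}
    (h : ∀ β, φ.coeff β ∈ degreeLT ℂ (D (base β))) (β) :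
    (aOp φ).coeff β ∈ degreeLT ℂ (D (base β)) := by
  rw [coeff_aOp]
  split_ifs with h0
  · rw [← base_pred β h0]; exact h _
  · exact zero_mem _

theorem bOp_coeff_mem {D : Expo → ℕ} {φ : LogSeries}
    (h : ∀ β, φ.coeff β ∈ degreeLT ℂ (D (base β))) (β) :
    (bOp φ).coeff β ∈ degreeLT ℂ (D (base β)) := by
  rw [coeff_bOp]
  split_ifs with h0
  · rw [← base_pred β h0]; exact primPoly_mem_degreeLT _ (h _)
  · exact zero_mem _

/-- The series whose coefficient of `s^β` has degree less than `D (base β)` in `log s`. -/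
def lattice (D : Expo → ℕ) : Submodule ATilde LogSeries where
  carrier := {φ | ∀ β, φ.coeff β ∈ degreeLT ℂ (D (base β))}
  add_mem' hx hy β := by rw [coeff_add]; exact add_mem (hx β) (hy β)
  zero_mem' β := zero_mem _
  smul_mem' x φ hφ := by
    let W : Submodule ℂ LogSeries :=
      { carrier := {φ | ∀ β, φ.coeff β ∈ degreeLT ℂ (D (base β))}
        add_mem' := fun hx hy β => by rw [coeff_add]; exact add_mem (hx β) (hy β)
        zero_mem' := fun β => zero_mem _
        smul_mem' := fun c φ h β => by rw [coeff_smul]; exact Submodule.smul_mem _ _ (h β) }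
    have hb : ∀ ν, (bOp ^ ν) φ ∈ W := by
      intro ν
      induction ν with
      | zero => exact hφ
      | succ ν ih => rw [pow_succ', Module.End.mul_apply]; exact bOp_coeff_mem ih
    intro β
    have h1 : (x • φ).coeff β = (partialAct aOp bOp ⌈β.1 + 1⌉₊ x φ).coeff β := by
      have := smul_sub_mem x φ ⌈β.1 + 1⌉₊ β (Nat.le_ceil _)
      rwa [coeff_sub, sub_eq_zero] at this
    rw [h1]
    suffices h : partialAct aOp bOp ⌈β.1 + 1⌉₊ x φ ∈ W from h β
    rw [partialAct, LinearMap.sum_apply]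
    refine Submodule.sum_mem _ fun ν _ => ?_
    exact aeval_mem (F := fun _ => W) (fun _ c hc => aOp_coeff_mem hc) _ 0 _ (hb ν)

theorem lattice_mono {D D' : Expo → ℕ} (h : ∀ β, D β ≤ D' β) : lattice D ≤ lattice D' :=
  fun _ hφ β => degreeLT_mono (h _) (hφ β)

theorem smulC_mem_lattice {D : Expo → ℕ} {φ : LogSeries} (c : ℂ) (h : φ ∈ lattice D) :
    c • φ ∈ lattice D := fun β => by
  rw [coeff_smul]; exact Submodule.smul_mem _ _ (h β)

theorem thetaOp_mem_lattice {D : Expo → ℕ} {φ : LogSeries} (h : φ ∈ lattice D) :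
    thetaOp φ ∈ lattice D := fun β => by
  rw [coeff_thetaOp]
  exact add_mem (Submodule.smul_mem _ _ (h β)) (derivative_mem_degreeLT (h β))

theorem single_mem_lattice {D : Expo → ℕ} {β : Expo} {q : ℂ[X]}
    (h : q ∈ degreeLT ℂ (D (base β))) : single β q ∈ lattice D := by
  intro γ
  rw [coeff_single]
  split_ifs with hγ
  · rwa [hγ]
  · exact zero_mem _

/-- The quotient by `b` is the derivative, which preserves classes modulo `ℤ` and does not raise the
log-degree. -/
theorem exists_bOp_eq {D : Expo → ℕ} {N : ℕ} {φ : LogSeries} (h : φ ∈ lattice D)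
    (hN : φ ∈ filt (N + 1)) : ∃ ψ ∈ lattice D, ψ ∈ filt N ∧ bOp ψ = φ := by
  refine ⟨dOp φ, fun β => ?_, fun β hβ => ?_, bOp_dOp (filt_anti (by omega) hN)⟩
  · have : base ⟨β.1 + 1, by linarith [β.2]⟩ = base β :=
      base_eq_of_eq_add (m := 1) (by simp)
    have h1 := h ⟨β.1 + 1, by linarith [β.2]⟩
    rw [this] at h1
    exact add_mem (Submodule.smul_mem _ _ h1) (derivative_mem_degreeLT h1)
  · have h1 := hN ⟨β.1 + 1, by linarith [β.2]⟩ (by push_cast; linarith)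
    rw [dOp, coeff_mk, h1]
    simp

theorem exists_bOp_pow_eq {D : Expo → ℕ} {N : ℕ} {φ : LogSeries} (h : φ ∈ lattice D)
    (hN : φ ∈ filt N) : ∃ ψ ∈ lattice D, (bOp ^ N) ψ = φ := by
  induction N generalizing φ with
  | zero => exact ⟨φ, h, rfl⟩
  | succ N ih =>
    obtain ⟨ψ, h1, h2, rfl⟩ := exists_bOp_eq h hN
    obtain ⟨χ, h3, rfl⟩ := ih h1 h2
    exact ⟨χ, h3, by rw [pow_succ', Module.End.mul_apply]⟩

end LogSeries

/-! ### Polynomials in the operator `c + d/dz` -/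

theorem eq_sum_of_mem_degreeLT {n : ℕ} {q : ℂ[X]} (h : q ∈ degreeLT ℂ n) :
    q = ∑ i ∈ Finset.range n, q.coeff i • X ^ i := by
  ext k
  simp only [finsetSum_coeff, Polynomial.coeff_smul, coeff_X_pow, smul_eq_mul, mul_ite, mul_one, mul_zero,
    Finset.sum_ite_eq, Finset.mem_range]
  split_ifs with hk
  · rfl
  · exact coeff_eq_zero_of_degree_lt ((mem_degreeLT.1 h).trans_le (by exact_mod_cast not_lt.1 hk))

theorem coeff_eq_zero_of_mem_degreeLT {n k : ℕ} {q : ℂ[X]} (h : q ∈ degreeLT ℂ n) (hk : n ≤ k) :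
    q.coeff k = 0 :=
  coeff_eq_zero_of_degree_lt ((mem_degreeLT.1 h).trans_le (by exact_mod_cast hk))

theorem mem_degreeLT_of_succ {n : ℕ} {q : ℂ[X]} (h : q ∈ degreeLT ℂ (n + 1))
    (h0 : q.coeff n = 0) : q ∈ degreeLT ℂ n := by
  rw [mem_degreeLT, degree_lt_iff_coeff_zero]
  intro m hm
  rcases hm.eq_or_lt with rfl | hm
  · exact h0
  · exact coeff_eq_zero_of_mem_degreeLT h hm

theorem derivative_mem_degreeLT_of_succ {n : ℕ} {q : ℂ[X]} (h : q ∈ degreeLT ℂ (n + 1)) :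
    derivative q ∈ degreeLT ℂ n := by
  rw [mem_degreeLT, degree_lt_iff_coeff_zero]
  intro m hm
  rw [coeff_derivative, coeff_eq_zero_of_mem_degreeLT h (by omega), zero_mul]

theorem eq_zero_of_mem_degreeLT_zero {q : ℂ[X]} (h : q ∈ degreeLT ℂ 0) : q = 0 := by
  ext k; simpa using coeff_eq_zero_of_mem_degreeLT h (Nat.zero_le k)

theorem iterate_derivative_eq_zero_of_mem {n : ℕ} {q : ℂ[X]} (h : q ∈ degreeLT ℂ n) :
    derivative^[n] q = 0 := by
  induction n generalizing q with
  | zero => exact eq_zero_of_mem_degreeLT_zero h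
  | succ n ih => exact ih (derivative_mem_degreeLT_of_succ h)

/-- The operator `c + d/dz` on polynomials. -/
def addDeriv (c : ℂ) : Module.End ℂ ℂ[X] := algebraMap ℂ _ c + derivative

theorem addDeriv_apply (c : ℂ) (q : ℂ[X]) : addDeriv c q = c • q + derivative q := by
  simp [addDeriv, Module.algebraMap_end_apply]

theorem aeval_addDeriv_mem (c : ℂ) (P : ℂ[X]) {k : ℕ} {q : ℂ[X]} (h : q ∈ degreeLT ℂ k) :
    aeval (addDeriv c) P q ∈ degreeLT ℂ k :=
  aeval_mem (F := fun _ => degreeLT ℂ k) (fun _ q hq => by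
    rw [addDeriv_apply]
    exact add_mem (Submodule.smul_mem _ _ hq) (derivative_mem_degreeLT hq)) P 0 q h

/-- For the degree filtration `c + d/dz` is triangular with diagonal `c`, so the top coefficient
only sees `P(c)`. -/
theorem coeff_aeval_addDeriv (c : ℂ) (P : ℂ[X]) {k : ℕ} {q : ℂ[X]} (h : q ∈ degreeLT ℂ (k + 1)) :
    (aeval (addDeriv c) P q).coeff k = P.eval c * q.coeff k := by
  induction P using Polynomial.induction_on generalizing q with
  | C r => simp [Module.algebraMap_end_apply]
  | add P Q hP hQ => simp [hP h, hQ h, add_mul]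
  | monomial j r ih =>
    rw [pow_succ, ← mul_assoc, map_mul, Module.End.mul_apply, aeval_X]
    have h1 : addDeriv c q ∈ degreeLT ℂ (k + 1) := by
      simpa using aeval_addDeriv_mem c X h
    rw [ih h1, addDeriv_apply, Polynomial.coeff_add, Polynomial.coeff_smul, coeff_eq_zero_of_mem_degreeLT
      (derivative_mem_degreeLT_of_succ h) le_rfl]
    simp [mul_assoc]

/-- Subtracting `c` leaves `d/dz`, whose `k`-th power vanishes on polynomials of degree `< k`. -/
theorem aeval_addDeriv_eq_zero {c : ℂ} {P : ℂ[X]} {k : ℕ} (hP : (X - C c) ^ k ∣ P) {q : ℂ[X]}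
    (h : q ∈ degreeLT ℂ k) : aeval (addDeriv c) P q = 0 := by
  obtain ⟨Q, rfl⟩ := hP
  have h1 : addDeriv c - algebraMap ℂ _ c = derivative := by simp [addDeriv]
  rw [mul_comm, map_mul, Module.End.mul_apply, map_pow, map_sub, aeval_X, aeval_C, h1,
    Module.End.pow_apply, iterate_derivative_eq_zero_of_mem h, map_zero]

/-- A subspace of `ℂ[z]` stable under `d/dz` that contains a polynomial of degree `k` contains all
polynomials of degree at most `k`. -/
theorem degreeLT_le_of_derivative_mem {G : Submodule ℂ ℂ[X]} (hG : ∀ q ∈ G, derivative q ∈ G)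
    {k : ℕ} {q : ℂ[X]} (hq : q ∈ G) (hk : q ∈ degreeLT ℂ (k + 1)) (h0 : q.coeff k ≠ 0) :
    degreeLT ℂ (k + 1) ≤ G := by
  induction k generalizing q with
  | zero =>
    intro r hr
    have : r - (r.coeff 0 / q.coeff 0) • q ∈ degreeLT ℂ 0 :=
      mem_degreeLT_of_succ (sub_mem hr (Submodule.smul_mem _ _ hk)) (by simp [h0])
    rw [sub_eq_zero.1 (eq_zero_of_mem_degreeLT_zero this)]
    exact G.smul_mem _ hq
  | succ k ih =>
    have h1 := ih (hG q hq) (derivative_mem_degreeLT_of_succ hk) (by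
      rw [coeff_derivative]; exact mul_ne_zero h0 (by exact_mod_cast k.succ_ne_zero))
    intro r hr
    have : r - (r.coeff (k + 1) / q.coeff (k + 1)) • q ∈ degreeLT ℂ (k + 1) :=
      mem_degreeLT_of_succ (sub_mem hr (Submodule.smul_mem _ _ hk)) (by simp [h0])
    have := G.add_mem (h1 this) (G.smul_mem (r.coeff (k + 1) / q.coeff (k + 1)) hq)
    simpa using this

theorem coeff_primPoly {β : ℂ} (hβ : β ≠ 0) {k : ℕ} {q : ℂ[X]} (h : q ∈ degreeLT ℂ (k + 1)) :
    (primPoly β q).coeff k = β⁻¹ * q.coeff k := by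
  have h1 := congrArg (fun p => p.coeff k) (primPoly_spec hβ q)
  simp only [Polynomial.coeff_add, Polynomial.coeff_smul, smul_eq_mul] at h1
  rw [coeff_eq_zero_of_mem_degreeLT (derivative_mem_degreeLT_of_succ (primPoly_mem_degreeLT β h))
    le_rfl, add_zero] at h1
  rw [← h1]
  field_simp

namespace LogSeries

theorem coeff_aeval_thetaOp (P : ℂ[X]) (φ : LogSeries) (β : Expo) :
    (aeval thetaOp P φ).coeff β = aeval (addDeriv ((β.1 : ℂ) + 1)) P (φ.coeff β) := by
  induction P using Polynomial.induction_on generalizing φ with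
  | C r => simp [Module.algebraMap_end_apply]
  | add P Q hP hQ => simp [hP, hQ]
  | monomial j r ih =>
    rw [pow_succ, ← mul_assoc, map_mul, Module.End.mul_apply, ih, map_mul _ _ X,
      Module.End.mul_apply, aeval_X, aeval_X, coeff_thetaOp, addDeriv_apply]

/-- The polynomial with a root of order `n` at `β + 1` for each `β` in a finite set. -/
def killPoly (F : Finset Expo) (n : ℕ) : ℂ[X] := ∏ β ∈ F, (X - C ((β.1 : ℂ) + 1)) ^ n

theorem coeff_killPoly_eq_zero {F : Finset Expo} {n : ℕ} {φ : LogSeries} {β : Expo} (hβ : β ∈ F)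
    (h : φ.coeff β ∈ degreeLT ℂ n) : (aeval thetaOp (killPoly F n) φ).coeff β = 0 := by
  rw [coeff_aeval_thetaOp]
  exact aeval_addDeriv_eq_zero
    (Finset.dvd_prod_of_mem (fun β : Expo => (X - C ((β.1 : ℂ) + 1)) ^ n) hβ) h

theorem eval_killPoly_eq_zero {F : Finset Expo} {n : ℕ} {c : ℂ} (h : (killPoly F n).eval c = 0) :
    ∃ β ∈ F, c = (β.1 : ℂ) + 1 := by
  rw [killPoly, eval_prod, Finset.prod_eq_zero_iff] at h
  obtain ⟨β, hβ, h⟩ := h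
  refine ⟨β, hβ, ?_⟩
  rw [eval_pow] at h
  simpa [sub_eq_zero] using eq_zero_of_pow_eq_zero h

theorem aeval_thetaOp_mem_lattice {D : Expo → ℕ} (P : ℂ[X]) {φ : LogSeries} (h : φ ∈ lattice D) :
    aeval thetaOp P φ ∈ lattice D := fun β => by
  rw [coeff_aeval_thetaOp]
  exact aeval_addDeriv_mem _ P (h β)

/-! ### Generators of the lattices -/

variable {D : Expo → ℕ} {R : Finset Expo}

/-- Each class contains exactly one exponent of level `m`, the shift by `m` of its representative.
-/
theorem sub_sum_single_mem (hR : ∀ ρ ∈ R, base ρ = ρ) (hD : ∀ β, D (base β) ≠ 0 → base β ∈ R)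
    {m : ℕ} {w : LogSeries} (hw : w ∈ lattice D) (hm : w ∈ filt m) :
    w - ∑ ρ ∈ R, single (shift ρ m) (w.coeff (shift ρ m)) ∈ lattice D ∧
      w - ∑ ρ ∈ R, single (shift ρ m) (w.coeff (shift ρ m)) ∈ filt (m + 1) := by
  classical
  refine ⟨sub_mem hw (sum_mem fun ρ _ => single_mem_lattice (hw _)), ?_⟩
  rw [mem_filt_iff] at hm ⊢
  intro β hβ
  rw [coeff_sub, coeff_sum]
  simp only [coeff_single]
  rcases (Nat.lt_succ_iff_lt_or_eq.1 hβ) with h | h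
  · rw [hm β h, zero_sub, neg_eq_zero]
    refine Finset.sum_eq_zero fun ρ hρ => if_neg ?_
    rintro rfl
    rw [level_shift] at h
    omega
  · have h1 : ∀ ρ ∈ R, (if β = shift ρ m then w.coeff (shift ρ m) else 0)
        = if base β = ρ then w.coeff β else 0 := by
      intro ρ hρ
      by_cases h2 : base β = ρ
      · have h3 := eq_shift_of_base_eq h2
        rw [h] at h3
        rw [if_pos h3, if_pos h2, ← h3]
      · rw [if_neg h2, if_neg]
        rintro rfl
        exact h2 (by rw [base_shift, hR ρ hρ])
    rw [Finset.sum_congr rfl h1, Finset.sum_ite_eq]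
    split_ifs with h2
    · exact sub_self _
    · have h3 : D (base β) = 0 := by_contra fun h3 => h2 (hD β h3)
      have h4 := hw β
      rw [h3] at h4
      rw [eq_zero_of_mem_degreeLT_zero h4, sub_zero]

/-- If a `ℂ[[b]]`-module contains, for each polynomial `q` of admissible degree, a series
with leading term `s^{ρ+m} q(log s)`, then it contains a module of finite type that contains all
series of the lattice of level at least `m`. -/
theorem exists_fg_le (hR : ∀ ρ ∈ R, base ρ = ρ) (hD : ∀ β, D (base β) ≠ 0 → base β ∈ R)
    (S : Submodule (PowerSeries ℂ) LogSeries) (m : ℕ)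
    (hS : ∀ ρ ∈ R, ∀ q ∈ degreeLT ℂ (D ρ), ∃ y ∈ S, y - single (shift ρ m) q ∈ lattice D ∧
      y - single (shift ρ m) q ∈ filt (m + 1)) :
    ∃ T ≤ S, T.FG ∧ ∀ w ∈ lattice D, w ∈ filt m → w ∈ T := by
  classical
  have hX : ∀ ρ i, i < D ρ → (X ^ i : ℂ[X]) ∈ degreeLT ℂ (D ρ) := fun ρ i hi =>
    mem_degreeLT.2 (by rw [degree_X_pow]; exact_mod_cast hi)
  choose! y hyS hyl hyf using hS
  let s : Finset (Σ _ : Expo, ℕ) := R.sigma fun ρ => Finset.range (D ρ)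
  let g : (Σ _ : Expo, ℕ) → LogSeries := fun p => y p.1 (X ^ p.2)
  refine ⟨Submodule.span _ (s.image g : Set LogSeries), ?_, ⟨s.image g, rfl⟩, ?_⟩
  · rw [Submodule.span_le]
    intro z hz
    obtain ⟨⟨ρ, i⟩, hp, rfl⟩ := Finset.mem_image.1 (Finset.mem_coe.1 hz)
    simp only [s, Finset.mem_sigma, Finset.mem_range] at hp
    exact hyS ρ hp.1 _ (hX ρ i hp.2)
  · intro w hw hm
    -- Replacing the leading monomials by the `g p` only alters levels above `m`; the remainder has
    -- level at least `m + 1`, and dividing it by `b` returns to level at least `m`.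
    obtain ⟨S', hS'⟩ := exists_powerSeries_of_step s g (P := fun w => w ∈ lattice D ∧ w ∈ filt m)
      (w := w) (fun w ⟨hw, hm⟩ => by
        obtain ⟨h1, h2⟩ := sub_sum_single_mem hR hD hw hm
        let c : (Σ _ : Expo, ℕ) → ℂ := fun p => (w.coeff (shift p.1 m)).coeff p.2
        have h3 : w - ∑ p ∈ s, c p • g p = (w - ∑ ρ ∈ R, single (shift ρ m) (w.coeff (shift ρ m)))
            - ∑ p ∈ s, c p • (g p - single (shift p.1 m) (X ^ p.2)) := by
          have h4 : ∑ p ∈ s, c p • single (shift p.1 m) (X ^ p.2) =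
              ∑ ρ ∈ R, single (shift ρ m) (w.coeff (shift ρ m)) := by
            rw [Finset.sum_sigma]
            refine Finset.sum_congr rfl fun ρ hρ => ?_
            have h5 := hw (shift ρ m)
            rw [base_shift, hR ρ hρ] at h5
            conv_rhs => rw [eq_sum_of_mem_degreeLT h5]
            rw [map_sum]
            simp only [map_smul, c]
          simp only [smul_sub, Finset.sum_sub_distrib, h4]
          abel
        have h6 : w - ∑ p ∈ s, c p • g p ∈ lattice D := by
          rw [h3]
          refine sub_mem h1 (sum_mem fun p hp => smulC_mem_lattice _ ?_)
          simp only [s, Finset.mem_sigma, Finset.mem_range] at hp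
          exact hyl _ hp.1 _ (hX _ _ hp.2)
        have h7 : w - ∑ p ∈ s, c p • g p ∈ filt (m + 1) := by
          rw [h3]
          refine sub_mem h2 (sum_mem fun p hp => Submodule.smul_mem _ _ ?_)
          simp only [s, Finset.mem_sigma, Finset.mem_range] at hp
          exact hyf _ hp.1 _ (hX _ _ hp.2)
        obtain ⟨ψ, h8, h9, h10⟩ := exists_bOp_eq h6 h7
        exact ⟨c, ψ, ⟨h8, h9⟩, by rw [h10]; abel⟩) ⟨hw, hm⟩
    rw [hS']
    exact sum_mem fun p hp => Submodule.smul_mem _ _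
      (Submodule.subset_span (Finset.mem_coe.2 (Finset.mem_image_of_mem g hp)))

/-- At level `0` the monomials themselves generate the whole lattice, and `ℂ[[b]]` is Noetherian. -/
theorem fg_of_le_lattice (hR : ∀ ρ ∈ R, base ρ = ρ) (hD : ∀ β, D (base β) ≠ 0 → base β ∈ R)
    {S : Submodule (PowerSeries ℂ) LogSeries} (hS : S ≤ toB (lattice D)) : S.FG := by
  obtain ⟨T, -, hT, h⟩ := exists_fg_le hR hD ⊤ 0 fun ρ _ q _ =>
    ⟨single (shift ρ 0) q, trivial, by simp, by simp⟩
  have := isNoetherian_of_fg_of_noetherian T hT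
  exact isNoetherian_submodule.1 this S (hS.trans fun w hw => h w hw (by rw [filt_zero]; trivial))

/-! ### The lattice of a series is commensurable with the module it generates -/

/-- The series `y` with `b^K y ∈ E` for some `K`. -/
def bSaturation (E : Submodule ATilde LogSeries) : Submodule (PowerSeries ℂ) LogSeries where
  carrier := {y | ∃ K : ℕ, (PowerSeries.X ^ K : PowerSeries ℂ) • y ∈ toB E}
  add_mem' := by
    rintro x y ⟨K, hK⟩ ⟨L, hL⟩
    refine ⟨K + L, ?_⟩
    rw [smul_add]
    refine add_mem ?_ ?_
    · rw [add_comm, pow_add, mul_smul]; exact Submodule.smul_mem _ _ hK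
    · rw [pow_add, mul_smul]; exact Submodule.smul_mem _ _ hL
  zero_mem' := ⟨0, by simp⟩
  smul_mem' := by
    rintro f x ⟨K, hK⟩
    exact ⟨K, by rw [smul_comm]; exact Submodule.smul_mem _ _ hK⟩

theorem le_bSaturation (E : Submodule ATilde LogSeries) : toB E ≤ bSaturation E :=
  fun x hx => ⟨0, by simpa using hx⟩

theorem smulC_mem_bSaturation {E : Submodule ATilde LogSeries} (c : ℂ) {y : LogSeries}
    (h : y ∈ bSaturation E) : c • y ∈ bSaturation E := by
  rw [← C_smul]; exact Submodule.smul_mem _ _ h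

/-- Because `b^{K+1} θ y = a b^K y - K b^{K+1} y`. -/
theorem thetaOp_mem_bSaturation {E : Submodule ATilde LogSeries} {y : LogSeries}
    (h : y ∈ bSaturation E) : thetaOp y ∈ bSaturation E := by
  obtain ⟨K, hK⟩ := h
  refine ⟨K + 1, ?_⟩
  have h1 : a • ((PowerSeries.X ^ K : PowerSeries ℂ) • y) ∈ E := E.smul_mem a hK
  rw [a_smul, ← bOp_thetaOp, thetaOp_X_pow_smul, ← X_smul, smul_smul, ← pow_succ', smul_add] at h1
  have h2 : (PowerSeries.X ^ (K + 1) : PowerSeries ℂ) • (K : ℂ) • y ∈ toB E := by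
    rw [← C_smul, smul_smul, mul_comm, pow_succ', ← mul_assoc, mul_smul]
    exact Submodule.smul_mem _ _ hK
  simpa using (toB E).sub_mem h1 h2

theorem aeval_thetaOp_mem_bSaturation {E : Submodule ATilde LogSeries} (P : ℂ[X]) {y : LogSeries}
    (h : y ∈ bSaturation E) : aeval thetaOp P y ∈ bSaturation E := by
  let W : Submodule ℂ LogSeries :=
    { carrier := bSaturation E
      add_mem' := (bSaturation E).add_mem
      zero_mem' := (bSaturation E).zero_mem
      smul_mem' := fun c _ => smulC_mem_bSaturation c }
  exact aeval_mem (F := fun _ => W) (fun _ _ => thetaOp_mem_bSaturation) P 0 y h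

/-- Each primitive divides the coefficient of the highest power of `log s` by a nonzero exponent, so
multiplying by `b^j` carries a nonvanishing top coefficient `j` levels up. -/
theorem coeff_bOp_pow_shift {ρ : Expo} {m k : ℕ} {φ : LogSeries}
    (hφ : ∀ j, φ.coeff (shift ρ j) ∈ degreeLT ℂ (k + 1))
    (h0 : (φ.coeff (shift ρ m)).coeff k ≠ 0) (j : ℕ) :
    (((bOp ^ j) φ).coeff (shift ρ (m + j))).coeff k ≠ 0 := by
  suffices h : (∀ i, ((bOp ^ j) φ).coeff (shift ρ (i + j)) ∈ degreeLT ℂ (k + 1)) ∧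
      (((bOp ^ j) φ).coeff (shift ρ (m + j))).coeff k ≠ 0 from h.2
  induction j with
  | zero => exact ⟨fun i => hφ i, h0⟩
  | succ j ih =>
    have hpos : ∀ i, 0 < (shift ρ (i + (j + 1))).1 := by
      intro i
      rw [coe_shift]; push_cast
      have := ρ.2
      have : (0 : ℚ) ≤ i := i.cast_nonneg
      have : (0 : ℚ) ≤ j := j.cast_nonneg
      linarith
    have hp : ∀ i, pred (shift ρ (i + (j + 1))) (hpos i) = shift ρ (i + j) := by
      intro i; exact Subtype.ext (by simp [pred, coe_shift]; ring)
    constructor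
    · intro i
      rw [pow_succ', Module.End.mul_apply, coeff_bOp, dif_pos (hpos i), hp]
      exact primPoly_mem_degreeLT _ (ih.1 i)
    · rw [pow_succ', Module.End.mul_apply, coeff_bOp, dif_pos (hpos m), hp,
        coeff_primPoly (by exact_mod_cast (hpos m).ne') (ih.1 m)]
      exact mul_ne_zero (inv_ne_zero (by exact_mod_cast (hpos m).ne')) ih.2

/-- The heart of the finiteness: `htop` says that every bound `D ρ` is attained by `φ`. Polynomials
in `θ` isolate one exponent, and differentiation of its top polynomial yields all admissible leading
terms at a common level, so `exists_fg_le` applies. -/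
theorem lattice_le_bSaturation (hR : ∀ ρ ∈ R, base ρ = ρ)
    (hD : ∀ β, D (base β) ≠ 0 → base β ∈ R) {φ : LogSeries} (hφ : φ ∈ lattice D)
    (htop : ∀ ρ ∈ R, ∀ k, D ρ = k + 1 → ∃ m, (φ.coeff (shift ρ m)).coeff k ≠ 0) :
    toB (lattice D) ≤ bSaturation (Submodule.span ATilde {φ}) := by
  classical
  set E := Submodule.span ATilde {φ}
  have hφE : φ ∈ E := Submodule.mem_span_singleton_self φ
  choose! μ hμ using htop
  -- In the class of `ρ` the top power of `log s` occurs at level `μ ρ (D ρ - 1)`; a power of `b`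
  -- raises it to the common level `m`.
  let m : ℕ := R.sup fun ρ => μ ρ (D ρ - 1)
  let n : ℕ := R.sup D
  have key := exists_fg_le hR hD (bSaturation E) m (fun ρ hρ => by
    rcases hk : D ρ with _ | k
    · intro q hq
      refine ⟨0, zero_mem _, ?_⟩
      rw [eq_zero_of_mem_degreeLT_zero hq]
      simp
    -- The possible leading polynomials at `shift ρ m`, modulo higher levels; the goal is that `G`
    -- contains every degree up to `k`.
    let G : Submodule ℂ ℂ[X] :=
      { carrier := {q | ∃ y ∈ bSaturation E, y - single (shift ρ m) q ∈ lattice D ∧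
          y - single (shift ρ m) q ∈ filt (m + 1)}
        add_mem' := by
          rintro p q ⟨y, h1, h2, h3⟩ ⟨z, h4, h5, h6⟩
          have e : y + z - single (shift ρ m) (p + q) =
              (y - single (shift ρ m) p) + (z - single (shift ρ m) q) := by rw [map_add]; abel
          refine ⟨y + z, add_mem h1 h4, ?_⟩
          rw [e]
          exact ⟨add_mem h2 h5, add_mem h3 h6⟩
        zero_mem' := ⟨0, zero_mem _, by simp⟩
        smul_mem' := by
          rintro c q ⟨y, h1, h2, h3⟩
          refine ⟨c • y, smulC_mem_bSaturation c h1, ?_⟩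
          rw [map_smul, ← smul_sub]
          exact ⟨smulC_mem_lattice c h2, Submodule.smul_mem _ c h3⟩ }
    -- `θ - c`, with `c` the exponent plus one, differentiates the leading polynomial.
    have hG : ∀ q ∈ G, derivative q ∈ G := by
      rintro q ⟨y, h1, h2, h3⟩
      set c : ℂ := ((shift ρ m).1 : ℂ) + 1
      have e : thetaOp y - c • y - single (shift ρ m) (derivative q) =
          thetaOp (y - single (shift ρ m) q) - c • (y - single (shift ρ m) q) := by
        rw [map_sub, thetaOp_single, map_add, map_smul, smul_sub]
        abel
      refine ⟨thetaOp y - c • y, sub_mem (thetaOp_mem_bSaturation h1) (smulC_mem_bSaturation c h1), ?_⟩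
      rw [e]
      exact ⟨sub_mem (thetaOp_mem_lattice h2) (smulC_mem_lattice c h2),
        sub_mem (thetaOp_mem_filt h3) (Submodule.smul_mem _ c h3)⟩
    obtain ⟨j, hj⟩ : ∃ j, m = μ ρ k + j := by
      have : μ ρ (D ρ - 1) ≤ m := Finset.le_sup (f := fun ρ => μ ρ (D ρ - 1)) hρ
      rw [hk, Nat.add_sub_cancel] at this
      exact ⟨m - μ ρ k, by omega⟩
    set χ := (bOp ^ j) φ
    have hχE : χ ∈ E := by
      have := (toB E).smul_mem (PowerSeries.X ^ j) hφE
      rwa [X_pow_smul] at this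
    have hχD : χ ∈ lattice D := by
      have := (toB (lattice D)).smul_mem (PowerSeries.X ^ j) hφ
      rwa [X_pow_smul] at this
    have hχ : (χ.coeff (shift ρ m)).coeff k ≠ 0 := by
      rw [hj]
      refine coeff_bOp_pow_shift (fun i => ?_) (hμ ρ hρ k hk) j
      have := hφ (shift ρ i)
      rwa [base_shift, hR ρ hρ, hk] at this
    -- All other exponents of level at most `m` in the classes of `R`; the order `n` in `killPoly`
    -- exceeds the log-degree in each of them.
    let F : Finset Expo := ((R ×ˢ Finset.range (m + 1)).image fun p => shift p.1 p.2).erase (shift ρ m)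
    set y := aeval thetaOp (killPoly F n) χ
    have hyD : y ∈ lattice D := aeval_thetaOp_mem_lattice _ hχD
    have hyk : y.coeff (shift ρ m) ∈ degreeLT ℂ (k + 1) := by
      have := hyD (shift ρ m)
      rwa [base_shift, hR ρ hρ, hk] at this
    have hχk : χ.coeff (shift ρ m) ∈ degreeLT ℂ (k + 1) := by
      have := hχD (shift ρ m)
      rwa [base_shift, hR ρ hρ, hk] at this
    have hyG : y.coeff (shift ρ m) ∈ G := by
      refine ⟨y, aeval_thetaOp_mem_bSaturation _ (le_bSaturation E hχE),
        sub_mem hyD (single_mem_lattice (hyD _)), ?_⟩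
      rw [mem_filt_iff]
      intro β hβ
      rw [coeff_sub, coeff_single]
      split_ifs with h
      · rw [h, sub_self]
      rw [sub_zero]
      by_cases hβR : D (base β) = 0
      · have := hyD β
        rw [hβR] at this
        exact eq_zero_of_mem_degreeLT_zero this
      · refine coeff_killPoly_eq_zero (Finset.mem_erase.2 ⟨h, Finset.mem_image.2
          ⟨(base β, level β), Finset.mem_product.2 ⟨hD β hβR, Finset.mem_range.2 hβ⟩,
            shift_base_level β⟩⟩) (degreeLT_mono ?_ (hχD β))
        exact Finset.le_sup (f := D) (hD β hβR)
    -- The top coefficient is multiplied by the value of `killPoly F n` at `shift ρ m` plus one,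
    -- nonzero because `shift ρ m` was erased from `F`.
    have hy0 : (y.coeff (shift ρ m)).coeff k ≠ 0 := by
      rw [coeff_aeval_thetaOp, coeff_aeval_addDeriv _ _ hχk]
      refine mul_ne_zero (fun h0 => ?_) hχ
      obtain ⟨β, hβ, h1⟩ := eval_killPoly_eq_zero h0
      refine (Finset.mem_erase.1 hβ).1 (Subtype.ext ?_)
      have h2 : (((shift ρ m).1 : ℚ) : ℂ) = ((β.1 : ℚ) : ℂ) := add_right_cancel h1
      exact_mod_cast h2.symm
    exact fun q hq => degreeLT_le_of_derivative_mem hG hyG hyk hy0 hq)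
  obtain ⟨T, hTS, -, hT⟩ := key
  intro w hw
  have h1 : (PowerSeries.X ^ m : PowerSeries ℂ) • w ∈ bSaturation E := by
    refine hTS (hT _ ((toB (lattice D)).smul_mem _ hw) ?_)
    rw [X_pow_smul]
    have := filt_mem_of_bOp_pow 0 m (φ := w) (by rw [filt_zero]; trivial)
    rwa [zero_add] at this
  obtain ⟨K, hK⟩ := h1
  exact ⟨K + m, by rwa [pow_add, mul_smul]⟩

/-- The lattice has finite type, so the largest exponent needed by its generators serves for all
elements. -/
theorem exists_X_pow_smul_lattice_mem (hR : ∀ ρ ∈ R, base ρ = ρ)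
    (hD : ∀ β, D (base β) ≠ 0 → base β ∈ R) {φ : LogSeries} (hφ : φ ∈ lattice D)
    (htop : ∀ ρ ∈ R, ∀ k, D ρ = k + 1 → ∃ m, (φ.coeff (shift ρ m)).coeff k ≠ 0) :
    ∃ K : ℕ, ∀ w ∈ lattice D,
      (PowerSeries.X ^ K : PowerSeries ℂ) • w ∈ Submodule.span ATilde {φ} := by
  classical
  have h1 := lattice_le_bSaturation hR hD hφ htop
  obtain ⟨s, hs⟩ := fg_of_le_lattice hR hD (le_refl (toB (lattice D)))
  set E := Submodule.span ATilde {φ}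
  have h2 : ∀ w ∈ s, ∃ K : ℕ, (PowerSeries.X ^ K : PowerSeries ℂ) • w ∈ toB E := fun w hw =>
    h1 (hs ▸ Submodule.subset_span (Finset.mem_coe.2 hw))
  choose! K hK using h2
  refine ⟨s.sup K, fun w hw => ?_⟩
  have hw' : w ∈ toB (lattice D) := hw
  rw [← hs] at hw'
  clear hw
  suffices h : (PowerSeries.X ^ s.sup K : PowerSeries ℂ) • w ∈ toB E from h
  induction hw' using Submodule.span_induction with
  | mem x hx =>
    obtain ⟨j, hj⟩ := Nat.exists_eq_add_of_le (Finset.le_sup (f := K) (Finset.mem_coe.1 hx))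
    rw [hj, add_comm, pow_add, mul_smul]
    exact Submodule.smul_mem _ _ (hK x hx)
  | zero => simp
  | add x y _ _ hx hy => rw [smul_add]; exact add_mem hx hy
  | smul c x _ hx => rw [smul_comm]; exact Submodule.smul_mem _ _ hx

end LogSeries

/-! ### The operator `b⁻¹ a` on `E[b⁻¹]` -/

theorem LocalizedModule_mk_add {A M : Type*} [CommRing A] [AddCommGroup M] [Module A M]
    {S : Submonoid A} (x y : M) (s : S) :
    LocalizedModule.mk (x + y) s = LocalizedModule.mk x s + LocalizedModule.mk y s := by
  rw [LocalizedModule.mk_add_mk]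
  refine LocalizedModule.mk_eq.2 ⟨1, ?_⟩
  simp only [Submonoid.smul_def, one_smul, mul_smul, smul_add]

section theta

/-- The Leibniz rule of `theta_smul` after clearing denominators, with the derivatives as free
variables so that `module` can close it. -/
theorem theta_smul_aux {A M : Type*} [CommRing A] [AddCommGroup M] [Module A M]
    (X s ds f df : A) (x x' : M) :
    (X * s * s * s) • (s • (f • x' + (X ^ 2 * df) • x) - (X ^ 2 * ds) • f • x) =
      (X * s * s) • (s • f • (s • x' - (X ^ 2 * ds) • x) + (X * s * s) • (X * df) • x) := by
  module

theorem theta_step_aux {A M : Type*} [CommRing A] [AddCommGroup M] [Module A M]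
    (X q l : A) (x y z : M) :
    q • (X • y + l • x) + X • z = (q * l) • x + X • (q • y + z) := by
  module

theorem theta_lattice_aux {A M : Type*} [CommRing A] [AddCommGroup M] [Module A M]
    (X k : A) (K : ℕ) (x x' : M) :
    X ^ K • (X • X ^ K • (x' + k • x) - k • X • X ^ K • x) = X ^ (K + 1) • X ^ K • x' := by
  module

variable {E : Type*} [AddCommGroup E] [Module ATilde E]

theorem theta_smul (f : PowerSeries ℂ) (y : BInv E) :
    theta E (f • y) = f • theta E y + (PowerSeries.X * PowerSeries.derivative ℂ f) • y := by
  induction y using LocalizedModule.induction_on with | _ x s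
  have h1 : ∀ z : E, theta E (LocalizedModule.mk z s) = LocalizedModule.mk
      ((s : PowerSeries ℂ) • (a • z)
        - (PowerSeries.X ^ 2 * PowerSeries.derivative ℂ (s : PowerSeries ℂ)) • z)
      (⟨PowerSeries.X, Submonoid.mem_powers _⟩ * s * s) := fun z => thetaFun_mk z s
  rw [LocalizedModule.smul'_mk, LocalizedModule.smul'_mk, h1, h1, LocalizedModule.smul'_mk,
    LocalizedModule.mk_add_mk]
  refine LocalizedModule.mk_eq.2 ⟨1, ?_⟩
  simp only [Submonoid.smul_def, Submonoid.coe_mul, a_smul_smul, one_smul]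
  exact theta_smul_aux _ _ _ _ _ _ _

theorem theta_C_smul (c : ℂ) (y : BInv E) :
    theta E ((PowerSeries.C c : PowerSeries ℂ) • y) = (PowerSeries.C c : PowerSeries ℂ) • theta E y := by
  rw [theta_smul]
  simp

theorem theta_X_smul (y : BInv E) :
    theta E ((PowerSeries.X : PowerSeries ℂ) • y) = (PowerSeries.X : PowerSeries ℂ) • (theta E y + y) := by
  rw [theta_smul, PowerSeries.derivative_X, mul_one, smul_add]

theorem mk_mem_saturation (x : E) : LocalizedModule.mk x 1 ∈ saturation E :=
  Submodule.mem_sInf.2 fun _ hF => hF.1 x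

theorem theta_mem_saturation {y : BInv E} (hy : y ∈ saturation E) : theta E y ∈ saturation E :=
  Submodule.mem_sInf.2 fun F hF => hF.2 y (Submodule.mem_sInf.1 hy F hF)

theorem X_smul_theta_mk (x : E) : (PowerSeries.X : PowerSeries ℂ) • theta E (LocalizedModule.mk x 1) =
    LocalizedModule.mk (a • x) 1 := by
  have := theta_mk_X_pow x 0
  simp only [pow_zero, Nat.cast_zero, zero_smul, sub_zero, zero_add, pow_one] at this
  have h1 : (⟨1, pow_mem (Submonoid.mem_powers (PowerSeries.X : PowerSeries ℂ)) 0⟩ :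
    Submonoid.powers (PowerSeries.X : PowerSeries ℂ)) = 1 := rfl
  erw [this]
  rw [LocalizedModule.smul'_mk]
  refine LocalizedModule.mk_eq.2 ⟨1, ?_⟩
  simp only [Submonoid.smul_def, one_smul]

end theta

/-! ### Torsion-freeness, and the smallest lattice containing a series -/

namespace LogSeries

/-- A nonzero element of `ℂ[[b]]` is a unit times a power of `b`, and `b` is injective. -/
instance : Module.IsTorsionFree (PowerSeries ℂ) LogSeries := by
  refine Module.IsTorsionFree.of_smul_eq_zero fun f φ h => or_iff_not_imp_left.2 fun hf => ?_
  obtain ⟨u, hu⟩ := PowerSeries.isUnit_divided_by_X_pow_order hf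
  have h2 := congrArg (fun z => (↑u⁻¹ : PowerSeries ℂ) • z) h
  simp only [smul_zero, smul_smul] at h2
  rw [← PowerSeries.X_pow_order_mul_divXPowOrder (f := f), ← hu, mul_comm, mul_assoc, u.mul_inv,
    mul_one, X_pow_smul, Module.End.pow_apply] at h2
  exact bOp_injective.iterate _ (h2.trans (by rw [← Module.End.pow_apply, map_zero]))

/-- `D` is the least bound on the log-degree in each class; minimality says that the bound is
attained, which is the last clause. -/
theorem exists_lattice {n : ℕ} {φ : LogSeries} (hφ : φ ∈ Xi n) :
    ∃ (D : Expo → ℕ) (R : Finset Expo), (∀ ρ ∈ R, base ρ = ρ) ∧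
      (∀ β, D (base β) ≠ 0 → base β ∈ R) ∧ φ ∈ lattice D ∧
      ∀ ρ ∈ R, ∀ k, D ρ = k + 1 → ∃ m, (φ.coeff (shift ρ m)).coeff k ≠ 0 := by
  classical
  obtain ⟨A, hA⟩ := hφ
  have hex : ∀ ρ, ∃ d, ∀ m, φ.coeff (shift ρ m) ∈ degreeLT ℂ d := fun ρ => ⟨n + 1, fun m => by
    rw [mem_degreeLT, Nat.cast_succ]
    exact (natDegree_le_iff_degree_le.1 (hA _).1).trans_lt (by exact_mod_cast n.lt_succ_self)⟩
  refine ⟨fun ρ => Nat.find (hex ρ), A.image base, ?_, ?_, ?_, ?_⟩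
  · intro ρ hρ
    obtain ⟨α, -, rfl⟩ := Finset.mem_image.1 hρ
    exact base_base α
  · intro β hβ
    rw [Ne, Nat.find_eq_zero, not_forall] at hβ
    obtain ⟨m, hm⟩ := hβ
    obtain ⟨α, hα, k, hk⟩ := (hA (shift (base β) m)).2 fun h0 => hm (by rw [h0]; exact zero_mem _)
    have := base_eq_of_eq_add hk
    rw [base_shift, base_base] at this
    exact Finset.mem_image.2 ⟨α, hα, this.symm⟩
  · intro β
    have := Nat.find_spec (hex (base β)) (level β)
    rwa [shift_base_level] at this
  · intro ρ _ k hk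
    replace hk : Nat.find (hex ρ) = k + 1 := hk
    by_contra! h
    refine Nat.find_min (hex ρ) (m := k) (by omega) fun m => mem_degreeLT_of_succ ?_ (h m)
    have := Nat.find_spec (hex ρ) m
    rwa [hk] at this

end LogSeries

/-! ### Modules commensurable with a lattice are regular and geometric -/

section monogenic

variable {D : Expo → ℕ} {R : Finset Expo} {E : Submodule ATilde LogSeries}

/-- Finite type comes from the lattice; a torsion-free module of finite type over the principal
ideal domain `ℂ[[b]]` is free. -/
theorem isABModule_of_le_lattice (hR : ∀ ρ ∈ R, base ρ = ρ)
    (hD : ∀ β, D (base β) ≠ 0 → base β ∈ R) (hE : E ≤ lattice D) : IsABModule E := by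
  have h1 : (toB E).FG := fg_of_le_lattice hR hD hE
  let e : ↥(toB E) ≃ₗ[PowerSeries ℂ] E :=
    { toFun := fun x => ⟨x.1, x.2⟩
      invFun := fun x => ⟨x.1, x.2⟩
      map_add' := fun _ _ => rfl
      map_smul' := fun _ _ => rfl
      left_inv := fun _ => rfl
      right_inv := fun _ => rfl }
  have h2 : Module.Finite (PowerSeries ℂ) (toB E) := Module.Finite.iff_fg.2 h1
  have h3 : Module.Free (PowerSeries ℂ) (toB E) := inferInstance
  exact ⟨Module.Free.of_equiv e, Module.Finite.equiv e⟩

/-- The map `w ↦ b^K w / b^K` from a lattice `W` with `b^K W ⊂ E` to `E[b⁻¹]`. -/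
def latticeToBInv (K : ℕ)
    (hK : ∀ w ∈ lattice D, (PowerSeries.X ^ K : PowerSeries ℂ) • w ∈ E) :
    toB (lattice D) →ₗ[PowerSeries ℂ] BInv E where
  toFun w := LocalizedModule.mk ⟨_, hK w.1 w.2⟩
    ⟨PowerSeries.X ^ K, pow_mem (Submonoid.mem_powers _) K⟩
  map_add' v w := by
    rw [← LocalizedModule_mk_add]
    congr 1
    exact Subtype.ext (smul_add _ _ _)
  map_smul' f w := by
    rw [RingHom.id_apply, LocalizedModule.smul'_mk]
    congr 1
    exact Subtype.ext (smul_comm _ _ _)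

variable {K : ℕ} {hK : ∀ w ∈ lattice D, (PowerSeries.X ^ K : PowerSeries ℂ) • w ∈ E}

theorem latticeToBInv_of_mem {w : LogSeries} (hw : w ∈ toB (lattice D)) (hE : w ∈ E) :
    latticeToBInv K hK ⟨w, hw⟩ = LocalizedModule.mk ⟨w, hE⟩ 1 := by
  refine LocalizedModule.mk_eq.2 ⟨1, Subtype.ext ?_⟩
  simp only [Submonoid.smul_def, one_smul]
  rfl

theorem theta_latticeToBInv {w w' : LogSeries} (hw : w ∈ toB (lattice D))
    (hw' : w' ∈ toB (lattice D)) (h : w' = thetaOp w) :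
    theta E (latticeToBInv K hK ⟨w, hw⟩) = latticeToBInv K hK ⟨w', hw'⟩ := by
  subst h
  refine (theta_mk_X_pow _ K).trans (LocalizedModule.mk_eq.2 ⟨1, Subtype.ext ?_⟩)
  simp only [Submonoid.smul_def, one_smul]
  change (PowerSeries.X ^ K : PowerSeries ℂ) • (a • ((PowerSeries.X ^ K : PowerSeries ℂ) • w) -
    (K : ATilde) • b • ((PowerSeries.X ^ K : PowerSeries ℂ) • w)) =
    (PowerSeries.X ^ (K + 1) : PowerSeries ℂ) • (PowerSeries.X ^ K : PowerSeries ℂ) • thetaOp w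
  rw [a_smul, ← bOp_thetaOp, thetaOp_X_pow_smul, ← X_smul, ← X_smul_eq, ← map_natCast ofB,
    ← smul_eq, ← C_smul, map_natCast]
  exact theta_lattice_aux _ _ _ _ _

/-- The image of the lattice contains `E` and is stable under `b⁻¹ a`, because the lattice is stable
under `θ`; minimality of `E^♯` does the rest. -/
theorem saturation_le_range (hE : E ≤ lattice D) :
    saturation E ≤ LinearMap.range (latticeToBInv K hK) := by
  refine sInf_le ⟨fun x => ⟨⟨x.1, hE x.2⟩, latticeToBInv_of_mem _ x.2⟩, ?_⟩
  rintro _ ⟨w, rfl⟩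
  exact ⟨_, (theta_latticeToBInv w.2 (thetaOp_mem_lattice w.2) rfl).symm⟩

/-- Modulo `b E^♯`, an eigenvector of `θ` with eigenvalue `lam` is multiplied by `Q(lam)` under
`Q(θ)`. -/
theorem exists_aeval_thetaOp_sub {w : LogSeries} (hw : w ∈ toB (lattice D))
    {lam : ℂ} {y : BInv E} (hy : y ∈ saturation E)
    (h : theta E (latticeToBInv K hK ⟨w, hw⟩) -
      (PowerSeries.C lam : PowerSeries ℂ) • latticeToBInv K hK ⟨w, hw⟩ =
        (PowerSeries.X : PowerSeries ℂ) • y) (Q : ℂ[X]) {v : LogSeries}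
    (hv : v ∈ toB (lattice D)) (hvQ : v = aeval thetaOp Q w) :
    ∃ z ∈ saturation E, latticeToBInv K hK ⟨v, hv⟩ =
      (PowerSeries.C (Q.eval lam) : PowerSeries ℂ) • latticeToBInv K hK ⟨w, hw⟩ +
        (PowerSeries.X : PowerSeries ℂ) • z := by
  induction Q using Polynomial.induction_on generalizing v with
  | C r =>
    refine ⟨0, zero_mem _, ?_⟩
    rw [smul_zero, add_zero, eval_C, ← map_smul]
    congr 1
    refine Subtype.ext ?_
    change v = (PowerSeries.C r : PowerSeries ℂ) • w
    rw [hvQ]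
    simp [Module.algebraMap_end_apply, C_smul]
  | add P Q hP hQ =>
    obtain ⟨z, hz, hP⟩ := hP (aeval_thetaOp_mem_lattice P hw) rfl
    obtain ⟨z', hz', hQ⟩ := hQ (aeval_thetaOp_mem_lattice Q hw) rfl
    refine ⟨z + z', add_mem hz hz', ?_⟩
    rw [eval_add, map_add PowerSeries.C, add_smul, smul_add, add_add_add_comm, ← hP, ← hQ, ← map_add]
    congr 1
    exact Subtype.ext (by simp [hvQ])
  | monomial j r ih =>
    have hpow : C r * X ^ (j + 1) = C r * X ^ j * X := by rw [pow_succ, mul_assoc]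
    rw [hpow] at hvQ ⊢
    generalize C r * X ^ j = Q at ih hvQ
    have hQw : aeval thetaOp Q w ∈ toB (lattice D) := aeval_thetaOp_mem_lattice Q hw
    obtain ⟨z, hz, ih⟩ := ih hQw rfl
    -- From `θ x = lam x + b y` one gets `θ (Q(lam) x + b z) = Q(lam) lam x + b (Q(lam) y + θ z +
    -- z)`.
    refine ⟨(PowerSeries.C (Q.eval lam) : PowerSeries ℂ) • y + (theta E z + z),
      add_mem (Submodule.smul_mem _ _ hy) (add_mem (theta_mem_saturation hz) hz), ?_⟩
    rw [← theta_latticeToBInv hQw hv (by rw [hvQ, mul_comm, map_mul, aeval_X]; rfl), ih, map_add,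
      theta_C_smul, theta_X_smul, sub_eq_iff_eq_add.1 h, eval_mul, eval_X, map_mul,
     ]
    exact theta_step_aux _ _ _ _ _ _

/-- `E^♯` sits in a Noetherian copy of the lattice. For the eigenvalues, a polynomial with roots `β
+ 1` sends an eigenvector into `b E^♯`, so it vanishes at the eigenvalue. -/
theorem isRegularGeometric_of_lattice (hR : ∀ ρ ∈ R, base ρ = ρ)
    (hD : ∀ β, D (base β) ≠ 0 → base β ∈ R) (hE : E ≤ lattice D) (K : ℕ)
    (hK : ∀ w ∈ lattice D, (PowerSeries.X ^ K : PowerSeries ℂ) • w ∈ E) :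
    IsRegularGeometric E := by
  classical
  have hfin : Module.Finite (PowerSeries ℂ) (toB (lattice D)) :=
    Module.Finite.iff_fg.2 (fg_of_le_lattice hR hD le_rfl)
  have hle := saturation_le_range (hK := hK) hE
  refine ⟨⟨isABModule_of_le_lattice hR hD hE, ?_⟩, ?_⟩
  · have : IsNoetherian (PowerSeries ℂ) (LinearMap.range (latticeToBInv K hK)) :=
      isNoetherian_of_isNoetherianRing_of_finite _ _
    exact isNoetherian_submodule.1 this _ hle
  · rintro lam ⟨x, hx, hxb, y, hy, h⟩
    obtain ⟨⟨w, hw⟩, rfl⟩ := hle hx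
    -- Killing levels `0` to `K` makes the result divisible by `b^{K+1}` in the lattice: `K` factors
    -- to enter `E`, and one to spare.
    let F : Finset Expo := (R ×ˢ Finset.range (K + 1)).image fun p => shift p.1 p.2
    have hwD : aeval thetaOp (killPoly F (R.sup D)) w ∈ toB (lattice D) :=
      aeval_thetaOp_mem_lattice (killPoly F (R.sup D)) hw
    obtain ⟨z, hz, h1⟩ := exists_aeval_thetaOp_sub hw hy h (killPoly F (R.sup D)) hwD rfl
    have h2 : aeval thetaOp (killPoly F (R.sup D)) w ∈ LogSeries.filt (K + 1) := by
      rw [mem_filt_iff]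
      intro β hβ
      by_cases hβR : D (base β) = 0
      · have := hwD β
        rw [hβR] at this
        exact eq_zero_of_mem_degreeLT_zero this
      · exact coeff_killPoly_eq_zero (Finset.mem_image.2
          ⟨(base β, level β), Finset.mem_product.2 ⟨hD β hβR, Finset.mem_range.2 hβ⟩,
            shift_base_level β⟩) (degreeLT_mono (Finset.le_sup (f := D) (hD β hβR)) (hw β))
    obtain ⟨v, hv, h3⟩ := exists_bOp_pow_eq hwD h2
    rw [← X_pow_smul] at h3
    have hKv := hK v hv
    have h4 : latticeToBInv K hK ⟨_, hwD⟩ =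
        (PowerSeries.X : PowerSeries ℂ) • LocalizedModule.mk ⟨_, hKv⟩ 1 := by
      rw [← latticeToBInv_of_mem (hK := hK) (hE hKv) hKv, ← map_smul]
      congr 1
      refine Subtype.ext ?_
      change _ = (PowerSeries.X : PowerSeries ℂ) • (PowerSeries.X ^ K : PowerSeries ℂ) • v
      rw [smul_smul, ← pow_succ', h3]
    -- Otherwise dividing by this scalar would put `x` in `b E^♯`.
    have h5 : (killPoly F (R.sup D)).eval lam = 0 := by
      by_contra h0
      refine hxb ⟨(PowerSeries.C ((killPoly F (R.sup D)).eval lam)⁻¹ : PowerSeries ℂ) •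
        (LocalizedModule.mk ⟨_, hKv⟩ 1 - z),
        Submodule.smul_mem _ _ (sub_mem (mk_mem_saturation _) hz), ?_⟩
      rw [smul_comm, smul_sub, ← h4, h1, add_sub_cancel_right, smul_smul, ← map_mul,
        inv_mul_cancel₀ h0, map_one, one_smul]
    obtain ⟨β, -, h6⟩ := eval_killPoly_eq_zero h5
    exact ⟨β.1 + 1, by linarith [β.2], by rw [h6]; push_cast; rfl⟩

end monogenic

theorem span_isMonogenic_isRegularGeometric {n : ℕ} {φ : LogSeries} (hφ : φ ∈ Xi n) :
    IsMonogenic (Submodule.span ATilde {φ}) ∧ IsRegularGeometric (Submodule.span ATilde {φ}) := by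
  obtain ⟨D, R, hR, hD, hφD, htop⟩ := exists_lattice hφ
  obtain ⟨K, hK⟩ := exists_X_pow_smul_lattice_mem hR hD hφD htop
  have hE : Submodule.span ATilde {φ} ≤ lattice D := by
    rw [Submodule.span_singleton_le_iff_mem]; exact hφD
  refine ⟨⟨isABModule_of_le_lattice hR hD hE, ?_⟩, isRegularGeometric_of_lattice hR hD hE K hK⟩
  have e := (LinearMap.toSpanSingleton ATilde LogSeries φ).quotKerEquivRange
  rw [← LinearMap.span_singleton_eq_range] at e
  exact ⟨_, ⟨e.symm⟩⟩

/-! ### Division by `b` in `Ã` -/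

namespace ATilde

/-- The recursion `u_{m+1} = y_m - u_m'` defining `u = b y` is solved for `y`. -/
theorem exists_eq_b_mul {x : ATilde} (h : x.coeff 0 = 0) : ∃ y, x = b * y := by
  refine ⟨mk fun m => x.coeff (m + 1) + derivative (x.coeff m), ?_⟩
  rw [b_mul]
  ext1 m
  induction m with
  | zero => simp [h]
  | succ m ih => rw [coeff_bMul_succ, ← ih, coeff_mk, add_sub_cancel_right]

theorem exists_eq_b_pow_mul {N : ℕ} {x : ATilde} (h : ∀ m < N, x.coeff m = 0) :
    ∃ y, x = b ^ N * y := by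
  induction N generalizing x with
  | zero => exact ⟨x, by simp⟩
  | succ N ih =>
    obtain ⟨y, rfl⟩ := exists_eq_b_mul (h 0 (Nat.succ_pos N))
    have hy : ∀ m < N, y.coeff m = 0 := by
      intro m hm
      have := h (m + 1) (by omega)
      rwa [b_mul, coeff_bMul_succ, ← b_mul, h m (by omega), map_zero, sub_zero] at this
    obtain ⟨z, rfl⟩ := ih hy
    exact ⟨z, by rw [pow_succ', mul_assoc]⟩

/-- Thus the right ideal `b Ã` is two-sided, so `b E` is stable under `Ã`; the Nakayama argument
relies on this. -/
theorem exists_mul_b_eq (x : ATilde) : ∃ y, x * b = b * y :=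
  exists_eq_b_mul (by simp [coeff_mul, b])

end ATilde

namespace LogSeries

/-! ### Leading terms -/

/-- Write `f = f(0) + b g`: the second part raises the level past that of `β`. -/
theorem coeff_smul_of_mem_filt (f : PowerSeries ℂ) {φ : LogSeries} {β : Expo}
    (h : φ ∈ LogSeries.filt (level β)) :
    (f • φ).coeff β = PowerSeries.constantCoeff f • φ.coeff β := by
  conv_lhs => rw [PowerSeries.eq_X_mul_shift_add_const f]
  rw [add_smul, coeff_add, mul_smul, X_smul, C_smul, coeff_smul,
    mem_filt_iff.1 (bOp_filt _ _ (smul_mem_filt _ h)) β (Nat.lt_succ_self _), zero_add]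

theorem coeff_smul_eMono_self (f : PowerSeries ℂ) (β : Expo) (j : ℕ) :
    ((f • eMono β j).coeff β).coeff j = PowerSeries.constantCoeff f * (j.factorial : ℂ)⁻¹ := by
  rw [coeff_smul_of_mem_filt, eMono, coeff_smul, logMono_eq, coeff_single_self]
  · simp
  · exact Submodule.smul_mem _ _ (single_mem_filt le_rfl _)

theorem X_pow_mem_degreeLT {i n : ℕ} (h : i < n) : (X ^ i : ℂ[X]) ∈ degreeLT ℂ n :=
  mem_degreeLT.2 (by rw [degree_X_pow]; exact_mod_cast h)

theorem smul_eMono_mem_lattice (f : PowerSeries ℂ) {D : Expo → ℕ} {β : Expo} {j : ℕ}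
    (h : j < D (base β)) : f • eMono β j ∈ lattice D :=
  (lattice D).smul_mem (ofB f) (smulC_mem_lattice _ (single_mem_lattice (X_pow_mem_degreeLT h)))

/-! ### The canonical writing -/

/-- The degree bound `n` on the classes in `R`, and zero elsewhere. -/
def bound (R : Finset Expo) (n : ℕ) (β : Expo) : ℕ := open Classical in if β ∈ R then n else 0

theorem bound_of_mem {R : Finset Expo} {n : ℕ} {β : Expo} (h : β ∈ R) : bound R n β = n := if_pos h

theorem bound_of_notMem {R : Finset Expo} {n : ℕ} {β : Expo} (h : β ∉ R) : bound R n β = 0 :=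
  if_neg h

theorem mem_of_bound_ne_zero {R : Finset Expo} {n : ℕ} {β : Expo} (h : bound R n β ≠ 0) : β ∈ R :=
  by_contra fun h0 => h (bound_of_notMem h0)

/-- The terms of level at least `m` in the class are combinations over `ℂ[[b]]` of `s^{ρ+m} (log
s)^i`, `i ≤ n`. Since `b` never raises the log-degree, only `i = n` contributes to `(log s)^n`; its
coefficient is a unit because the first such term is nonzero. -/
theorem exists_leading_unit {ρ : Expo} (hρ : base ρ = ρ) {n m : ℕ} {φ : LogSeries}
    (hφ : ∀ j, φ.coeff (shift ρ j) ∈ degreeLT ℂ (n + 1))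
    (hm : (φ.coeff (shift ρ m)).coeff n ≠ 0)
    (hlt : ∀ j < m, (φ.coeff (shift ρ j)).coeff n = 0) :
    ∃ U : PowerSeries ℂ, PowerSeries.constantCoeff U ≠ 0 ∧
      ∀ j, ((U • eMono (shift ρ m) n).coeff (shift ρ j)).coeff n =
        (φ.coeff (shift ρ j)).coeff n := by
  classical
  have hlev : level (shift ρ m) = m := by rw [← hρ, level_shift, level_base, zero_add]
  have hbase : ∀ j, base (shift ρ j) = ρ := fun j => by rw [base_shift, hρ]
  have hR : ∀ σ ∈ ({ρ} : Finset Expo), base σ = σ := by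
    intro σ hσ; rwa [Finset.mem_singleton.1 hσ]
  -- Dropping the lower levels of the class loses no power `(log s)^n`, by `hlt`.
  let w : LogSeries := LogSeries.mk fun β => if base β = ρ ∧ m ≤ level β then φ.coeff β else 0
  have hw : w ∈ lattice (bound {ρ} (n + 1)) := by
    intro β
    simp only [w, coeff_mk]
    split_ifs with h
    · rw [bound_of_mem (by simp [h.1]), eq_shift_of_base_eq h.1]; exact hφ _
    · exact zero_mem _
  have hwm : w ∈ LogSeries.filt m := by
    rw [mem_filt_iff]
    intro β hβ
    simp only [w, coeff_mk]
    rw [if_neg (by omega)]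
  have hwj : ∀ j, (w.coeff (shift ρ j)).coeff n = (φ.coeff (shift ρ j)).coeff n := by
    intro j
    have hj : level (shift ρ j) = j := by rw [← hρ, level_shift, level_base, zero_add]
    simp only [w, coeff_mk, hbase, hj, true_and]
    split_ifs with h
    · rfl
    · rw [hlt j (by omega), Polynomial.coeff_zero]
  obtain ⟨S, hS⟩ := exists_powerSeries_of_step (Finset.range (n + 1)) (fun i => eMono (shift ρ m) i)
    (P := fun w => w ∈ lattice (bound {ρ} (n + 1)) ∧ w ∈ LogSeries.filt m) (w := w)
    (fun w ⟨hw, hwm⟩ => by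
      obtain ⟨h1, h2⟩ := sub_sum_single_mem hR (fun β => mem_of_bound_ne_zero) hw hwm
      obtain ⟨ψ, h3, h4, h5⟩ := exists_bOp_eq h1 h2
      refine ⟨fun i => (i.factorial : ℂ) * (w.coeff (shift ρ m)).coeff i, ψ, ⟨h3, h4⟩, ?_⟩
      have h6 := hw (shift ρ m)
      rw [hbase, bound_of_mem (by simp)] at h6
      have h7 : single (shift ρ m) (w.coeff (shift ρ m)) = ∑ i ∈ Finset.range (n + 1),
          ((i.factorial : ℂ) * (w.coeff (shift ρ m)).coeff i) • eMono (shift ρ m) i := by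
        conv_lhs => rw [eq_sum_of_mem_degreeLT h6, map_sum]
        refine Finset.sum_congr rfl fun i _ => ?_
        have : (i.factorial : ℂ) ≠ 0 := by exact_mod_cast i.factorial_ne_zero
        rw [map_smul, eMono, logMono_eq, smul_smul]
        congr 1
        field_simp
      rw [h5, Finset.sum_singleton, h7]
      abel) ⟨hw, hwm⟩
  have hSn : ∀ j, ((S n • eMono (shift ρ m) n).coeff (shift ρ j)).coeff n =
      (φ.coeff (shift ρ j)).coeff n := by
    intro j
    have h1 : ∑ i ∈ Finset.range n, S i • eMono (shift ρ m) i ∈ lattice (bound {ρ} n) :=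
      sum_mem fun i hi => smul_eMono_mem_lattice _ (by
        rw [hbase, bound_of_mem (by simp)]; exact Finset.mem_range.1 hi)
    have h2 := h1 (shift ρ j)
    rw [hbase, bound_of_mem (by simp)] at h2
    rw [← hwj, hS, Finset.sum_range_succ, coeff_add, Polynomial.coeff_add,
      coeff_eq_zero_of_mem_degreeLT h2 le_rfl, zero_add]
  refine ⟨S n, fun h0 => hm ?_, hSn⟩
  rw [← hSn, coeff_smul_eMono_self, h0, zero_mul]

/-- Descending induction on the power of `log s`: one monomial per class, with a unit coefficient,
accounts for all terms in `(log s)^n`, and its subtraction lowers the log-degree. The last clause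
(one exponent per class and power) later gives the condition `shift` of a canonical writing. -/
theorem exists_unit_writing {R : Finset Expo} (hR : ∀ ρ ∈ R, base ρ = ρ) (n : ℕ) {φ : LogSeries}
    (hφ : φ ∈ lattice (bound R n)) :
    ∃ (B : Finset (Expo × ℕ)) (S : Expo → ℕ → PowerSeries ℂ),
      φ = ∑ p ∈ B, S p.1 p.2 • eMono p.1 p.2 ∧
      (∀ p ∈ B, PowerSeries.constantCoeff (S p.1 p.2) ≠ 0 ∧ p.2 < n) ∧
      ∀ p ∈ B, ∀ q ∈ B, p.2 = q.2 → base p.1 = base q.1 → p = q := by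
  classical
  induction n generalizing φ with
  | zero =>
    refine ⟨∅, 0, ?_, by simp, by simp⟩
    rw [Finset.sum_empty]
    ext1 β
    refine eq_zero_of_mem_degreeLT_zero (degreeLT_mono ?_ (hφ β))
    unfold bound
    split_ifs <;> exact le_rfl
  | succ n ih =>
    -- Only the classes in which `(log s)^n` really occurs receive a new monomial.
    let R1 := R.filter fun ρ => ∃ m, (φ.coeff (shift ρ m)).coeff n ≠ 0
    have hb : ∀ ρ ∈ R1, base ρ = ρ := fun ρ hρ => hR ρ (Finset.mem_filter.1 hρ).1
    have key : ∀ ρ ∈ R1, ∃ (m : ℕ) (U : PowerSeries ℂ), PowerSeries.constantCoeff U ≠ 0 ∧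
        ∀ j, ((U • eMono (shift ρ m) n).coeff (shift ρ j)).coeff n =
          (φ.coeff (shift ρ j)).coeff n := by
      intro ρ hρ
      obtain ⟨h1, h2⟩ := Finset.mem_filter.1 hρ
      refine ⟨Nat.find h2, exists_leading_unit (hR ρ h1) (fun j => ?_) (Nat.find_spec h2)
        fun j hj => not_not.1 (Nat.find_min h2 hj)⟩
      have := hφ (shift ρ j)
      rwa [base_shift, hR ρ h1, bound_of_mem h1] at this
    choose! m U hU0 hU using key
    have hbs : ∀ ρ ∈ R1, base (shift ρ (m ρ)) = ρ := fun ρ hρ => by rw [base_shift, hb ρ hρ]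
    have hmem : φ - ∑ ρ ∈ R1, U ρ • eMono (shift ρ (m ρ)) n ∈ lattice (bound R n) := by
      have h1 : ∀ σ ∈ R1, U σ • eMono (shift σ (m σ)) n ∈ lattice (bound {σ} (n + 1)) :=
        fun σ hσ => smul_eMono_mem_lattice _ (by
          rw [hbs σ hσ, bound_of_mem (Finset.mem_singleton_self σ)]; exact n.lt_succ_self)
      intro β
      by_cases hβ : base β ∈ R
      swap
      · have h2 : φ.coeff β = 0 := by
          have := hφ β
          rw [bound_of_notMem hβ] at this
          exact eq_zero_of_mem_degreeLT_zero this
        have h3 : ∀ σ ∈ R1, (U σ • eMono (shift σ (m σ)) n).coeff β = 0 := by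
          intro σ hσ
          have := h1 σ hσ β
          rw [bound_of_notMem] at this
          · exact eq_zero_of_mem_degreeLT_zero this
          · rw [Finset.mem_singleton]
            rintro rfl
            exact hβ (Finset.mem_filter.1 hσ).1
        rw [coeff_sub, coeff_sum, h2, Finset.sum_eq_zero h3, sub_zero]
        exact zero_mem _
      · rw [bound_of_mem hβ]
        refine mem_degreeLT_of_succ ?_ ?_
        · rw [coeff_sub, coeff_sum]
          have := hφ β
          rw [bound_of_mem hβ] at this
          refine sub_mem this (sum_mem fun σ hσ => degreeLT_mono ?_ (h1 σ hσ β))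
          unfold bound
          split_ifs <;> omega
        · rw [coeff_sub, coeff_sum, Polynomial.coeff_sub, finsetSum_coeff, sub_eq_zero]
          have h2 : ∀ σ ∈ R1, ((U σ • eMono (shift σ (m σ)) n).coeff β).coeff n =
              if base β = σ then (φ.coeff β).coeff n else 0 := by
            intro σ hσ
            split_ifs with h
            · rw [eq_shift_of_base_eq h]
              exact hU σ hσ _
            · have := h1 σ hσ β
              rw [bound_of_notMem (by rwa [Finset.mem_singleton])] at this
              rw [eq_zero_of_mem_degreeLT_zero this, Polynomial.coeff_zero]
          rw [Finset.sum_congr rfl h2, Finset.sum_ite_eq]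
          split_ifs with h
          · rfl
          · by_contra h0
            exact h (Finset.mem_filter.2 ⟨hβ, level β, by rwa [shift_base_level]⟩)
    obtain ⟨B, S, h1, h2, h3⟩ := ih hmem
    let g : Expo → Expo × ℕ := fun ρ => (shift ρ (m ρ), n)
    have hg : ∀ ρ ∈ R1, ∀ σ ∈ R1, g ρ = g σ → ρ = σ := by
      intro ρ hρ σ hσ h
      have h1 : shift ρ (m ρ) = shift σ (m σ) := (Prod.ext_iff.1 h).1
      rw [← hbs ρ hρ, ← hbs σ hσ, h1]
    have hdisj : Disjoint B (R1.image g) := by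
      rw [Finset.disjoint_left]
      intro p hp hp'
      obtain ⟨ρ, hρ, rfl⟩ := Finset.mem_image.1 hp'
      exact absurd (h2 _ hp).2 (lt_irrefl n)
    refine ⟨B ∪ R1.image g, fun α j => if j = n then U (base α) else S α j, ?_, ?_, ?_⟩
    · rw [Finset.sum_union hdisj, Finset.sum_image (fun ρ hρ σ hσ => hg ρ hρ σ hσ)]
      have e1 : ∑ p ∈ B, (if p.2 = n then U (base p.1) else S p.1 p.2) • eMono p.1 p.2 =
          ∑ p ∈ B, S p.1 p.2 • eMono p.1 p.2 :=
        Finset.sum_congr rfl fun p hp => by rw [if_neg (h2 p hp).2.ne]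
      have e2 : ∑ ρ ∈ R1, (if (g ρ).2 = n then U (base (g ρ).1) else S (g ρ).1 (g ρ).2) •
          eMono (g ρ).1 (g ρ).2 = ∑ ρ ∈ R1, U ρ • eMono (shift ρ (m ρ)) n :=
        Finset.sum_congr rfl fun ρ hρ => by rw [if_pos rfl, hbs ρ hρ]
      rw [e1, e2, ← h1]
      abel
    · intro p hp
      rcases Finset.mem_union.1 hp with hp | hp
      · simp only [if_neg (h2 p hp).2.ne]
        exact ⟨(h2 p hp).1, (h2 p hp).2.trans n.lt_succ_self⟩
      · obtain ⟨ρ, hρ, rfl⟩ := Finset.mem_image.1 hp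
        simp only [g, if_true, hbs ρ hρ]
        exact ⟨hU0 ρ hρ, n.lt_succ_self⟩
    · intro p hp q hq hpq hb
      rcases Finset.mem_union.1 hp with hp | hp <;> rcases Finset.mem_union.1 hq with hq | hq
      · exact h3 p hp q hq hpq hb
      · obtain ⟨ρ, hρ, rfl⟩ := Finset.mem_image.1 hq
        exact absurd hpq (h2 p hp).2.ne
      · obtain ⟨ρ, hρ, rfl⟩ := Finset.mem_image.1 hp
        exact absurd hpq.symm (h2 q hq).2.ne
      · obtain ⟨ρ, hρ, rfl⟩ := Finset.mem_image.1 hp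
        obtain ⟨σ, hσ, rfl⟩ := Finset.mem_image.1 hq
        rw [hbs ρ hρ, hbs σ hσ] at hb
        rw [hb]

theorem exists_mem_lattice_bound {n : ℕ} {φ : LogSeries} (hφ : φ ∈ Xi n) :
    ∃ R : Finset Expo, (∀ ρ ∈ R, base ρ = ρ) ∧ φ ∈ lattice (bound R (n + 1)) := by
  classical
  obtain ⟨A, hA⟩ := hφ
  refine ⟨A.image base, fun ρ hρ => ?_, fun β => ?_⟩
  · obtain ⟨α, -, rfl⟩ := Finset.mem_image.1 hρ
    exact base_base α
  · by_cases h0 : φ.coeff β = 0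
    · rw [h0]; exact zero_mem _
    · obtain ⟨α, hα, k, hk⟩ := (hA β).2 h0
      rw [bound_of_mem (Finset.mem_image.2 ⟨α, hα, (base_eq_of_eq_add hk).symm⟩), mem_degreeLT,
        Nat.cast_succ]
      exact (natDegree_le_iff_degree_le.1 (hA _).1).trans_lt (by exact_mod_cast n.lt_succ_self)

/-- `A` is the closure of `B` under lowering the power of `log s`, with zero coefficients on the
added indices; each added index lies below an index of `B`, whose coefficient is a unit. -/
theorem isCanonicalWriting_of_units {n : ℕ} {φ : LogSeries} {B : Finset (Expo × ℕ)}
    {S : Expo → ℕ → PowerSeries ℂ} (hS : φ = ∑ p ∈ B, S p.1 p.2 • eMono p.1 p.2)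
    (hB : ∀ p ∈ B, PowerSeries.constantCoeff (S p.1 p.2) ≠ 0 ∧ p.2 < n + 1)
    (hinj : ∀ p ∈ B, ∀ q ∈ B, p.2 = q.2 → base p.1 = base q.1 → p = q) {A : Finset (Expo × ℕ)}
    (hA : ∀ α i, (α, i) ∈ A ↔ ∃ k ≥ i, (α, k) ∈ B) :
    IsCanonicalWriting n φ A (fun α j => open Classical in if (α, j) ∈ B then S α j else 0) where
  eq_sum := by
    classical
    have hBA : B ⊆ A := fun p hp => (hA p.1 p.2).2 ⟨p.2, le_rfl, hp⟩
    rw [hS]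
    refine Finset.sum_subset_zero_on_sdiff hBA (fun p hp => ?_) (fun p hp => ?_)
    · rw [if_neg (Finset.mem_sdiff.1 hp).2, map_zero, zero_smul]
    · rw [if_pos hp, smul_eq]
  le α j h := by
    obtain ⟨k, hk, hkB⟩ := (hA α j).1 h
    have := (hB _ hkB).2
    simp only at this
    omega
  saturated α j h i hi := by
    obtain ⟨k, hk, hkB⟩ := (hA α j).1 h
    exact (hA α i).2 ⟨k, by omega, hkB⟩
  zero_or_unit α j h := by
    split_ifs with hj
    · exact Or.inr (hB _ hj).1
    · exact Or.inl rfl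
  exists_unit α j h := by
    obtain ⟨k, hk, hkB⟩ := (hA α j).1 h
    refine ⟨k, hk, (hA α k).2 ⟨k, le_rfl, hkB⟩, ?_⟩
    rw [if_pos hkB]
    exact (hB _ hkB).1
  shift α j h h0 α' p hp hα hA' := by
    by_contra h1
    have hj : (α, j) ∈ B := by_contra fun h2 => h0 (if_neg h2)
    have hj' : (α', j) ∈ B := by_contra fun h2 => h1 (if_neg h2)
    have h2 : α' = α := (Prod.ext_iff.1 (hinj _ hj' _ hj rfl (base_eq_of_eq_add hα))).1
    rw [h2] at hα
    have : (1 : ℚ) ≤ p := by exact_mod_cast hp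
    linarith


/-! ### The substitution `log s ↦ log s + t` -/

theorem derivative_taylor (t : ℂ) (q : ℂ[X]) : derivative (taylor t q) = taylor t (derivative q) := by
  simp [taylor_apply, derivative_comp]

/-- Translation commutes with `d/dz`, so both sides solve the same equation, whose solution is
unique. -/
theorem taylor_primPoly {β : ℂ} (hβ : β ≠ 0) (t : ℂ) (q : ℂ[X]) :
    taylor t (primPoly β q) = primPoly β (taylor t q) := by
  refine primPoly_unique hβ ?_
  rw [derivative_taylor, ← map_smul, ← map_add, primPoly_spec hβ]

/-- The substitution `log s ↦ log s + t`. -/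
def shiftLogOp (t : ℂ) : Module.End ℂ LogSeries where
  toFun φ := mk fun β => taylor t (φ.coeff β)
  map_add' φ ψ := by ext1 β; simp
  map_smul' c φ := by ext1 β; simp

/-- The `Ã`-linear map `log s ↦ log s + t`. -/
def shiftLog (t : ℂ) : LogSeries →ₗ[ATilde] LogSeries :=
  linearOfCommute (shiftLogOp t)
    (by
      refine LinearMap.ext fun φ => ext fun β => ?_
      change taylor t ((aOp φ).coeff β) = _
      rw [Module.End.mul_apply, coeff_aOp, coeff_aOp]
      split_ifs
      · rfl
      · exact map_zero _)
    (by
      refine LinearMap.ext fun φ => ext fun β => ?_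
      change taylor t ((bOp φ).coeff β) = _
      rw [Module.End.mul_apply, coeff_bOp, coeff_bOp]
      split_ifs with h
      · exact taylor_primPoly (by exact_mod_cast h.ne') _ _
      · exact map_zero _)
    (fun N φ hφ β hβ => by
      change taylor t (φ.coeff β) = 0
      rw [hφ β hβ, map_zero])

theorem coeff_shiftLog (t : ℂ) (φ : LogSeries) (β : Expo) :
    (shiftLog t φ).coeff β = taylor t (φ.coeff β) := rfl

theorem shiftLog_injective (t : ℂ) : Function.Injective (shiftLog t) := fun φ ψ h =>
  ext fun β => taylor_injective t (by rw [← coeff_shiftLog, h, coeff_shiftLog])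

theorem shiftLog_smul (t : ℂ) (f : PowerSeries ℂ) (φ : LogSeries) :
    shiftLog t (f • φ) = f • shiftLog t φ := map_smul (shiftLog t) (ofB f) φ

theorem shiftLog_mem_Xi (t : ℂ) {n : ℕ} {φ : LogSeries} (h : φ ∈ Xi n) : shiftLog t φ ∈ Xi n := by
  obtain ⟨A, hA⟩ := h
  refine ⟨A, fun β => ⟨?_, fun h0 => (hA β).2 fun h1 => h0 ?_⟩⟩
  · rw [coeff_shiftLog, natDegree_taylor]; exact (hA β).1
  · rw [coeff_shiftLog, h1, map_zero]

theorem shiftLog_eMono (t : ℂ) (α : Expo) (k : ℕ) :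
    shiftLog t (eMono α k) = ∑ i ∈ Finset.range (k + 1),
      ((k.factorial : ℂ)⁻¹ * (k.choose i * t ^ (k - i))) • logMono α i := by
  have h1 : shiftLog t (eMono α k) =
      single α ((k.factorial : ℂ)⁻¹ • ((X + C t) ^ k : ℂ[X])) := by
    ext1 β
    rw [coeff_shiftLog, eMono, logMono_eq, coeff_smul, coeff_single, coeff_single]
    split_ifs <;> simp
  rw [h1, add_pow, Finset.smul_sum, map_sum]
  refine Finset.sum_congr rfl fun i _ => ?_
  rw [logMono_eq, ← map_smul]
  congr 1
  rw [mul_smul]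
  congr 1
  rw [smul_eq_C_mul, C_mul, C_pow, map_natCast]
  ring

/-! ### Finite determinacy -/

/-- Nakayama over the local ring `ℂ[[b]]`: `χ` and `ψ` agree modulo `b E`, hence so do their
multiples by `Ã`. -/
theorem toB_span_le_of_sub {χ ψ e : LogSeries} (hfg : (toB (Submodule.span ATilde {χ})).FG)
    (he : e ∈ Submodule.span ATilde {χ}) (h : χ - ψ = (PowerSeries.X : PowerSeries ℂ) • e) :
    Submodule.span ATilde {ψ} = Submodule.span ATilde {χ} := by
  set E := Submodule.span ATilde {χ}
  have hχ : χ ∈ E := Submodule.mem_span_singleton_self χ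
  have hψ : ψ ∈ toB E := by
    have h1 := (toB E).smul_mem PowerSeries.X he
    rw [← h] at h1
    simpa using (toB E).sub_mem hχ h1
  refine le_antisymm ((Submodule.span_singleton_le_iff_mem _ _).2 hψ) ?_
  have key : toB E ≤ toB (Submodule.span ATilde {ψ}) := by
    refine Submodule.le_of_le_smul_of_le_jacobson_bot (I := Ideal.span {PowerSeries.X}) hfg ?_ ?_
    · rw [← PowerSeries.maximalIdeal_eq_span_X]
      exact IsLocalRing.maximalIdeal_le_jacobson _
    · intro w hw
      obtain ⟨x, rfl⟩ := Submodule.mem_span_singleton.1 hw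
      -- Moves `b` to the left of `x`, so that the error `x b e` becomes `b (y e)`.
      obtain ⟨y, hy⟩ := exists_mul_b_eq x
      have h1 : x • χ = x • ψ + (PowerSeries.X : PowerSeries ℂ) • y • e := by
        have h2 := congrArg (fun z => x • z) h
        simp only [smul_sub] at h2
        rw [X_smul_eq, smul_smul, hy, mul_smul, ← X_smul_eq] at h2
        rw [← h2]; abel
      rw [h1]
      refine Submodule.add_mem_sup (Submodule.smul_mem _ x (Submodule.mem_span_singleton_self ψ)) ?_
      exact Submodule.smul_mem_smul (Ideal.mem_span_singleton_self _) (E.smul_mem y he)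
  exact key

theorem eq_trunc_add (f : PowerSeries ℂ) (K : ℕ) :
    ∃ g, f - (PowerSeries.trunc K f : PowerSeries ℂ) = PowerSeries.X ^ K * g := by
  rw [← dvd_def, PowerSeries.X_pow_dvd_iff]
  intro m hm
  rw [map_sub, Polynomial.coeff_coe, PowerSeries.coeff_trunc, if_pos hm, sub_self]

theorem logMono_mem_Xi (α : Expo) {i n : ℕ} (h : i ≤ n) : logMono α i ∈ Xi n := by
  refine ⟨{α}, fun β => ?_⟩
  rw [logMono_eq, coeff_single]
  split_ifs with hβ
  · exact ⟨by rw [natDegree_X_pow]; exact h, fun _ => ⟨α, by simp, 0, by simp [hβ]⟩⟩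
  · simp

/-- By `hA` every monomial lies in the smallest lattice of `χ`, hence enters the module after
multiplication by `b^K`. Truncating at order `K + 1` leaves one more factor `b`, as Nakayama
requires. -/
theorem exists_generator_truncation {n : ℕ} {χ : LogSeries} (hχ : χ ∈ Xi n)
    {A : Finset (Expo × ℕ)} {T : Expo → ℕ → PowerSeries ℂ}
    (hT : χ = ∑ p ∈ A, T p.1 p.2 • logMono p.1 p.2)
    (hA : ∀ p ∈ A, ∃ β k, p.2 ≤ k ∧ base β = base p.1 ∧ (χ.coeff β).coeff k ≠ 0) :
    ∃ K : ℕ, Submodule.span ATilde {∑ p ∈ A, (PowerSeries.trunc (K + 1) (T p.1 p.2) : PowerSeries ℂ) •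
      logMono p.1 p.2} = Submodule.span ATilde {χ} := by
  obtain ⟨D, R, hR, hD, hχD, htop⟩ := exists_lattice hχ
  obtain ⟨K, hK⟩ := exists_X_pow_smul_lattice_mem hR hD hχD htop
  have hE : Submodule.span ATilde {χ} ≤ lattice D := by
    rw [Submodule.span_singleton_le_iff_mem]; exact hχD
  choose g hg using fun p : Expo × ℕ => eq_trunc_add (T p.1 p.2) (K + 1)
  refine ⟨K, toB_span_le_of_sub (fg_of_le_lattice hR hD hE)
    (e := ∑ p ∈ A, g p • (PowerSeries.X ^ K : PowerSeries ℂ) • logMono p.1 p.2) ?_ ?_⟩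
  · refine sum_mem fun p hp => (toB (Submodule.span ATilde {χ})).smul_mem (g p) (hK _ ?_)
    obtain ⟨β, k, hk, hβ, h0⟩ := hA p hp
    refine single_mem_lattice (X_pow_mem_degreeLT ?_)
    by_contra h1
    refine h0 (coeff_eq_zero_of_mem_degreeLT (hχD β) ?_)
    rw [hβ]
    omega
  · conv_lhs => rw [hT]
    rw [← Finset.sum_sub_distrib, Finset.smul_sum]
    refine Finset.sum_congr rfl fun p _ => ?_
    rw [← sub_smul, hg, smul_smul, smul_smul]
    congr 1
    ring

/-! ### Generic translates -/

/-- The product is a nonzero polynomial over the infinite field `ℂ`. -/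
theorem exists_forall_eval_ne_zero {ι : Type*} (s : Finset ι) (P : ι → ℂ[X]) (h : ∀ i ∈ s, P i ≠ 0) :
    ∃ t, ∀ i ∈ s, (P i).eval t ≠ 0 := by
  have h1 : ∏ i ∈ s, P i ≠ 0 := Finset.prod_ne_zero_iff.2 h
  by_contra! h2
  refine h1 (Polynomial.funext fun t => ?_)
  obtain ⟨i, hi, h3⟩ := h2 t
  rw [eval_prod, eval_zero]
  exact Finset.prod_eq_zero hi h3

variable {n : ℕ} {φ : LogSeries} {B A : Finset (Expo × ℕ)} {S : Expo → ℕ → PowerSeries ℂ}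

open Classical in
/-- The coefficient of `s^α (log s)^i` in the series obtained from `∑_B S_{α,k}(b) s^α (log s)^k / k!`
by the substitution `log s ↦ log s + t`. -/
def shiftCoeff (B : Finset (Expo × ℕ)) (S : Expo → ℕ → PowerSeries ℂ) (t : ℂ) (α : Expo) (i : ℕ) :
    PowerSeries ℂ :=
  ∑ x ∈ B with x.1 = α ∧ i ≤ x.2, PowerSeries.C ((x.2.factorial : ℂ)⁻¹ *
    (x.2.choose i * t ^ (x.2 - i))) * S x.1 x.2

theorem shiftLog_eq_sum (hS : φ = ∑ p ∈ B, S p.1 p.2 • eMono p.1 p.2)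
    (hA : ∀ α i, (α, i) ∈ A ↔ ∃ k ≥ i, (α, k) ∈ B) (t : ℂ) :
    shiftLog t φ = ∑ p ∈ A, shiftCoeff B S t p.1 p.2 • logMono p.1 p.2 := by
  classical
  simp only [shiftCoeff, Finset.sum_smul]
  rw [Finset.sum_comm' (t' := B) (s' := fun x => A.filter fun y => x.1 = y.1 ∧ y.2 ≤ x.2)
    (by
      intro x y
      simp only [Finset.mem_filter]
      tauto), hS, map_sum]
  refine Finset.sum_congr rfl fun x hx => ?_
  have h1 : A.filter (fun y => x.1 = y.1 ∧ y.2 ≤ x.2) =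
      (Finset.range (x.2 + 1)).image fun i => (x.1, i) := by
    ext ⟨α, i⟩
    simp only [Finset.mem_filter, hA, Finset.mem_image, Finset.mem_range, Prod.mk.injEq]
    constructor
    · rintro ⟨-, h, hi⟩
      exact ⟨i, by omega, h, rfl⟩
    · rintro ⟨i, hi, rfl, rfl⟩
      exact ⟨⟨x.2, by omega, hx⟩, rfl, by omega⟩
  rw [h1, Finset.sum_image (by intro i _ j _ h; exact (Prod.ext_iff.1 h).2), shiftLog_smul,
    shiftLog_eMono, Finset.smul_sum]
  refine Finset.sum_congr rfl fun i _ => ?_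
  rw [← C_smul, smul_smul, mul_comm]

/-- Each constant term is a polynomial in `t` in which different `k` give different powers
`t^(k-i)`, with nonzero coefficients; no cancellation can occur, so a generic `t` works. -/
theorem exists_shiftCoeff_ne_zero (hB : ∀ p ∈ B, PowerSeries.constantCoeff (S p.1 p.2) ≠ 0)
    (hA : ∀ α i, (α, i) ∈ A ↔ ∃ k ≥ i, (α, k) ∈ B) :
    ∃ t : ℂ, ∀ p ∈ A, PowerSeries.constantCoeff (shiftCoeff B S t p.1 p.2) ≠ 0 := by
  classical
  let P : Expo × ℕ → ℂ[X] := fun p => ∑ x ∈ B with x.1 = p.1 ∧ p.2 ≤ x.2,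
    C ((x.2.factorial : ℂ)⁻¹ * x.2.choose p.2 * PowerSeries.constantCoeff (S x.1 x.2)) *
      X ^ (x.2 - p.2)
  have hP : ∀ p ∈ A, P p ≠ 0 := by
    rintro ⟨α, i⟩ hp h0
    obtain ⟨k, hk, hkB⟩ := (hA α i).1 hp
    have h1 := congrArg (fun q => q.coeff (k - i)) h0
    simp only [P, finsetSum_coeff, coeff_C_mul, coeff_X_pow, Polynomial.coeff_zero] at h1
    rw [Finset.sum_eq_single (α, k)] at h1
    · refine absurd h1 ?_
      simp only [if_true, mul_one]
      refine mul_ne_zero (mul_ne_zero (inv_ne_zero ?_) ?_) (hB _ hkB)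
      · exact_mod_cast k.factorial_ne_zero
      · exact_mod_cast (Nat.choose_pos hk).ne'
    · rintro ⟨α', k'⟩ h2 h3
      obtain ⟨-, h4, h5⟩ := Finset.mem_filter.1 h2
      simp only at h4 h5
      subst h4
      rw [if_neg, mul_zero]
      intro h6
      exact h3 (by rw [show k' = k by omega])
    · intro h2
      exact absurd (Finset.mem_filter.2 ⟨hkB, rfl, hk⟩) h2
  obtain ⟨t, ht⟩ := exists_forall_eval_ne_zero A P hP
  refine ⟨t, fun p hp => ?_⟩
  convert ht p hp using 1
  simp only [shiftCoeff, P, map_sum, eval_finsetSum, eval_mul, eval_C, eval_pow, eval_X, map_mul,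
    PowerSeries.constantCoeff_C]
  refine Finset.sum_congr ?_ fun x _ => by ring
  congr

/-- In the class of `p` take the term of `B` with the highest power of `log s`. By `hinj` it is
alone with that power, so its leading coefficient survives in `φ`. -/
theorem exists_coeff_ne_zero (hS : φ = ∑ p ∈ B, S p.1 p.2 • eMono p.1 p.2)
    (hB : ∀ p ∈ B, PowerSeries.constantCoeff (S p.1 p.2) ≠ 0)
    (hinj : ∀ p ∈ B, ∀ q ∈ B, p.2 = q.2 → base p.1 = base q.1 → p = q) {p : Expo × ℕ}
    (hp : p ∈ B) : ∃ β k, p.2 ≤ k ∧ base β = base p.1 ∧ (φ.coeff β).coeff k ≠ 0 := by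
  classical
  obtain ⟨q, hq, hmax⟩ := (B.filter fun q => base q.1 = base p.1).exists_max_image (fun q => q.2)
    ⟨p, Finset.mem_filter.2 ⟨hp, rfl⟩⟩
  obtain ⟨hqB, hqb⟩ := Finset.mem_filter.1 hq
  refine ⟨q.1, q.2, hmax p (Finset.mem_filter.2 ⟨hp, rfl⟩), hqb, ?_⟩
  rw [hS, coeff_sum, finsetSum_coeff, Finset.sum_eq_single q]
  · rw [coeff_smul_eMono_self]
    exact mul_ne_zero (hB q hqB) (inv_ne_zero (by exact_mod_cast q.2.factorial_ne_zero))
  · intro x hx hxq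
    have h1 : S x.1 x.2 • eMono x.1 x.2 ∈ lattice (bound {base x.1} (x.2 + 1)) :=
      smul_eMono_mem_lattice _ (by rw [bound_of_mem (by simp)]; exact Nat.lt_succ_self _)
    refine coeff_eq_zero_of_mem_degreeLT (h1 q.1) ?_
    by_cases hb : base q.1 = base x.1
    · rw [bound_of_mem (by simp [hb])]
      have h2 := hmax x (Finset.mem_filter.2 ⟨hx, by rw [← hb, hqb]⟩)
      have h3 : x.2 ≠ q.2 := fun h3 => hxq (hinj x hx q hqB h3 hb.symm)
      omega
    · rw [bound_of_notMem (by simpa using hb)]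
      exact Nat.zero_le _
  · exact fun h => absurd hqB h

theorem exists_canonicalWriting_polynomial_generator (hφ : φ ∈ Xi n) :
    ∃ (A : Finset (Expo × ℕ)) (S : Expo → ℕ → PowerSeries ℂ), IsCanonicalWriting n φ A S ∧
      ∃ T : Expo → ℕ → ℂ[X], (∀ α j, (α, j) ∈ A → (T α j).eval 0 ≠ 0) ∧
        ∃ ψ ∈ Xi n, ψ = ∑ p ∈ A, ofB (T p.1 p.2 : PowerSeries ℂ) • logMono p.1 p.2 ∧
          Nonempty (Submodule.span ATilde {ψ} ≃ₗ[ATilde] Submodule.span ATilde {φ}) := by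
  classical
  obtain ⟨R, hR, hφR⟩ := exists_mem_lattice_bound hφ
  obtain ⟨B, S, hS, hB, hinj⟩ := exists_unit_writing hR (n + 1) hφR
  let A : Finset (Expo × ℕ) := B.biUnion fun p => (Finset.range (p.2 + 1)).image fun i => (p.1, i)
  have hA : ∀ α i, (α, i) ∈ A ↔ ∃ k ≥ i, (α, k) ∈ B := by
    intro α i
    simp only [A, Finset.mem_biUnion, Finset.mem_image, Finset.mem_range, Prod.mk.injEq]
    constructor
    · rintro ⟨⟨α', k⟩, h1, i, h2, rfl, rfl⟩
      exact ⟨k, by simp only at h2; omega, h1⟩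
    · rintro ⟨k, hk, h1⟩
      exact ⟨(α, k), h1, i, by simp only; omega, rfl, rfl⟩
  have hB' := fun p hp => (hB p hp).1
  obtain ⟨t, ht⟩ := exists_shiftCoeff_ne_zero hB' hA
  have htop : ∀ p ∈ A, ∃ β k, p.2 ≤ k ∧ base β = base p.1 ∧ ((shiftLog t φ).coeff β).coeff k ≠ 0 := by
    rintro ⟨α, i⟩ hp
    obtain ⟨k, hk, hkB⟩ := (hA α i).1 hp
    obtain ⟨β, j, hj, hβ, h0⟩ := exists_coeff_ne_zero hS hB' hinj hkB
    -- Translation preserves only the leading coefficient, so the power `j` is replaced by the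
    -- degree.
    refine ⟨β, (φ.coeff β).natDegree, ?_, hβ, ?_⟩
    · exact hk.le.trans (hj.trans (le_natDegree_of_ne_zero h0))
    · rw [coeff_shiftLog, coeff_taylor_natDegree, Ne, leadingCoeff_eq_zero]
      intro h1
      rw [h1, Polynomial.coeff_zero] at h0
      exact h0 rfl
  obtain ⟨K, hK⟩ := exists_generator_truncation (shiftLog_mem_Xi t hφ) (shiftLog_eq_sum hS hA t) htop
  have e1 : Submodule.span ATilde {shiftLog t φ} = (Submodule.span ATilde {φ}).map (shiftLog t) := by
    rw [Submodule.map_span, Set.image_singleton]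
  have hψ : Nonempty (Submodule.span ATilde {∑ p ∈ A, ofB (PowerSeries.trunc (K + 1)
      (shiftCoeff B S t p.1 p.2) : PowerSeries ℂ) • logMono p.1 p.2} ≃ₗ[ATilde]
        Submodule.span ATilde {φ}) := by
    have hK' : Submodule.span ATilde {∑ p ∈ A, ofB (PowerSeries.trunc (K + 1)
      (shiftCoeff B S t p.1 p.2) : PowerSeries ℂ) • logMono p.1 p.2} =
        (Submodule.span ATilde {φ}).map (shiftLog t) := hK.trans e1
    rw [hK']
    exact ⟨(Submodule.equivMapOfInjective _ (shiftLog_injective t) _).symm⟩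
  refine ⟨A, _, isCanonicalWriting_of_units hS hB hinj hA,
    fun α i => PowerSeries.trunc (K + 1) (shiftCoeff B S t α i), fun α j hj => ?_,
    ∑ p ∈ A, ofB (PowerSeries.trunc (K + 1) (shiftCoeff B S t p.1 p.2) : PowerSeries ℂ) •
      logMono p.1 p.2, ?_, rfl, hψ⟩
  · rw [← coeff_zero_eq_eval_zero, PowerSeries.coeff_trunc, if_pos (Nat.succ_pos K),
      PowerSeries.coeff_zero_eq_constantCoeff_apply]
    exact ht (α, j) hj
  · refine sum_mem fun p hp => Submodule.smul_mem _ _ (logMono_mem_Xi _ ?_)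
    obtain ⟨k, hk, hkB⟩ := (hA p.1 p.2).1 hp
    have := (hB _ hkB).2
    simp only at this
    omega

end LogSeries

/-! ### Linear differential systems with constant coefficients on polynomials -/

theorem exists_derivative_eq (g : ℂ[X]) : ∃ w : ℂ[X], derivative w = g := by
  induction g using Polynomial.induction_on' with
  | add p q hp hq =>
    obtain ⟨u, rfl⟩ := hp
    obtain ⟨v, rfl⟩ := hq
    exact ⟨u + v, map_add _ _ _⟩
  | monomial n c =>
    refine ⟨monomial (n + 1) (c / (n + 1)), ?_⟩
    have : (n : ℂ) + 1 ≠ 0 := by exact_mod_cast n.succ_ne_zero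
    rw [derivative_monomial, Nat.add_sub_cancel]
    congr 1
    push_cast
    field_simp

/-- The derivation of polynomials as an endomorphism. -/
def polyDeriv : Module.End ℂ ℂ[X] := derivative

theorem polyDeriv_apply (q : ℂ[X]) : polyDeriv q = derivative q := rfl

/-- Factor `P` into terms `z - c`. For `c ≠ 0`, `d/dz - c` is invertible without change of degree;
for `c = 0` one integrates, and only then can the degree grow. -/
theorem exists_aeval_polyDeriv_eq {P : ℂ[X]} (hP : P ≠ 0) (g : ℂ[X]) :
    ∃ w, aeval polyDeriv P w = g ∧
      (P.eval 0 ≠ 0 → ∀ k, g ∈ degreeLT ℂ k → w ∈ degreeLT ℂ k) := by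
  induction hd : P.natDegree generalizing P g with
  | zero =>
    rw [eq_C_of_natDegree_eq_zero hd] at hP ⊢
    have h0 : P.coeff 0 ≠ 0 := fun h => hP (by rw [h, C_0])
    refine ⟨(P.coeff 0)⁻¹ • g, ?_, fun _ k hk => Submodule.smul_mem _ _ hk⟩
    rw [aeval_C, Module.algebraMap_end_apply, smul_smul, mul_inv_cancel₀ h0, one_smul]
  | succ d ih =>
    obtain ⟨c, hc⟩ := IsAlgClosed.exists_root P (by
      intro h
      simp [natDegree, h] at hd)
    obtain ⟨Q, rfl⟩ := dvd_iff_isRoot.2 hc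
    have hQ : Q ≠ 0 := right_ne_zero_of_mul hP
    have hQd : Q.natDegree = d := by
      rw [natDegree_mul (X_sub_C_ne_zero c) hQ, natDegree_X_sub_C] at hd
      omega
    have h1 : ∃ u : ℂ[X], derivative u - c • u = g ∧
        (c ≠ 0 → ∀ k, g ∈ degreeLT ℂ k → u ∈ degreeLT ℂ k) := by
      by_cases h : c = 0
      · obtain ⟨u, hu⟩ := exists_derivative_eq g
        exact ⟨u, by rw [h, zero_smul, sub_zero, hu], fun h' => absurd h h'⟩
      · refine ⟨primPoly (-c) g, ?_, fun _ k hk => primPoly_mem_degreeLT _ hk⟩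
        conv_rhs => rw [← primPoly_spec (neg_ne_zero.2 h) g]
        rw [neg_smul]
        abel
    obtain ⟨u, hu, hu'⟩ := h1
    obtain ⟨w, hw, hw'⟩ := ih hQ u hQd
    refine ⟨w, ?_, fun h k hk => ?_⟩
    · rw [map_mul, Module.End.mul_apply, hw, map_sub, aeval_X, aeval_C, LinearMap.sub_apply,
        Module.algebraMap_end_apply, polyDeriv_apply, hu]
    · rw [eval_mul, eval_sub, eval_X, eval_C, zero_sub] at h
      exact hw' (right_ne_zero_of_mul h) k
        (hu' (neg_ne_zero.1 (left_ne_zero_of_mul h)) k hk)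

theorem aeval_polyDeriv_mem (P : ℂ[X]) {k : ℕ} {q : ℂ[X]} (h : q ∈ degreeLT ℂ k) :
    aeval polyDeriv P q ∈ degreeLT ℂ k :=
  aeval_mem (F := fun _ => degreeLT ℂ k) (fun _ _ hq => derivative_mem_degreeLT hq) P 0 q h

variable {ι : Type*} [Fintype ι]

/-- The system reads `N(d/dz) q = g`, where `N = z - (M - c)`; the adjugate of `N` reduces it to the
scalar operator `(det N)(d/dz)`. Since `det N` at `0` is `det (c - M)`, degrees are kept when `c` is
not an eigenvalue of `M`. -/
theorem exists_linear_system_eq [DecidableEq ι] (M : Matrix ι ι ℂ) (c : ℂ) (g : ι → ℂ[X]) :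
    ∃ q : ι → ℂ[X], (∀ i, c • q i + derivative (q i) - ∑ j, M i j • q j = g i) ∧
      ((c • (1 : Matrix ι ι ℂ) - M).det ≠ 0 → ∀ k, (∀ i, g i ∈ degreeLT ℂ k) →
        ∀ i, q i ∈ degreeLT ℂ k) := by
  set N := (M - c • (1 : Matrix ι ι ℂ)).charmatrix with hN
  have hdet : N.det = (M - c • (1 : Matrix ι ι ℂ)).charpoly := rfl
  have h0 : N.det ≠ 0 := by rw [hdet]; exact (Matrix.charpoly_monic _).ne_zero
  have hev : N.det.eval 0 = (c • (1 : Matrix ι ι ℂ) - M).det := by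
    rw [hdet, Matrix.eval_charpoly, map_zero, zero_sub, neg_sub]
  choose w hw hw' using fun i => exists_aeval_polyDeriv_eq h0 (g i)
  refine ⟨fun i => ∑ k, aeval polyDeriv (N.adjugate i k) (w k), fun i => ?_, fun h k hk i => ?_⟩
  · have hNij : ∀ j (p : ℂ[X]), aeval polyDeriv (N i j) p =
        (if i = j then c • p + derivative p else 0) - M i j • p := by
      intro j p
      rw [hN, Matrix.charmatrix_apply, Matrix.diagonal_apply, Matrix.sub_apply, Matrix.smul_apply,
        Matrix.one_apply]
      split_ifs with h
      · simp only [map_sub, aeval_X, aeval_C, LinearMap.sub_apply, Module.algebraMap_end_apply,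
          polyDeriv_apply, smul_eq_mul, mul_one]
        abel
      · simp
    have h1 : ∑ j, aeval polyDeriv (N i j) (∑ k, aeval polyDeriv (N.adjugate j k) (w k)) = g i := by
      simp only [map_sum, ← Module.End.mul_apply, ← map_mul]
      rw [Finset.sum_comm]
      have h2 : ∀ k, ∑ j, aeval polyDeriv (N i j * N.adjugate j k) (w k) =
          if i = k then g i else 0 := by
        intro k
        rw [← LinearMap.sum_apply, ← map_sum, ← Matrix.mul_apply, Matrix.mul_adjugate,
          Matrix.smul_apply, Matrix.one_apply]
        split_ifs with h
        · rw [smul_eq_mul, mul_one, ← h, hw]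
        · simp
      simp only [h2, Finset.sum_ite_eq, Finset.mem_univ, if_true]
    rw [← h1]
    simp only [hNij, Finset.sum_sub_distrib, Finset.sum_ite_eq, Finset.mem_univ, if_true]
  · exact sum_mem fun j _ => aeval_polyDeriv_mem _ (hw' j (by rwa [hev]) k (hk j))

namespace LogSeries

/-! ### Regular singular systems -/

/-- The operator `y ↦ b⁻¹ a y - A(b) y` on vectors of series. -/
def residual (A : ι → ι → PowerSeries ℂ) (y : ι → LogSeries) (i : ι) : LogSeries :=
  thetaOp (y i) - ∑ j, A i j • y j

variable {A : ι → ι → PowerSeries ℂ}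

theorem residual_add (y z : ι → LogSeries) (i : ι) :
    residual A (y + z) i = residual A y i + residual A z i := by
  simp only [residual, Pi.add_apply, map_add, smul_add, Finset.sum_add_distrib]
  abel

theorem residual_sub (y z : ι → LogSeries) (i : ι) :
    residual A (y - z) i = residual A y i - residual A z i := by
  simp only [residual, Pi.sub_apply, map_sub, smul_sub, Finset.sum_sub_distrib]
  abel

theorem residual_mem_lattice {D : Expo → ℕ} {y : ι → LogSeries} (h : ∀ i, y i ∈ lattice D) (i : ι) :
    residual A y i ∈ lattice D :=
  sub_mem (thetaOp_mem_lattice (h i)) (sum_mem fun j _ => (toB (lattice D)).smul_mem _ (h j))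

theorem residual_mem_filt {N : ℕ} {y : ι → LogSeries} (h : ∀ i, y i ∈ LogSeries.filt N) (i : ι) :
    residual A y i ∈ LogSeries.filt N :=
  sub_mem (thetaOp_mem_filt (h i)) (sum_mem fun j _ => smul_mem_filt _ (h j))

theorem coeff_residual {β : Expo} {y : ι → LogSeries} (h : ∀ i, y i ∈ LogSeries.filt (level β))
    (i : ι) : (residual A y i).coeff β = ((β.1 : ℂ) + 1) • (y i).coeff β +
      derivative ((y i).coeff β) -
        ∑ j, PowerSeries.constantCoeff (A i j) • (y j).coeff β := by
  rw [residual, coeff_sub, coeff_thetaOp, coeff_sum]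
  congr 1
  exact Finset.sum_congr rfl fun j _ => coeff_smul_of_mem_filt _ (h j)

theorem mem_filt_succ {ρ : Expo} {n N : ℕ} {w : LogSeries} (hw : w ∈ lattice (bound {ρ} n))
    (hN : w ∈ LogSeries.filt N) (h0 : w.coeff (shift ρ N) = 0) : w ∈ LogSeries.filt (N + 1) := by
  rw [mem_filt_iff] at hN ⊢
  intro β hβ
  rcases Nat.lt_succ_iff_lt_or_eq.1 hβ with h | h
  · exact hN β h
  · by_cases hb : base β = ρ
    · rw [eq_shift_of_base_eq hb, h, h0]
    · have := hw β
      rw [bound_of_notMem (by simpa using hb)] at this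
      exact eq_zero_of_mem_degreeLT_zero this

/-- The constant term of a matrix with coefficients in `ℂ[[b]]`. -/
def constMatrix (A : ι → ι → PowerSeries ℂ) : Matrix ι ι ℂ :=
  Matrix.of fun i j => PowerSeries.constantCoeff (A i j)

theorem lattice_bound_mono (R : Finset Expo) {n n' : ℕ} (h : n ≤ n') :
    lattice (bound R n) ≤ lattice (bound R n') := by
  refine lattice_mono fun β => ?_
  unfold bound
  split_ifs
  · exact h
  · exact le_rfl

theorem single_mem_lattice_bound {ρ β : Expo} (h : base β = ρ) {n : ℕ} {q : ℂ[X]}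
    (hq : q ∈ degreeLT ℂ n) : single β q ∈ lattice (bound {ρ} n) :=
  single_mem_lattice (by rwa [h, bound_of_mem (Finset.mem_singleton_self ρ)])

theorem coeff_mem_of_mem_lattice_bound {ρ β : Expo} (h : base β = ρ) {n : ℕ} {w : LogSeries}
    (hw : w ∈ lattice (bound {ρ} n)) : w.coeff β ∈ degreeLT ℂ n := by
  have := hw β
  rwa [h, bound_of_mem (Finset.mem_singleton_self ρ)] at this

theorem exists_degreeLT (q : ι → ℂ[X]) : ∃ n, ∀ i, q i ∈ degreeLT ℂ n := by
  classical
  refine ⟨Finset.univ.sup fun i => (q i).natDegree + 1, fun i => ?_⟩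
  rw [mem_degreeLT]
  refine degree_le_natDegree.trans_lt ?_
  have : (q i).natDegree + 1 ≤ Finset.univ.sup fun i => (q i).natDegree + 1 :=
    Finset.le_sup (f := fun i => (q i).natDegree + 1) (Finset.mem_univ i)
  exact_mod_cast this

/-- At `s^{ρ+N}` only the constant matrix acts, so the leading term of `z` is cancelled by solving
`(c + d/dz - A(0)) q = g` with `c = ρ + N + 1`. -/
theorem exists_residual_step [DecidableEq ι] {ρ : Expo} (hρ : base ρ = ρ) {n N : ℕ} {z : ι → LogSeries}
    (hz : ∀ i, z i ∈ lattice (bound {ρ} n)) (hN : ∀ i, z i ∈ LogSeries.filt N) :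
    ∃ (q : ι → ℂ[X]) (n' : ℕ), (∀ i, q i ∈ degreeLT ℂ n') ∧
      (((((shift ρ N).1 : ℂ) + 1) • (1 : Matrix ι ι ℂ) - constMatrix A).det ≠ 0 → n' = n) ∧
      (∀ i, z i - residual A (fun j => single (shift ρ N) (q j)) i ∈ lattice (bound {ρ} n')) ∧
      ∀ i, z i - residual A (fun j => single (shift ρ N) (q j)) i ∈ LogSeries.filt (N + 1) := by
  have hlev : level (shift ρ N) = N := by rw [← hρ, level_shift, level_base, zero_add]
  have hbase : base (shift ρ N) = ρ := by rw [base_shift, hρ]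
  obtain ⟨q, hq, hq'⟩ := exists_linear_system_eq (constMatrix A) (((shift ρ N).1 : ℂ) + 1)
    (fun i => (z i).coeff (shift ρ N))
  obtain ⟨n', hn, hn1, hn2⟩ : ∃ n', n ≤ n' ∧ (∀ i, q i ∈ degreeLT ℂ n') ∧
      (((((shift ρ N).1 : ℂ) + 1) • (1 : Matrix ι ι ℂ) - constMatrix A).det ≠ 0 → n' = n) := by
    by_cases h : ((((shift ρ N).1 : ℂ) + 1) • (1 : Matrix ι ι ℂ) - constMatrix A).det ≠ 0
    · exact ⟨n, le_rfl, hq' h n fun i => coeff_mem_of_mem_lattice_bound hbase (hz i), fun _ => rfl⟩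
    · obtain ⟨m, hm⟩ := exists_degreeLT q
      exact ⟨max n m, le_max_left _ _, fun i => degreeLT_mono (le_max_right _ _) (hm i),
        fun h' => absurd h' h⟩
  have hsl : ∀ i, single (shift ρ N) (q i) ∈ lattice (bound {ρ} n') := fun i =>
    single_mem_lattice_bound hbase (hn1 i)
  have hsf : ∀ i, single (shift ρ N) (q i) ∈ LogSeries.filt N := fun i =>
    single_mem_filt hlev.ge _
  have h1 : ∀ i, z i - residual A (fun j => single (shift ρ N) (q j)) i ∈ lattice (bound {ρ} n') :=
    fun i => sub_mem (lattice_bound_mono _ hn (hz i)) (residual_mem_lattice hsl i)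
  refine ⟨q, n', hn1, hn2, h1, fun i => mem_filt_succ (h1 i)
    (sub_mem (hN i) (residual_mem_filt hsf i)) ?_⟩
  rw [coeff_sub, coeff_residual (fun j => by rw [hlev]; exact hsf j), ← hq i]
  simp [constMatrix]

/-- Without resonance every step keeps the same log-degree bound, and the infinitely many
corrections live at distinct exponents, so their sum is a series of the lattice. -/
theorem exists_residual_eq_of_regular [DecidableEq ι] {ρ : Expo} (hρ : base ρ = ρ) {n N : ℕ}
    (hreg : ∀ k, ((((shift ρ (N + k)).1 : ℂ) + 1) • (1 : Matrix ι ι ℂ) - constMatrix A).det ≠ 0)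
    {z : ι → LogSeries} (hz : ∀ i, z i ∈ lattice (bound {ρ} n))
    (hN : ∀ i, z i ∈ LogSeries.filt N) :
    ∃ y : ι → LogSeries, (∀ i, y i ∈ lattice (bound {ρ} n)) ∧ (∀ i, y i ∈ LogSeries.filt N) ∧
      residual A y = z := by
  have hlev : ∀ N, level (shift ρ N) = N := fun N => by rw [← hρ, level_shift, level_base, zero_add]
  have hbase : ∀ N, base (shift ρ N) = ρ := fun N => by rw [base_shift, hρ]
  have step : ∀ (k : ℕ) (z : ι → LogSeries), ∃ q : ι → ℂ[X],
      (∀ i, z i ∈ lattice (bound {ρ} n)) → (∀ i, z i ∈ LogSeries.filt (N + k)) →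
      (∀ i, q i ∈ degreeLT ℂ n) ∧
      (∀ i, z i - residual A (fun j => single (shift ρ (N + k)) (q j)) i ∈ lattice (bound {ρ} n)) ∧
      ∀ i, z i - residual A (fun j => single (shift ρ (N + k)) (q j)) i ∈
        LogSeries.filt (N + k + 1) := by
    intro k z
    by_cases h : (∀ i, z i ∈ lattice (bound {ρ} n)) ∧ (∀ i, z i ∈ LogSeries.filt (N + k))
    · obtain ⟨q, n', h1, h2, h3, h4⟩ := exists_residual_step (A := A) hρ h.1 h.2
      obtain rfl := h2 (hreg k)
      exact ⟨q, fun _ _ => ⟨h1, h3, h4⟩⟩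
    -- A dummy value, so that the correction can be chosen as a total function of `k` and `z`.
    · exact ⟨0, fun h1 h2 => absurd ⟨h1, h2⟩ h⟩
  choose q hq using step
  let u : ℕ → ι → LogSeries := fun k => Nat.rec z
    (fun k w i => w i - residual A (fun j => single (shift ρ (N + k)) (q k w j)) i) k
  have hu : ∀ k, (∀ i, u k i ∈ lattice (bound {ρ} n)) ∧ ∀ i, u k i ∈ LogSeries.filt (N + k) := by
    intro k
    induction k with
    | zero => exact ⟨hz, hN⟩
    | succ k ih => exact (hq k (u k) ih.1 ih.2).2
  -- The infinite sum of the corrections: level `N + k` is filled by the `k`-th one.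
  let y : ι → LogSeries := fun i => mk fun β =>
    if base β = ρ ∧ N ≤ level β then q (level β - N) (u (level β - N)) i else 0
  have hyl : ∀ i, y i ∈ lattice (bound {ρ} n) := by
    intro i β
    simp only [y, coeff_mk]
    split_ifs with h
    · rw [bound_of_mem (by simp [h.1])]
      exact (hq _ _ (hu _).1 (hu _).2).1 i
    · exact zero_mem _
  have hyf : ∀ i, y i ∈ LogSeries.filt N := by
    intro i
    rw [mem_filt_iff]
    intro β hβ
    simp only [y, coeff_mk]
    rw [if_neg (by omega)]
  let p : ℕ → ι → LogSeries := fun K i =>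
    ∑ k ∈ Finset.range K, single (shift ρ (N + k)) (q k (u k) i)
  have hp : ∀ K, residual A (p K) + u K = z := by
    intro K
    induction K with
    | zero =>
      funext i
      simp [p, residual, u]
    | succ K ih =>
      rw [← ih]
      funext i
      have h1 : p (K + 1) = p K + fun j => single (shift ρ (N + K)) (q K (u K) j) := by
        funext j
        exact Finset.sum_range_succ _ _
      have h2 : u (K + 1) i =
        u K i - residual A (fun j => single (shift ρ (N + K)) (q K (u K) j)) i := rfl
      rw [Pi.add_apply, Pi.add_apply, h1, residual_add, h2]
      abel
  have hyp : ∀ K i, y i - p K i ∈ LogSeries.filt (N + K) := by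
    intro K i
    rw [mem_filt_iff]
    intro β hβ
    have h1 : ∀ k, (single (shift ρ (N + k)) (q k (u k) i)).coeff β =
        if base β = ρ ∧ level β = N + k then q k (u k) i else 0 := by
      intro k
      rw [coeff_single]
      refine if_congr ⟨?_, fun h => ?_⟩ rfl rfl
      · rintro rfl
        exact ⟨hbase _, hlev _⟩
      · rw [eq_shift_of_base_eq h.1, h.2]
    rw [coeff_sub, coeff_sum, Finset.sum_congr rfl fun k _ => h1 k, sub_eq_zero]
    simp only [y, coeff_mk]
    split_ifs with h
    · rw [Finset.sum_eq_single (level β - N), if_pos ⟨h.1, by omega⟩]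
      · intro k _ hk
        rw [if_neg (by omega)]
      · intro hk
        exact absurd (Finset.mem_range.2 (by omega)) hk
    · refine (Finset.sum_eq_zero fun k _ => if_neg fun h' => h ⟨h'.1, by omega⟩).symm
  refine ⟨y, hyl, hyf, funext fun i => ?_⟩
  rw [← sub_eq_zero]
  refine eq_zero_of_forall_mem_filt fun K => filt_anti (Nat.le_add_left K N) ?_
  have h1 : residual A y i - z i = residual A (y - p K) i - u K i := by
    conv_lhs => rw [← hp K]
    rw [residual_sub, Pi.add_apply]
    abel
  rw [h1]
  exact sub_mem (residual_mem_filt (fun j => hyp K j) i) ((hu K).2 i)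

/-- `charpoly` has finitely many roots, so resonances stop at some level `M`. The levels before `M`,
counted by `d`, are treated one at a time with a growing degree bound, the rest by
`exists_residual_eq_of_regular`. -/
theorem exists_residual_eq [DecidableEq ι] {ρ : Expo} (hρ : base ρ = ρ) {n N : ℕ}
    {z : ι → LogSeries} (hz : ∀ i, z i ∈ lattice (bound {ρ} n))
    (hN : ∀ i, z i ∈ LogSeries.filt N) :
    ∃ (n' : ℕ) (y : ι → LogSeries), (∀ i, y i ∈ lattice (bound {ρ} n')) ∧
      (∀ i, y i ∈ LogSeries.filt N) ∧ residual A y = z := by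
  have hfin : ∃ M, ∀ k, M ≤ k →
      ((((shift ρ k).1 : ℂ) + 1) • (1 : Matrix ι ι ℂ) - constMatrix A).det ≠ 0 := by
    have h1 : ∀ c : ℂ, (c • (1 : Matrix ι ι ℂ) - constMatrix A).det =
        (constMatrix A).charpoly.eval c := by
      intro c
      rw [Matrix.eval_charpoly, Matrix.scalar_apply, Matrix.smul_one_eq_diagonal]
    have h2 : {k : ℕ | (constMatrix A).charpoly.eval (((shift ρ k).1 : ℂ) + 1) = 0}.Finite := by
      have h3 := Polynomial.finite_setOfPred_isRoot (Matrix.charpoly_monic (constMatrix A)).ne_zero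
      refine Set.Finite.preimage (f := fun k : ℕ => (((shift ρ k).1 : ℚ) : ℂ) + 1) ?_ h3
      intro k _ l _ h
      have h4 : (((shift ρ k).1 : ℚ) : ℂ) = (((shift ρ l).1 : ℚ) : ℂ) := add_right_cancel h
      have h5 : (shift ρ k).1 = (shift ρ l).1 := by exact_mod_cast h4
      rw [coe_shift, coe_shift] at h5
      exact_mod_cast add_left_cancel h5
    obtain ⟨M, hM⟩ := h2.bddAbove
    refine ⟨M + 1, fun k hk h => ?_⟩
    rw [h1] at h
    have := hM h
    omega
  obtain ⟨M, hM⟩ := hfin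
  obtain ⟨d, hd⟩ : ∃ d, M ≤ N + d := ⟨M, by omega⟩
  induction d generalizing N n z with
  | zero =>
    obtain ⟨y, h⟩ := exists_residual_eq_of_regular (A := A) hρ (fun k => hM (N + k) (by omega)) hz hN
    exact ⟨n, y, h⟩
  | succ d ih =>
    obtain ⟨q, m, h1, -, h3, h4⟩ := exists_residual_step (A := A) hρ hz hN
    obtain ⟨n', y, h5, h6, h7⟩ := ih h3 h4 (by omega)
    have hbase : base (shift ρ N) = ρ := by rw [base_shift, hρ]
    have hlev : level (shift ρ N) = N := by rw [← hρ, level_shift, level_base, zero_add]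
    refine ⟨max n' m, (fun j => single (shift ρ N) (q j)) + y, fun i => ?_, fun i => ?_,
      funext fun i => ?_⟩
    · exact add_mem (single_mem_lattice_bound hbase (degreeLT_mono (le_max_right _ _) (h1 i)))
        (lattice_bound_mono _ (le_max_left _ _) (h5 i))
    · exact add_mem (single_mem_filt hlev.ge _) (filt_anti N.le_succ (h6 i))
    · rw [residual_add, h7]
      exact add_sub_cancel _ _

theorem lattice_bound_le_Xi {ρ : Expo} {n : ℕ} {φ : LogSeries}
    (h : φ ∈ lattice (bound {ρ} n)) : φ ∈ Xi n := by
  refine ⟨{ρ}, fun β => ?_⟩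
  have h1 := h β
  by_cases hb : base β = ρ
  · rw [bound_of_mem (by simp [hb]), mem_degreeLT] at h1
    exact ⟨natDegree_le_iff_degree_le.2 h1.le, fun _ => ⟨ρ, by simp, level β, by
      conv_lhs => rw [eq_shift_of_base_eq hb]
      rfl⟩⟩
  · rw [bound_of_notMem (by simpa using hb)] at h1
    simp [eq_zero_of_mem_degreeLT_zero h1]

/-- A generalized eigenvector `v` of the constant term of a regular singular system, with
eigenvalue `β + 1`, is the constant term of the leading coefficient of a solution. -/
theorem exists_solution [DecidableEq ι] {β : Expo} {v : ι → ℂ} {k : ℕ}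
    (hv : ((constMatrix A - ((β.1 : ℂ) + 1) • (1 : Matrix ι ι ℂ)) ^ k).mulVec v = 0) :
    ∃ (n : ℕ) (y : ι → LogSeries), (∀ i, y i ∈ Xi n) ∧ (∀ i, y i ∈ LogSeries.filt (level β)) ∧
      residual A y = 0 ∧ ∀ i, ((y i).coeff β).coeff 0 = v i := by
  set N := constMatrix A - ((β.1 : ℂ) + 1) • (1 : Matrix ι ι ℂ) with hN
  -- The polynomial `exp(z N) v`, finite because `N^k v = 0`; it satisfies `q' = N q` and `q(0) =
  -- v`.
  let q : ι → ℂ[X] := fun i => ∑ j ∈ Finset.range k, C ((N ^ j).mulVec v i / j.factorial) * X ^ j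
  have hqc : ∀ i j, (q i).coeff j = (N ^ j).mulVec v i / j.factorial := by
    intro i j
    simp only [q, finsetSum_coeff, coeff_C_mul, coeff_X_pow, mul_ite, mul_one, mul_zero,
      Finset.sum_ite_eq, Finset.mem_range]
    split_ifs with h
    · rfl
    · obtain ⟨l, rfl⟩ := Nat.exists_eq_add_of_le (not_lt.1 h)
      rw [add_comm k l, pow_add, ← Matrix.mulVec_mulVec, hv]
      simp
  have hqeq : ∀ i, ((β.1 : ℂ) + 1) • q i + derivative (q i) -
      ∑ j, PowerSeries.constantCoeff (A i j) • q j = 0 := by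
    intro i
    ext m
    have h1 : (derivative (q i)).coeff m = (N ^ (m + 1)).mulVec v i / m.factorial := by
      rw [coeff_derivative, hqc, Nat.factorial_succ]
      have : (m : ℂ) + 1 ≠ 0 := by exact_mod_cast m.succ_ne_zero
      push_cast
      field_simp
    have h2 : (N ^ (m + 1)).mulVec v i = ∑ j, PowerSeries.constantCoeff (A i j) *
        (N ^ m).mulVec v j - ((β.1 : ℂ) + 1) * (N ^ m).mulVec v i := by
      rw [pow_succ', ← Matrix.mulVec_mulVec]
      conv_lhs => rw [hN, Matrix.sub_mulVec, Matrix.smul_mulVec, Matrix.one_mulVec]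
      rfl
    simp only [Polynomial.coeff_sub, Polynomial.coeff_add, Polynomial.coeff_smul, finsetSum_coeff,
      smul_eq_mul, h1, hqc, Polynomial.coeff_zero, h2]
    rw [sub_div, Finset.sum_div]
    simp only [mul_div_assoc]
    ring
  obtain ⟨n, hn⟩ := exists_degreeLT q
  have hb : base β = base β := rfl
  let y₀ : ι → LogSeries := fun i => single β (q i)
  have h0l : ∀ i, y₀ i ∈ lattice (bound {base β} n) := fun i => single_mem_lattice_bound hb (hn i)
  have h0f : ∀ i, y₀ i ∈ LogSeries.filt (level β) := fun i => single_mem_filt le_rfl _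
  have h1 : ∀ i, residual A y₀ i ∈ LogSeries.filt (level β + 1) := by
    intro i
    refine mem_filt_succ (residual_mem_lattice h0l i) (residual_mem_filt h0f i) ?_
    rw [shift_base_level, coeff_residual h0f]
    simp only [y₀, coeff_single_self]
    exact hqeq i
  -- The residual of the leading term begins one level higher, and so does the correction `y₁`; the
  -- coefficient at `β` is left untouched.
  obtain ⟨n', y₁, h2, h3, h4⟩ := exists_residual_eq (A := A) (base_base β)
    (z := fun i => - residual A y₀ i) (fun i => neg_mem (residual_mem_lattice h0l i))
    (fun i => neg_mem (h1 i))
  refine ⟨max n n', y₀ + y₁, fun i => lattice_bound_le_Xi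
    (add_mem (lattice_bound_mono _ (le_max_left _ _) (h0l i))
      (lattice_bound_mono _ (le_max_right _ _) (h2 i))),
    fun i => add_mem (h0f i) (filt_anti (Nat.le_succ _) (h3 i)), funext fun i => ?_, fun i => ?_⟩
  · rw [residual_add, h4]
    simp
  · rw [Pi.add_apply, coeff_add, mem_filt_iff.1 (h3 i) β (Nat.lt_succ_self _), add_zero,
      coeff_single_self, hqc]
    simp

end LogSeries

/-! ### Embedding geometric modules -/

theorem ATilde.aeval_a_mul (P : ℂ[X]) (y : ATilde) : aeval ATilde.a P * y = aeval aMul P y := by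
  induction P using Polynomial.induction_on generalizing y with
  | C r => simp [Algebra.algebraMap_eq_smul_one]
  | add P Q hP hQ => simp [hP, hQ, add_mul]
  | monomial k r ih =>
    rw [pow_succ, ← mul_assoc, map_mul, map_mul _ _ X, aeval_X, aeval_X, mul_assoc, ih, a_mul,
      Module.End.mul_apply]

/-- The remainder carries `b^N` on the left, so its action on any series lands in `filt N`. -/
theorem ATilde.exists_eq_sum_add (x : ATilde) (N : ℕ) :
    ∃ y, x = ∑ ν ∈ Finset.range N, aeval ATilde.a (x.coeff ν) * b ^ ν + b ^ N * y := by
  obtain ⟨y, hy⟩ := exists_eq_b_pow_mul (N := N)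
    (x := x - ∑ ν ∈ Finset.range N, aeval ATilde.a (x.coeff ν) * b ^ ν) (by
      intro m hm
      have hs : ∀ (s : Finset ℕ) (z : ℕ → ATilde),
          (∑ i ∈ s, z i).coeff m = ∑ i ∈ s, (z i).coeff m := fun s z => Finset.sum_apply m s z
      have hb : ∀ ν, b ^ ν = (bMul ^ ν) (1 : ATilde) := by
        intro ν
        induction ν with
        | zero => rfl
        | succ ν ih => rw [pow_succ', pow_succ', ih, b_mul, Module.End.mul_apply]
      rw [ATilde.coeff_sub, hs, sub_eq_zero]
      simp only [aeval_a_mul, coeff_aeval_aMul, hb, coeff_bMul_pow_one, mul_ite, mul_one, mul_zero]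
      rw [Finset.sum_ite_eq, if_pos (Finset.mem_range.2 hm)])
  exact ⟨y, by rw [← hy]; abel⟩

/-- An additive map into the formal series that commutes with `a` and with `ℂ[[b]]` is
`Ã`-linear. -/
theorem map_smul_of_commute {E : Type*} [AddCommGroup E] [Module ATilde E] (f : E →+ LogSeries)
    (hf : ∀ (g : PowerSeries ℂ) (e : E), f (ofB g • e) = ofB g • f e)
    (ha : ∀ e : E, f (ATilde.a • e) = ATilde.a • f e) (x : ATilde) (e : E) :
    f (x • e) = x • f e := by
  let S : Subalgebra ℂ ATilde :=
    { carrier := {x | ∀ e, f (x • e) = x • f e}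
      mul_mem' := fun {x y} hx hy e => by rw [mul_smul, mul_smul, hx, hy]
      add_mem' := fun {x y} hx hy e => by rw [add_smul, add_smul, map_add, hx, hy]
      algebraMap_mem' := fun c e => by rw [← ofB_C]; exact hf _ e }
  have haS : ATilde.a ∈ S := ha
  have hbS : b ∈ S := fun e => by rw [← ofB_X]; exact hf _ e
  rw [← sub_eq_zero]
  refine eq_zero_of_forall_mem_filt fun N => ?_
  obtain ⟨y, hy⟩ := exists_eq_sum_add x N
  have hS : ∑ ν ∈ Finset.range N, aeval ATilde.a (x.coeff ν) * b ^ ν ∈ S :=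
    sum_mem fun ν _ => mul_mem (Algebra.adjoin_le (Set.singleton_subset_iff.2 haS)
      (aeval_mem_adjoin_singleton ℂ ATilde.a)) (pow_mem hbS ν)
  have hbN : ∀ φ : LogSeries, b ^ N • φ ∈ LogSeries.filt N := by
    intro φ
    rw [← X_pow_smul_eq, X_pow_smul]
    have := filt_mem_of_bOp_pow 0 N (φ := φ) (by rw [filt_zero]; trivial)
    rwa [zero_add] at this
  -- The truncation lies in `S`, so the defect of linearity is divisible by `b^N` for every `N`; no
  -- topology on `E` enters.
  have h1 : f (x • e) - x • f e = b ^ N • (f (y • e) - y • f e) := by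
    conv_lhs => rw [hy, add_smul, add_smul, map_add, hS e, mul_smul, mul_smul, pow_mem hbS N]
    rw [smul_sub]
    abel
  rw [h1]
  exact hbN _

/-! ### Injectivity from leading coefficients -/

section injectivity

variable {ι : Type*} [Fintype ι]

/-- The constant terms of the `c i` form a linear form that vanishes on every `v t`, hence is zero.
So all `c i` are divisible by `b`, and by torsion-freeness the quotients satisfy the same relations.
-/
theorem forall_eq_zero_of_combination {T : Type*} {v : T → ι → ℂ} {β : T → Expo}
    {y : T → ι → LogSeries} (hf : ∀ t i, y t i ∈ LogSeries.filt (level (β t)))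
    (hv : ∀ t i, ((y t i).coeff (β t)).coeff 0 = v t i)
    (hspan : Submodule.span ℂ (Set.range v) = ⊤) {c : ι → PowerSeries ℂ}
    (hc : ∀ t, ∑ i, c i • y t i = 0) (i : ι) : c i = 0 := by
  classical
  have h1 : ∀ d : ι → PowerSeries ℂ, (∀ t, ∑ i, d i • y t i = 0) →
      ∀ i, PowerSeries.constantCoeff (d i) = 0 := by
    intro d hd
    let ℓ : (ι → ℂ) →ₗ[ℂ] ℂ := ∑ i, PowerSeries.constantCoeff (d i) • LinearMap.proj i
    have hℓ : ∀ w, ℓ w = ∑ i, PowerSeries.constantCoeff (d i) * w i := by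
      intro w; simp [ℓ]
    have h2 : ℓ = 0 := by
      refine LinearMap.ext_on_range hspan fun t => ?_
      have h3 := congrArg (fun φ : LogSeries => (φ.coeff (β t)).coeff 0) (hd t)
      simp only [coeff_sum, finsetSum_coeff, LogSeries.coeff_zero, Polynomial.coeff_zero] at h3
      rw [hℓ, LinearMap.zero_apply, ← h3]
      refine Finset.sum_congr rfl fun i _ => ?_
      rw [coeff_smul_of_mem_filt _ (hf t i), Polynomial.coeff_smul, hv, smul_eq_mul]
    intro i
    have h4 := hℓ (Pi.single i 1)
    rw [h2] at h4
    simpa [Pi.single_apply] using h4.symm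
  have h2 : ∀ k, ∃ d : ι → PowerSeries ℂ, ∀ i, c i = PowerSeries.X ^ k * d i := by
    intro k
    induction k with
    | zero => exact ⟨c, by simp⟩
    | succ k ih =>
      obtain ⟨d, hd⟩ := ih
      have h3 := h1 d fun t => by
        have h4 := hc t
        simp only [hd, mul_smul, ← Finset.smul_sum] at h4
        exact (smul_eq_zero.1 h4).resolve_left (pow_ne_zero k PowerSeries.X_ne_zero)
      choose g hg using fun i => PowerSeries.X_dvd_iff.2 (h3 i)
      exact ⟨g, fun i => by rw [hd, hg, pow_succ, mul_assoc]⟩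
  refine PowerSeries.ext fun m => ?_
  obtain ⟨d, hd⟩ := h2 (m + 1)
  rw [hd, map_zero]
  exact PowerSeries.X_pow_dvd_iff.1 (dvd_mul_right _ _) m m.lt_succ_self

end injectivity

/-! ### From a basis of `E^♯` to maps into formal series -/

section embedding

variable {E : Type*} [AddCommGroup E] [Module ATilde E]

/-- This makes `E^♯`, of finite type over a principal ideal domain, free, so that it has a basis. -/
theorem isTorsionFree_BInv (hE : IsABModule E) : Module.IsTorsionFree (PowerSeries ℂ) (BInv E) := by
  have := hE.1
  refine Module.IsTorsionFree.of_smul_eq_zero fun f y h => ?_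
  induction y using LocalizedModule.induction_on with | _ x s
  rw [LocalizedModule.smul'_mk] at h
  obtain ⟨u, hu⟩ := LocalizedModule.mk_eq.1 (h.trans (LocalizedModule.zero_mk s).symm)
  have hne : ∀ s : Submonoid.powers (PowerSeries.X : PowerSeries ℂ), (s : PowerSeries ℂ) ≠ 0 := by
    rintro ⟨_, k, rfl⟩
    exact pow_ne_zero k PowerSeries.X_ne_zero
  simp only [Submonoid.smul_def, smul_zero, smul_eq_zero, hne, false_or] at hu
  rcases hu with hu | hu
  · exact Or.inl hu
  · exact Or.inr (by rw [hu, LocalizedModule.zero_mk])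

variable {ι : Type*} [Fintype ι]

/-- The matrix of `b⁻¹ a` on `E^♯`. -/
theorem exists_matrix (e : Module.Basis ι (PowerSeries ℂ) (saturation E)) :
    ∃ A : ι → ι → PowerSeries ℂ, ∀ i, theta E (e i) = ∑ j, A i j • (e j : BInv E) := by
  refine ⟨fun i j => e.repr ⟨_, theta_mem_saturation (e i).2⟩ j, fun i => ?_⟩
  have h := congrArg (saturation E).subtype (e.sum_repr ⟨_, theta_mem_saturation (e i).2⟩)
  rw [map_sum] at h
  exact h.symm

variable {e : Module.Basis ι (PowerSeries ℂ) (saturation E)} {A : ι → ι → PowerSeries ℂ}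

theorem theta_sum (hA : ∀ i, theta E (e i) = ∑ j, A i j • (e j : BInv E)) (c : ι → PowerSeries ℂ) :
    theta E (∑ i, c i • (e i : BInv E)) =
      ∑ i, (∑ j, c j * A j i + PowerSeries.X * PowerSeries.derivative ℂ (c i)) • (e i : BInv E) := by
  simp only [map_sum, theta_smul, hA, add_smul, Finset.sum_add_distrib, Finset.smul_sum, smul_smul,
    Finset.sum_smul]
  rw [Finset.sum_comm]

/-- Row `i` of `A` expresses `b⁻¹ a e_i`, so a left eigenvector `u` of `A(0)` gives the eigenvector
`∑ u_i e_i`; it is not in `b E^♯` since `u ≠ 0` is constant. -/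
theorem isSharpEigenvalue_of_det [DecidableEq ι]
    (hA : ∀ i, theta E (e i) = ∑ j, A i j • (e j : BInv E))
    {lam : ℂ} (h : (constMatrix A - lam • (1 : Matrix ι ι ℂ)).det = 0) : IsSharpEigenvalue E lam := by
  obtain ⟨u, hu0, hu⟩ := Matrix.exists_vecMul_eq_zero_iff.2 h
  have hrepr : ∀ c : ι → PowerSeries ℂ, ∑ i, c i • (e i : BInv E) ∈ saturation E := fun c =>
    sum_mem fun i _ => Submodule.smul_mem _ _ (e i).2
  refine ⟨∑ i, (PowerSeries.C (u i) : PowerSeries ℂ) • (e i : BInv E), hrepr _, ?_, ?_⟩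
  · rintro ⟨y, hy, h1⟩
    refine hu0 (funext fun i => ?_)
    have h2 : ∑ i, (PowerSeries.C (u i) : PowerSeries ℂ) • e i =
        (PowerSeries.X : PowerSeries ℂ) • (⟨y, hy⟩ : saturation E) :=
      Subtype.ext (by simpa using h1)
    have h3 := congrArg (fun z => PowerSeries.constantCoeff (e.repr z i)) h2
    simp only [e.repr_sum_self, map_smul, Finsupp.smul_apply, smul_eq_mul, map_mul,
      PowerSeries.constantCoeff_X, zero_mul, PowerSeries.constantCoeff_C] at h3
    simpa using h3
  · have h1 : ∀ i, ∃ g : PowerSeries ℂ,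
        ∑ j, PowerSeries.C (u j) * A j i - PowerSeries.C lam * PowerSeries.C (u i) =
          PowerSeries.X * g := by
      intro i
      refine PowerSeries.X_dvd_iff.2 ?_
      have h2 := congrFun hu i
      rw [Matrix.vecMul_sub, Matrix.vecMul_smul, Matrix.vecMul_one] at h2
      simpa [constMatrix, Matrix.vecMul, dotProduct] using h2
    choose g hg using h1
    refine ⟨∑ i, g i • (e i : BInv E), hrepr _, ?_⟩
    rw [theta_sum hA, Finset.smul_sum, Finset.smul_sum, ← Finset.sum_sub_distrib]
    refine Finset.sum_congr rfl fun i _ => ?_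
    rw [smul_smul, smul_smul, ← sub_smul, ← hg, PowerSeries.derivative_C, mul_zero, add_zero]

/-- The map from `E` to the formal series defined by a solution of the system. -/
theorem exists_linearMap_of_residual
    (hA : ∀ i, theta E (e i) = ∑ j, A i j • (e j : BInv E)) {y : ι → LogSeries}
    (hy : residual A y = 0) :
    ∃ f : E →ₗ[ATilde] LogSeries, ∀ x : E,
      f x = ∑ i, e.repr ⟨_, mk_mem_saturation x⟩ i • y i := by
  have hθ : ∀ i, thetaOp (y i) = ∑ j, A i j • y j := fun i => sub_eq_zero.1 (congrFun hy i)
  let F : saturation E →ₗ[PowerSeries ℂ] LogSeries := e.constr ℕ y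
  have hF : ∀ z, F z = ∑ i, e.repr z i • y i := fun z => e.constr_apply_fintype ℕ y z
  -- The system says that `F` intertwines `b⁻¹ a` with `θ` on the basis; the two Leibniz rules
  -- extend this to all of `E^♯`.
  have hFθ : ∀ z : saturation E, F ⟨_, theta_mem_saturation z.2⟩ = thetaOp (F z) := by
    intro z
    have h1 : (⟨_, theta_mem_saturation z.2⟩ : saturation E) =
        ∑ i, (∑ j, e.repr z j * A j i +
          PowerSeries.X * PowerSeries.derivative ℂ (e.repr z i)) • e i := by
      refine Subtype.ext ?_
      have h2 := theta_sum hA (e.repr z)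
      have h3 : ∑ i, e.repr z i • (e i : BInv E) = z := by
        have h4 := congrArg (saturation E).subtype (e.sum_repr z)
        rwa [map_sum] at h4
      rw [h3] at h2
      simpa using h2
    rw [h1, hF z, hF]
    simp only [e.repr_sum_self]
    simp only [map_sum, thetaOp_smul, hθ, add_smul, Finset.sum_add_distrib,
      Finset.smul_sum, smul_smul, Finset.sum_smul]
    rw [Finset.sum_comm]
  let f : E →+ LogSeries :=
    { toFun := fun x => F ⟨_, mk_mem_saturation x⟩
      map_zero' := by
        rw [← map_zero F]
        congr 1
        exact Subtype.ext (LocalizedModule.zero_mk 1)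
      map_add' := fun x z => by
        rw [← map_add]
        congr 1
        exact Subtype.ext (LocalizedModule_mk_add x z 1) }
  have hfB : ∀ (g : PowerSeries ℂ) (x : E), f (ofB g • x) = ofB g • f x := by
    intro g x
    rw [← smul_eq g (f x)]
    refine Eq.trans ?_ (map_smul F g _)
    refine congrArg F (Subtype.ext ?_)
    exact (LocalizedModule.smul'_mk g x 1).symm
  have hfa : ∀ x : E, f (ATilde.a • x) = ATilde.a • f x := by
    intro x
    rw [a_smul, ← bOp_thetaOp, ← X_smul]
    change _ = (PowerSeries.X : PowerSeries ℂ) • thetaOp (F ⟨_, mk_mem_saturation x⟩)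
    rw [← hFθ, ← map_smul]
    refine congrArg F (Subtype.ext ?_)
    exact (X_smul_theta_mk x).symm
  exact ⟨{ f with map_smul' := fun x z => map_smul_of_commute f hfB hfa x z }, fun x => hF _⟩

/-- Over `ℂ` the generalized eigenspaces span. The zero vector is discarded because it would satisfy
the condition for every `lam`, eigenvalue or not. -/
theorem exists_finite_generalized_eigenvectors [DecidableEq ι] (M : Matrix ι ι ℂ) :
    ∃ s : Finset (ι → ℂ), Submodule.span ℂ (s : Set (ι → ℂ)) = ⊤ ∧
      ∀ v ∈ s, v ≠ 0 ∧ ∃ (lam : ℂ) (k : ℕ), ((M - lam • (1 : Matrix ι ι ℂ)) ^ k).mulVec v = 0 := by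
  classical
  let G : Set (ι → ℂ) := {v | ∃ (lam : ℂ) (k : ℕ), ((M - lam • (1 : Matrix ι ι ℂ)) ^ k).mulVec v = 0}
  have h1 : Submodule.span ℂ G = ⊤ := by
    rw [eq_top_iff, ← Module.End.iSup_maxGenEigenspace_eq_top (Matrix.toLin' M)]
    refine iSup_le fun lam v hv => Submodule.subset_span ⟨lam, ?_⟩
    obtain ⟨k, hk⟩ := (Module.End.mem_maxGenEigenspace _ _ _).1 hv
    refine ⟨k, ?_⟩
    rw [← hk, ← Matrix.toLin'_apply, Matrix.toLin'_pow, map_sub, map_smul, Matrix.toLin'_one]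
    rfl
  obtain ⟨s, hs, hs'⟩ := (Submodule.fg_span_iff_fg_span_finset_subset G).1 (by
    rw [h1]; exact Module.Finite.fg_top)
  refine ⟨s.erase 0, ?_, fun v hv => ⟨(Finset.mem_erase.1 hv).1, hs (Finset.mem_erase.1 hv).2⟩⟩
  rw [Finset.coe_erase, Submodule.span_sdiff_singleton_zero, ← hs', h1]

theorem Xi_mono {m n : ℕ} (h : m ≤ n) : Xi m ≤ Xi n := fun _ ⟨A, hA⟩ =>
  ⟨A, fun α => ⟨(hA α).1.trans h, (hA α).2⟩⟩

/-- A family of maps to `Ξ_n` as one map to `Ξ_n ⊗ ℂ^T`. -/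
theorem exists_injective_of_family {n : ℕ} {T : Type} [Fintype T] [DecidableEq T]
    (f : T → E →ₗ[ATilde] Xi n) (hf : ∀ x, (∀ t, f t x = 0) → x = 0) :
    ∃ F : E →ₗ[ATilde] (Xi n ⊗[ℂ] (T → ℂ)), Function.Injective F := by
  let F : E →ₗ[ATilde] (Xi n ⊗[ℂ] (T → ℂ)) :=
    { toFun := fun x => ∑ t, f t x ⊗ₜ Pi.single t (1 : ℂ)
      map_add' := fun x z => by
        simp only [map_add, TensorProduct.add_tmul, Finset.sum_add_distrib]
      map_smul' := fun c x => by
        simp only [map_smul, RingHom.id_apply, Finset.smul_sum, TensorProduct.smul_tmul'] }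
  refine ⟨F, (injective_iff_map_eq_zero F).2 fun x hx => hf x fun t => ?_⟩
  -- Contracting with the `t`-th coordinate form recovers `f t x`.
  have h1 := congrArg (fun z => TensorProduct.rid ℂ (Xi n)
    (LinearMap.lTensor (Xi n) (LinearMap.proj t : (T → ℂ) →ₗ[ℂ] ℂ) z)) hx
  simpa [F, Pi.single_apply] using h1

theorem IsRegularGeometric.exists_embedding (hE : IsRegularGeometric E) :
    ∃ (n : ℕ) (V : Type) (_ : AddCommGroup V) (_ : Module ℂ V), FiniteDimensional ℂ V ∧
      ∃ f : E →ₗ[ATilde] (Xi n ⊗[ℂ] V), Function.Injective f := by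
  classical
  obtain ⟨⟨hAB, hfg⟩, hgeo⟩ := hE
  have := isTorsionFree_BInv hAB
  have : Module.Finite (PowerSeries ℂ) (saturation E) := Module.Finite.iff_fg.2 hfg
  let e := Module.Free.chooseBasis (PowerSeries ℂ) (saturation E)
  obtain ⟨A, hA⟩ := exists_matrix e
  obtain ⟨s, hs, hsv⟩ := exists_finite_generalized_eigenvectors (constMatrix A)
  have hsol : ∀ v : s, ∃ (β : Expo) (n : ℕ) (f : E →ₗ[ATilde] LogSeries)
      (y : Module.Free.ChooseBasisIndex (PowerSeries ℂ) (saturation E) → LogSeries),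
      (∀ i, y i ∈ Xi n) ∧ (∀ i, y i ∈ LogSeries.filt (level β)) ∧
      (∀ i, ((y i).coeff β).coeff 0 = v.1 i) ∧
      ∀ x, f x = ∑ i, e.repr ⟨_, mk_mem_saturation x⟩ i • y i := by
    rintro ⟨v, hv⟩
    obtain ⟨hv0, lam, k, hk⟩ := hsv v hv
    have h1 := Matrix.exists_mulVec_eq_zero_iff.1 ⟨v, hv0, hk⟩
    rw [Matrix.det_pow] at h1
    obtain ⟨q, hq, rfl⟩ := hgeo lam (isSharpEigenvalue_of_det hA (eq_zero_of_pow_eq_zero h1))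
    -- Positivity of the eigenvalue `q` is exactly what makes `q - 1` an admissible exponent.
    have hβ : (((⟨q - 1, by linarith⟩ : Expo).1 : ℂ) + 1) = q := by push_cast; ring
    rw [← hβ] at hk
    obtain ⟨n, y, hy1, hy2, hy3, hy4⟩ := exists_solution hk
    obtain ⟨f, hf⟩ := exists_linearMap_of_residual hA hy3
    exact ⟨_, n, f, y, hy1, hy2, hy4, hf⟩
  choose β n f y hyn hyβ hyv hfy using hsol
  let N := Finset.univ.sup n
  have hfN : ∀ v x, f v x ∈ Xi N := by
    intro v x
    rw [hfy]
    refine sum_mem fun i _ => ?_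
    rw [smul_eq]
    exact (Xi N).smul_mem _ (Xi_mono (Finset.le_sup (Finset.mem_univ v)) (hyn v i))
  -- The eigenvectors are reindexed by `Fin s.card`, since `V` must live in `Type` whereas `s` may
  -- not.
  obtain ⟨F, hF⟩ := exists_injective_of_family
    (fun t => (f (s.equivFin.symm t)).codRestrict (Xi N) (hfN _)) fun x hx => by
      have h1 : ∀ v : s, ∑ i, e.repr ⟨_, mk_mem_saturation x⟩ i • y v i = 0 := by
        intro v
        have h2 := congrArg Subtype.val (hx (s.equivFin v))
        rw [LinearMap.codRestrict_apply, Equiv.symm_apply_apply, hfy] at h2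
        exact h2
      have h2 := forall_eq_zero_of_combination (v := fun v : s => v.1) hyβ hyv
        (by rw [Subtype.range_coe_subtype]; exact hs) h1
      have h3 : (⟨_, mk_mem_saturation x⟩ : saturation E) = 0 :=
        e.repr.map_eq_zero_iff.1 (Finsupp.ext h2)
      -- That `x / 1 = 0` means that a power of `b` kills `x`, and `E` is free.
      obtain ⟨⟨_, k, rfl⟩, hu⟩ := LocalizedModule.mk_eq.1
        ((congrArg Subtype.val h3).trans (LocalizedModule.zero_mk 1).symm)
      have := hAB.1
      simp only [Submonoid.smul_def, smul_zero, one_smul] at hu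
      exact (smul_eq_zero.1 hu).resolve_left (pow_ne_zero k PowerSeries.X_ne_zero)
  exact ⟨N, Fin s.card → ℂ, inferInstance, inferInstance, inferInstance, F, hF⟩

end embedding

end
end AB

theorem mainTheorem4 :
    -- the module generated by `φ` is a monogenic geometric regular (a,b)-module
    (∀ (n : ℕ) (φ : LogSeries), φ ∈ Xi n →
      IsMonogenic (Submodule.span ATilde {φ}) ∧
      IsRegularGeometric (Submodule.span ATilde {φ})) ∧
    -- polynomial generator, indexed by the index set of the canonical writing of `φ`
    (∀ (n : ℕ) (φ : LogSeries), φ ∈ Xi n →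
      ∃ (A : Finset (Expo × ℕ)) (S : Expo → ℕ → PowerSeries ℂ), IsCanonicalWriting n φ A S ∧
        ∃ T : Expo → ℕ → Polynomial ℂ,
          (∀ α j, (α, j) ∈ A → (T α j).eval 0 ≠ 0) ∧
          ∃ ψ ∈ Xi n,
            ψ = ∑ p ∈ A, ATilde.ofB (T p.1 p.2 : PowerSeries ℂ) • logMono p.1 p.2 ∧
            Nonempty (Submodule.span ATilde {ψ} ≃ₗ[ATilde] Submodule.span ATilde {φ})) ∧
    -- every geometric regular (a,b)-module embeds into some `Ξ_n ⊗ V`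
    (∀ (E : Type*) [AddCommGroup E] [Module ATilde E], IsRegularGeometric E →
      ∃ (n : ℕ) (V : Type) (_ : AddCommGroup V) (_ : Module ℂ V), FiniteDimensional ℂ V ∧
        ∃ f : E →ₗ[ATilde] (Xi n ⊗[ℂ] V), Function.Injective f) :=
  ⟨fun _ _ h => span_isMonogenic_isRegularGeometric h,
    fun _ _ h => LogSeries.exists_canonicalWriting_polynomial_generator h,
    fun _ _ _ hE => hE.exists_embedding⟩
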